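/- Conventions. A graded manifold $M$ is a smooth manifold (its body) with a sheaf $C^\infty_M$ of $\mathbb N$-graded, graded commutative $\mathbb R$-algebras whose degree-zero part consists of the smooth functions and which is locally freely generated over it by finitely many generators of positive degrees. Vector fields of degree $k$ are degree-$k$ derivations, $[\cdot,\cdot]$ is the graded commutator, and $\Omega(M)$ is the bigraded algebra of differential forms, with total degree (form degree plus weight), de Rham differential $d$, contractions $\iota_X$ and Lie derivatives $L_X$. A Q-manifold is a graded manifold with a vector field $Q$ of degree $1$ such that $Q^2=0$; put $Q_{TM}=d+L_Q$ on $\Omega(M)$. Let $F$ be a Q-manifold and let $\mathcal G$ be a graded space of vector fields of negative degrees on $F$ that is closed under the bracket and under the derived bracket $(\varepsilon,\varepsilon')\mapsto[[\varepsilon,Q_F],\varepsilon']$ (the holonomy algebra). A form $\omega\in\Omega(F)$ is $\mathcal G$-basic if $L_\varepsilon\omega=0$ and $L_{[Q_F,\varepsilon]}\omega=0$ for all $\varepsilon\in\mathcal G$; $\Omega(F)_{\mathcal G}$ denotes the space of these forms. A Q-bundle $\pi\colon M\to N$ with typical fiber $F$ and holonomy algebra $\mathcal G$ is a surjective morphism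 of Q-manifolds with an open cover $(U_i)$ of $N$ and isomorphisms of Q-manifolds $\pi^{-1}(U_i)\cong U_i\times F$ over $U_i$ such that the transition over $U_i\cap U_j$ lies in the group generated by the time-one flows of the degree-zero vector fields $[Q,Y]$, where $Y=\sum_k b^k\varepsilon_k$ has degree $-1$, $b^k\in C^\infty(U_i\cap U_j)$, $\varepsilon_k\in\mathcal G$. A gauge field is a section $\varphi\colon N\to M$ of $\pi$ in the category of graded manifolds ($\varphi$ need not respect $Q$). Its field strength $f$ is given by the algebra morphism $f^*\colon\Omega(M)\to C^\infty(N)$ with $f^*(h)=\varphi^*h$ and $f^*(dh)=Q_N\varphi^*h-\varphi^*Q_Mh$. **Theorem.** Let $\pi\colon M\to N$ be a Q-bundle with typical fiber $F$ and holonomy algebra $\mathcal G$. 1. Let $\varphi$ be a gauge field and $p\ge 0$. For every $\mathcal G$-basic form $\omega$ on $F$ of total degree $p$ there is a unique function $\operatorname{char}_\varphi(\omega)\in C^\infty(N)$ of degree $p$ whose restriction to each $U_i$ is $f^*$ of the trivial extension of $\omega$ to $\pi^{-1}(U_i)\cong U_i\times F$. This induces a well-defined linear map $$\chi_\varphi\colon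 H^p(\Omega(F)_{\mathcal G},Q_{TF})\to H^p(C^\infty(N),Q_N),\qquad[\omega]\mapsto[\operatorname{char}_\varphi(\omega)].$$ 2. If $\varphi_0$ and $\varphi_1$ are joined by a smooth family of gauge fields $\varphi_t$, $t\in[0,1]$, then $\chi_{\varphi_0}=\chi_{\varphi_1}$. 3. Let $\mathsf p\colon P\to X$ be a principal bundle with structure Lie group $K$ and Lie algebra $\mathfrak k$. Suppose that the Q-bundle is its Atiyah algebroid $T[1]P/K\to T[1]X$, with fiber $\mathfrak k[1]$ (linear coordinates $\xi^a$, $Q\xi^c=-\tfrac12C^c_{ab}\xi^a\xi^b$), holonomy algebra $\mathfrak k$ acting by contractions, and local trivializations coming from local sections $s_i$ of $P$ over $U_i$. Let $q\ge 0$. Then there are no nonzero basic forms of degree $2q+1$, and the basic forms of degree $2q$ are exactly the forms $$\hat w=\tfrac1{q!}\,w_{a_1\dots a_q}\,d\xi^{a_1}\cdots d\xi^{a_q},$$ where $w$ is a symmetric $\operatorname{ad}$-invariant $q$-linear form on $\mathfrak k$; $w$ is uniquely determined by $\hat w$, and $\hat w$ is $Q_{TF}$-closed. If $\varphi\colon T[1]X\to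 T[1]P/K$ is the horizontal lift of a connection $\theta$ on $P$ with curvature $\Omega=d\theta+\tfrac12[\theta,\theta]$, then $\chi_\varphi[\hat w]$ is the class in $H^{2q}_{dR}(X)$ of the Chern–Weil form of $w$, namely of the closed $2q$-form $c$ with $c|_{U_i}=\tfrac1{q!}\,s_i^*\,w(\Omega,\dots,\Omega)$ for all $i$; any form $c'$ on $X$ with $\mathsf p^*c'=\tfrac1{q!}\,w(\Omega,\dots,\Omega)$ equals $c$. -/

import Mathlib

open scoped Manifold ContDiff
open TopologicalSpace (Opens)

universe u

/-- A smooth manifold `Body` (Hausdorff, second countable, of dimension `dim`) with a sheaf `Fn` of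
`ℕ`-graded, graded-commutative real algebras whose part of degree zero is the sheaf of smooth
functions on `Body` (through `ofSmooth`). The sheaf condition is imposed in each degree. -/
structure GradedSpace where
  Body : Type u
  dim : ℕ
  [topology : TopologicalSpace Body]
  [charted : ChartedSpace (EuclideanSpace ℝ (Fin dim)) Body]
  [manifold : IsManifold (𝓡 dim) ∞ Body]
  [t2 : T2Space Body]
  [secondCountable : SecondCountableTopology Body]
  Fn : Opens Body → Type u
  [ring : ∀ U, Ring (Fn U)]
  [algebra : ∀ U, Algebra ℝ (Fn U)]
  deg : ∀ U, ℕ → Submodule ℝ (Fn U)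
  [graded : ∀ U, GradedAlgebra (deg U)]
  comm : ∀ {U : Opens Body} {i j : ℕ} {a b : Fn U}, a ∈ deg U i → b ∈ deg U j →
    a * b = (-1 : ℝ) ^ (i * j) • (b * a)
  res : ∀ {U V : Opens Body}, V ≤ U → (Fn U →ₐ[ℝ] Fn V)
  res_deg : ∀ {U V : Opens Body} (h : V ≤ U) {i : ℕ} {a : Fn U}, a ∈ deg U i → res h a ∈ deg V i
  res_self : ∀ {U : Opens Body} (a : Fn U), res le_rfl a = a
  res_res : ∀ {U V W : Opens Body} (h : V ≤ U) (h' : W ≤ V) (a : Fn U),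
    res h' (res h a) = res (h'.trans h) a
  ofSmooth : ∀ U : Opens Body, C^∞⟮𝓡 dim, U; 𝓘(ℝ, ℝ), ℝ⟯ →ₐ[ℝ] Fn U
  ofSmooth_injective : ∀ U, Function.Injective (ofSmooth U)
  mem_deg_zero : ∀ {U : Opens Body} {a : Fn U}, a ∈ deg U 0 ↔ ∃ f, ofSmooth U f = a
  res_ofSmooth : ∀ {U V : Opens Body} (h : V ≤ U) (f : C^∞⟮𝓡 dim, U; 𝓘(ℝ, ℝ), ℝ⟯),
    res h (ofSmooth U f) = ofSmooth V (ContMDiffMap.restrictRingHom (𝓡 dim) 𝓘(ℝ, ℝ) ℝ h f)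
  glue : ∀ (k : ℕ) (S : Set (Opens Body)) (s : ∀ V : S, Fn V.1), (∀ V, s V ∈ deg V.1 k) →
    (∀ V W : S, res (inf_le_left : V.1 ⊓ W.1 ≤ V.1) (s V) = res inf_le_right (s W)) →
    ∃! a : Fn (sSup S), a ∈ deg (sSup S) k ∧ ∀ V : S, res (le_sSup V.2) a = s V

attribute [instance] GradedSpace.topology GradedSpace.charted GradedSpace.manifold
  GradedSpace.t2 GradedSpace.secondCountable GradedSpace.ring GradedSpace.algebra
  GradedSpace.graded

namespace GradedSpace

/-- Smooth functions on an open subset of the body. -/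
abbrev Smooth (M : GradedSpace.{u}) (U : Opens M.Body) : Type u :=
  C^∞⟮𝓡 M.dim, U; 𝓘(ℝ, ℝ), ℝ⟯

/-- Exponents of a monomial in generators of degrees `d`: odd generators occur at most once. -/
abbrev Exponent {m : ℕ} (d : Fin m → ℕ) : Type :=
  {μ : Fin m → ℕ // ∀ j, Odd (d j) → μ j ≤ 1}

variable (M : GradedSpace.{u})

/-- The ordered monomial `ξ₁ ^ μ₁ ⋯ ξ_m ^ μ_m`. -/
def monomial {U : Opens M.Body} {m : ℕ} (ξ : Fin m → M.Fn U) (μ : Fin m → ℕ) : M.Fn U :=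
  (List.ofFn fun j => ξ j ^ μ j).prod

/-- `ξ₁, …, ξ_m`, of positive degrees `d₁, …, d_m`, are graded coordinates over `U`: over every open
`V ⊆ U` the functions are freely generated by them, i.e. each function is in a unique way a
combination of the monomials in the `ξ_j` with smooth coefficients. -/
structure IsGenerating (U : Opens M.Body) {m : ℕ} (d : Fin m → ℕ) (ξ : Fin m → M.Fn U) :
    Prop where
  pos : ∀ j, 0 < d j
  mem : ∀ j, ξ j ∈ M.deg U (d j)
  existsUnique : ∀ (V : Opens M.Body) (h : V ≤ U) (a : M.Fn V),
    ∃! c : Exponent d →₀ M.Smooth V,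
      a = c.sum fun μ f => M.ofSmooth V f * M.res h (M.monomial ξ μ)

end GradedSpace

/-- A (non-negatively) graded manifold: locally the functions are the free graded-commutative
algebra, over the smooth functions on the body, on finitely many generators of fixed positive
degrees `genDeg`. -/
structure GradedManifold extends GradedSpace.{u} where
  genCount : ℕ
  genDeg : Fin genCount → ℕ
  exists_generating : ∀ x : Body, ∃ (U : Opens Body) (ξ : Fin genCount → Fn U),
    x ∈ U ∧ toGradedSpace.IsGenerating U genDeg ξ

namespace GradedManifold

variable (M : GradedManifold.{u})

/-- A vector field of degree `k` over `U`: a derivation of degree `k` of the algebra of functions.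
(Functions of negative degree are zero.) -/
structure IsDerivation (U : Opens M.Body) (k : ℤ) (X : M.Fn U →ₗ[ℝ] M.Fn U) : Prop where
  map_deg : ∀ {i j : ℕ}, (j : ℤ) = i + k → ∀ {a}, a ∈ M.deg U i → X a ∈ M.deg U j
  map_neg : ∀ {i : ℕ}, (i : ℤ) + k < 0 → ∀ {a}, a ∈ M.deg U i → X a = 0
  leibniz : ∀ {i : ℕ} {a}, a ∈ M.deg U i → ∀ b,
    X (a * b) = X a * b + (-1 : ℝ) ^ (k * i) • (a * X b)

variable {M}

/-- The smooth function `g (h₁, …, h_r)`. -/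
noncomputable def smoothComp {U : Opens M.Body} {r : ℕ} (g : (Fin r → ℝ) → ℝ) (hg : ContDiff ℝ ∞ g)
    (h : Fin r → M.Smooth U) : M.Smooth U :=
  ⟨fun x => g fun i => h i x,
    hg.contMDiff.comp (contMDiff_pi_space.2 fun i => (h i).contMDiff)⟩

/-- The partial derivative `∂g/∂yᵢ`. -/
noncomputable def partialDeriv {r : ℕ} (g : (Fin r → ℝ) → ℝ) (i : Fin r) (y : Fin r → ℝ) : ℝ :=
  fderiv ℝ g y (Pi.single i 1)

theorem partialDeriv_contDiff {r : ℕ} {g : (Fin r → ℝ) → ℝ} (hg : ContDiff ℝ ∞ g) (i : Fin r) :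
    ContDiff ℝ ∞ (partialDeriv g i) :=
  (hg.fderiv_right (m := ∞) (by simp)).clm_apply contDiff_const

open MeasureTheory in
theorem contDiff_integral_zero_one {E : Type} [NormedAddCommGroup E] [NormedSpace ℝ E]
    {g : E × ℝ → ℝ} (hg : ContDiff ℝ ∞ g) : ContDiff ℝ ∞ fun y => ∫ t in (0:ℝ)..1, g (y, t) := by
  let b : ContDiffBump (0 : ℝ) := ⟨2, 3, by norm_num, by norm_num⟩
  let k : E → ℝ → ℝ := fun y t => b t * g (y, t)
  let f : ℝ → ℝ := Set.indicator (Set.Ico (-1) 0) 1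
  have hf : LocallyIntegrable f volume := by
    apply Integrable.locallyIntegrable
    exact (integrable_indicator_iff measurableSet_Ico).2
      (integrableOn_const (C := (1:ℝ)) (by simp))
  have key := contDiffOn_convolution_right_with_param (n := ⊤) (f := f) (μ := volume)
    (ContinuousLinearMap.mul ℝ ℝ) (g := k) (s := Set.univ) (k := Metric.closedBall 0 3)
    isOpen_univ (isCompact_closedBall 0 3) (by
      intro y t _ ht
      have : b t = 0 := b.zero_of_le_dist (le_of_lt (by simpa using ht))
      simp [k, this]) hf (by
      apply ContDiff.contDiffOn
      exact (b.contDiff.comp contDiff_snd).mul hg)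
  rw [Set.univ_prod_univ, contDiffOn_univ] at key
  have h2 := key.comp (contDiff_id.prodMk (contDiff_const (c := (0:ℝ))) : ContDiff ℝ ∞ fun y : E => (y, (0:ℝ)))
  convert h2 using 1
  ext y
  simp only [Function.comp, convolution]
  have : ∀ t, (ContinuousLinearMap.mul ℝ ℝ) (f t) (k (y,(0:ℝ)).1 ((y,(0:ℝ)).2 - t))
     = Set.indicator (Set.Ico (-1:ℝ) 0) (fun t => g (y, - t)) t := by
    intro t
    by_cases ht : t ∈ Set.Ico (-1:ℝ) 0
    · have hb : b (-t) = 1 := b.one_of_mem_closedBall (by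
        simp only [Metric.mem_closedBall, dist_zero_right, norm_neg, Real.norm_eq_abs, b]
        rw [abs_le]; constructor <;> linarith [ht.1, ht.2])
      simp [f, k, ht, hb]
    · simp [f, k, ht]
  simp only [id] at *
  rw [integral_congr_ae (Filter.Eventually.of_forall this), integral_indicator measurableSet_Ico,
    integral_Ico_eq_integral_Ioc, ← intervalIntegral.integral_of_le (by norm_num),
    intervalIntegral.integral_comp_neg fun t => g (y, t)]
  simp

theorem hadamard {r : ℕ} {g : (Fin r → ℝ) → ℝ} (hg : ContDiff ℝ ∞ g) (y₀ : Fin r → ℝ) :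
    ∃ G : Fin r → (Fin r → ℝ) → ℝ, (∀ i, ContDiff ℝ ∞ (G i)) ∧
      (∀ i, G i y₀ = partialDeriv g i y₀) ∧
      ∀ y, g y = g y₀ + ∑ i, (y i - y₀ i) * G i y := by
  have hc : ∀ i, ContDiff ℝ ∞ fun p : (Fin r → ℝ) × ℝ =>
      partialDeriv g i (y₀ + p.2 • (p.1 - y₀)) := fun i =>
    (partialDeriv_contDiff hg i).comp (by fun_prop)
  refine ⟨fun i y => ∫ t in (0:ℝ)..1, partialDeriv g i (y₀ + t • (y - y₀)),
    fun i => contDiff_integral_zero_one (hc i), fun i => by simp, fun y => ?_⟩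
  have hd : ∀ t ∈ Set.uIcc (0:ℝ) 1, HasDerivAt (fun t : ℝ => g (y₀ + t • (y - y₀)))
      (∑ i, (y i - y₀ i) * partialDeriv g i (y₀ + t • (y - y₀))) t := by
    intro t _
    have h1 : HasDerivAt (fun t : ℝ => y₀ + t • (y - y₀)) (y - y₀) t := by
      simpa using ((hasDerivAt_id t).smul_const (y - y₀)).const_add y₀
    have h2 := (hg.differentiable (by simp) (y₀ + t • (y - y₀))).hasFDerivAt.comp_hasDerivAt t h1
    have h3 : ∀ (L : (Fin r → ℝ) →L[ℝ] ℝ) (w : Fin r → ℝ),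
        L w = ∑ i, w i * L (Pi.single i 1) := by
      intro L w
      conv_lhs => rw [← Finset.univ_sum_single w]
      rw [map_sum]
      refine Finset.sum_congr rfl fun i _ => ?_
      rw [← smul_eq_mul, ← map_smul, ← Pi.single_smul, smul_eq_mul, mul_one]
    rw [h3] at h2
    exact h2
  have hi : ∀ i, Continuous fun t : ℝ => (y i - y₀ i) * partialDeriv g i (y₀ + t • (y - y₀)) :=
    fun i => continuous_const.mul
      ((hc i).continuous.comp (by fun_prop : Continuous fun t : ℝ => (y, t)))
  have := intervalIntegral.integral_eq_sub_of_hasDerivAt hd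
    ((continuous_finsetSum _ fun i _ => hi i).intervalIntegrable _ _)
  rw [intervalIntegral.integral_finsetSum fun i _ => (hi i).intervalIntegrable _ _] at this
  simp only [intervalIntegral.integral_const_mul] at this
  simp at this
  linarith

theorem ofSmooth_mem_deg_zero {U : Opens M.Body} (f : M.Smooth U) : M.ofSmooth U f ∈ M.deg U 0 :=
  M.mem_deg_zero.2 ⟨f, rfl⟩

theorem ofSmooth_commute {U : Opens M.Body} (f : M.Smooth U) (a : M.Fn U) :
    M.ofSmooth U f * a = a * M.ofSmooth U f := by
  induction a using DirectSum.Decomposition.inductionOn (M.deg U) with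
  | zero => simp
  | homogeneous a => simpa using M.comm (ofSmooth_mem_deg_zero f) a.2
  | add a b ha hb => rw [mul_add, add_mul, ha, hb]

theorem eq_zero_of_local {U : Opens M.Body} {a : M.Fn U}
    (h : ∀ x ∈ U, ∃ (V : Opens M.Body) (hV : V ≤ U), x ∈ V ∧ M.res hV a = 0) : a = 0 := by
  classical
  set S : Set (Opens M.Body) := {V | ∃ hV : V ≤ U, M.res hV a = 0} with hS
  have hU : U = sSup S := by
    apply le_antisymm
    · intro x hx
      obtain ⟨V, hV, hxV, h0⟩ := h x hx
      exact (le_sSup (show V ∈ S from ⟨hV, h0⟩)) hxV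
    · exact sSup_le fun V hV => hV.1
  have key : ∀ (W : Opens M.Body) (hW : W = sSup S) (i : ℕ) (b : M.Fn W), b ∈ M.deg W i →
      (∀ V (hV : V ∈ S), M.res (hW ▸ le_sSup hV : V ≤ W) b = 0) → b = 0 := by
    rintro W rfl i b hb hb0
    obtain ⟨c, _, hc⟩ := M.glue i S (fun V => 0) (fun V => Submodule.zero_mem _) (by simp)
    rw [hc b ⟨hb, fun V => hb0 V.1 V.2⟩, hc 0 ⟨Submodule.zero_mem _, by simp⟩]
  rw [← DirectSum.sum_support_decompose (M.deg U) a]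
  refine Finset.sum_eq_zero fun i _ => key U hU i _ (SetLike.coe_mem _) fun V hV => ?_
  obtain ⟨hVU, h0⟩ := hV
  have h1 : ∀ b : M.Fn U, M.res hVU (DirectSum.decompose (M.deg U) b i : M.Fn U) =
      (DirectSum.decompose (M.deg V) (M.res hVU b) i : M.Fn V) := by
    intro b
    induction b using DirectSum.Decomposition.inductionOn (M.deg U) with
    | zero => simp
    | @homogeneous j b =>
      by_cases hij : j = i
      · subst hij
        rw [DirectSum.decompose_of_mem_same _ b.2,
          DirectSum.decompose_of_mem_same _ (M.res_deg hVU b.2)]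
      · rw [DirectSum.decompose_of_mem_ne _ b.2 hij,
          DirectSum.decompose_of_mem_ne _ (M.res_deg hVU b.2) hij, map_zero]
    | add b c hb hc => simp [hb, hc]
  rw [h1, h0]
  simp

theorem eq_zero_of_pointwise {U : Opens M.Body} {a : M.Fn U}
    (h : ∀ x : U, ∃ (m : ℕ) (f : Fin m → M.Smooth U) (b : Fin m → M.Fn U),
      (∀ k, f k x = 0) ∧ a = ∑ k, M.ofSmooth U (f k) * b k) : a = 0 := by
  refine eq_zero_of_local fun x hx => ?_
  obtain ⟨V₀, ξ, hxV, hξ⟩ := M.exists_generating x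
  refine ⟨V₀ ⊓ U, inf_le_right, ⟨hxV, hx⟩, ?_⟩
  set V := V₀ ⊓ U
  have hV : V ≤ V₀ := inf_le_left
  have hVU : V ≤ U := inf_le_right
  let T : (GradedSpace.Exponent M.genDeg →₀ M.Smooth V) → M.Fn V := fun c =>
    c.sum fun μ f => M.ofSmooth V f * M.res hV (M.monomial ξ μ)
  have T_add : ∀ c c', T (c + c') = T c + T c' := fun c c' =>
    Finsupp.sum_add_index' (by simp) (by intros; rw [map_add, add_mul])
  have T_zero : T 0 = 0 := Finsupp.sum_zero_index
  have T_smul : ∀ (f : M.Smooth V) c, T (f • c) = M.ofSmooth V f * T c := fun f c => by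
    show Finsupp.sum _ _ = _ * Finsupp.sum _ _
    rw [Finsupp.sum_smul_index (by simp), Finsupp.mul_sum]
    simp only [map_mul, mul_assoc]
  have T_sum : ∀ {m : ℕ} (c : Fin m → _), T (∑ k, c k) = ∑ k, T (c k) := fun c =>
    map_sum (⟨⟨T, T_zero⟩, T_add⟩ : (GradedSpace.Exponent M.genDeg →₀ M.Smooth V) →+ M.Fn V) _ _
  obtain ⟨c, hc, huniq⟩ := hξ.existsUnique V hV (M.res hVU a)
  suffices c = 0 by rw [hc, this]; exact T_zero
  ext μ y
  obtain ⟨m, f, b, hf, hab⟩ := h ⟨y, hVU y.2⟩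
  choose e he _ using fun k => hξ.existsUnique V hV (M.res hVU (b k))
  have h1 : c = ∑ k, ContMDiffMap.restrictRingHom (𝓡 M.dim) 𝓘(ℝ, ℝ) ℝ hVU (f k) • e k := by
    refine (huniq _ ?_).symm
    change _ = T _
    rw [hab, T_sum, map_sum]
    refine Finset.sum_congr rfl fun k _ => ?_
    rw [T_smul, map_mul, M.res_ofSmooth, he k]
  rw [h1, Finsupp.finsetSum_apply]
  simp only [Finsupp.smul_apply, smul_eq_mul]
  have h2 : ∀ {m : ℕ} (p : Fin m → M.Smooth V), (∑ k, p k) y = ∑ k, p k y := fun p =>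
    map_sum (ContMDiffMap.evalRingHom y) p _
  rw [h2]
  refine Finset.sum_eq_zero fun k _ => ?_
  rw [ContMDiffMap.coe_mul, Pi.mul_apply]
  have : (ContMDiffMap.restrictRingHom (𝓡 M.dim) 𝓘(ℝ, ℝ) ℝ hVU (f k)) y = 0 := hf k
  rw [this, zero_mul]

/-- Vector fields satisfy the chain rule. -/
theorem IsDerivation.chain {U : Opens M.Body} {k : ℤ} {X : M.Fn U →ₗ[ℝ] M.Fn U}
    (hX : M.IsDerivation U k X) {r : ℕ} (g : (Fin r → ℝ) → ℝ) (hg : ContDiff ℝ ∞ g)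
    (h : Fin r → M.Smooth U) :
    X (M.ofSmooth U (smoothComp g hg h)) =
      ∑ i, M.ofSmooth U (smoothComp (partialDeriv g i) (partialDeriv_contDiff hg i) h) *
        X (M.ofSmooth U (h i)) := by
  have hl : ∀ (f : M.Smooth U) b, X (M.ofSmooth U f * b) =
      X (M.ofSmooth U f) * b + M.ofSmooth U f * X b := fun f b => by
    simpa using hX.leibniz (ofSmooth_mem_deg_zero f) b
  have hone : X 1 = 0 := by simpa using hl 1 1
  rw [← sub_eq_zero]
  refine eq_zero_of_pointwise fun x => ?_
  obtain ⟨G, hG, hG0, hgG⟩ := hadamard hg fun i => h i x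
  have e : smoothComp g hg h = algebraMap ℝ _ (g fun i => h i x) +
      ∑ i, (h i - algebraMap ℝ _ (h i x)) * smoothComp (G i) (hG i) h := by
    ext y
    have h2 : ∀ (p : Fin r → M.Smooth U), (∑ k, p k) y = ∑ k, p k y := fun p =>
      map_sum (ContMDiffMap.evalRingHom y) p _
    rw [ContMDiffMap.coe_add, Pi.add_apply, h2]
    exact hgG _
  have hconst : ∀ t : ℝ, X (M.ofSmooth U (algebraMap ℝ _ t)) = 0 := fun t => by
    rw [AlgHom.commutes, Algebra.algebraMap_eq_smul_one, map_smul, hone, smul_zero]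
  refine ⟨r + r, Fin.append (fun i => h i - algebraMap ℝ _ (h i x))
      (fun i => smoothComp (G i) (hG i) h -
        smoothComp (partialDeriv g i) (partialDeriv_contDiff hg i) h),
    Fin.append (fun i => X (M.ofSmooth U (smoothComp (G i) (hG i) h)))
      (fun i => X (M.ofSmooth U (h i))), ?_, ?_⟩
  · intro j
    refine Fin.addCases (fun i => ?_) (fun i => ?_) j
    · simp only [Fin.append_left]
      exact sub_self (h i x)
    · simp only [Fin.append_right]
      exact sub_eq_zero.2 (hG0 i)
  · rw [Fin.sum_univ_add, e]
    simp only [Fin.append_left, Fin.append_right, map_add, map_sum, map_mul, hl, map_sub, hconst,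
      zero_mul, zero_add, sub_mul, Finset.sum_add_distrib, Finset.sum_sub_distrib]
    simp only [ofSmooth_commute (smoothComp (G _) (hG _) h)]
    abel

/-! ### Differential forms, i.e. functions on `T[1]M` -/

/-- Generators `a` and `d a` of the algebra of forms. -/
inductive FormGen (M : GradedManifold.{u}) (U : Opens M.Body) : Type u
  | fn (a : M.Fn U) : FormGen M U
  | d (a : M.Fn U) : FormGen M U

/-- The relations of the algebra of differential forms: `a ↦ a` is a homomorphism of algebras, `d` is
linear and satisfies the graded Leibniz rule, forms commute up to the sign given by the total degree
(where `d a` has degree one more than `a`), and `d` satisfies the chain rule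
`d (g (h₁, …, h_r)) = ∑ ∂ᵢg (h₁, …, h_r) d hᵢ` for smooth functions `hᵢ` on the body and `g` on
`ℝ^r` (so that the forms generated by functions on the body are the usual smooth forms). -/
inductive FormRel (M : GradedManifold.{u}) (U : Opens M.Body) :
    FreeAlgebra ℝ (FormGen M U) → FreeAlgebra ℝ (FormGen M U) → Prop
  | fn_one : FormRel M U (.ι ℝ (.fn 1)) 1
  | fn_add (a b : M.Fn U) : FormRel M U (.ι ℝ (.fn (a + b))) (.ι ℝ (.fn a) + .ι ℝ (.fn b))
  | fn_smul (t : ℝ) (a : M.Fn U) : FormRel M U (.ι ℝ (.fn (t • a))) (t • .ι ℝ (.fn a))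
  | fn_mul (a b : M.Fn U) : FormRel M U (.ι ℝ (.fn (a * b))) (.ι ℝ (.fn a) * .ι ℝ (.fn b))
  | d_add (a b : M.Fn U) : FormRel M U (.ι ℝ (.d (a + b))) (.ι ℝ (.d a) + .ι ℝ (.d b))
  | d_smul (t : ℝ) (a : M.Fn U) : FormRel M U (.ι ℝ (.d (t • a))) (t • .ι ℝ (.d a))
  | d_mul {i : ℕ} {a : M.Fn U} (ha : a ∈ M.deg U i) (b : M.Fn U) :
      FormRel M U (.ι ℝ (.d (a * b)))
        (.ι ℝ (.d a) * .ι ℝ (.fn b) + (-1 : ℝ) ^ i • (.ι ℝ (.fn a) * .ι ℝ (.d b)))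
  | fn_d {i j : ℕ} {a b : M.Fn U} (ha : a ∈ M.deg U i) (hb : b ∈ M.deg U j) :
      FormRel M U (.ι ℝ (.fn a) * .ι ℝ (.d b))
        ((-1 : ℝ) ^ (i * (j + 1)) • (.ι ℝ (.d b) * .ι ℝ (.fn a)))
  | d_d {i j : ℕ} {a b : M.Fn U} (ha : a ∈ M.deg U i) (hb : b ∈ M.deg U j) :
      FormRel M U (.ι ℝ (.d a) * .ι ℝ (.d b))
        ((-1 : ℝ) ^ ((i + 1) * (j + 1)) • (.ι ℝ (.d b) * .ι ℝ (.d a)))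
  | d_chain {r : ℕ} (g : (Fin r → ℝ) → ℝ) (hg : ContDiff ℝ ∞ g) (h : Fin r → M.Smooth U) :
      FormRel M U (.ι ℝ (.d (M.ofSmooth U (smoothComp g hg h))))
        (∑ i, .ι ℝ (.fn (M.ofSmooth U
          (smoothComp (partialDeriv g i) (partialDeriv_contDiff hg i) h))) *
            .ι ℝ (.d (M.ofSmooth U (h i))))

/-- The algebra of differential forms on the graded manifold `M` over `U`. -/
def Form (M : GradedManifold.{u}) (U : Opens M.Body) : Type u := RingQuot (FormRel M U)

noncomputable instance (M : GradedManifold.{u}) (U : Opens M.Body) : Ring (Form M U) :=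
  inferInstanceAs (Ring (RingQuot (FormRel M U)))

noncomputable instance (M : GradedManifold.{u}) (U : Opens M.Body) : Algebra ℝ (Form M U) :=
  inferInstanceAs (Algebra ℝ (RingQuot (FormRel M U)))

namespace Form

variable {U : Opens M.Body}

/-- The quotient map. -/
noncomputable def mk : FreeAlgebra ℝ (FormGen M U) →ₐ[ℝ] Form M U :=
  RingQuot.mkAlgHom ℝ (FormRel M U)

theorem mk_rel {x y : FreeAlgebra ℝ (FormGen M U)} (h : FormRel M U x y) : mk x = mk y :=
  RingQuot.mkAlgHom_rel ℝ h

/-- Functions as forms of order zero. -/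
noncomputable def fn : M.Fn U →ₐ[ℝ] Form M U :=
  AlgHom.ofLinearMap
    { toFun := fun a => mk (.ι ℝ (.fn a))
      map_add' := fun a b => by rw [mk_rel (.fn_add a b), map_add]
      map_smul' := fun t a => by rw [mk_rel (.fn_smul t a), map_smul, RingHom.id_apply] }
    (by simp only [LinearMap.coe_mk, AddHom.coe_mk]; rw [mk_rel .fn_one, map_one])
    (fun a b => by simp only [LinearMap.coe_mk, AddHom.coe_mk]; rw [mk_rel (.fn_mul a b), map_mul])

/-- The 1-form `d a` of a function `a`. -/
noncomputable def dfn : M.Fn U →ₗ[ℝ] Form M U where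
  toFun := fun a => mk (.ι ℝ (.d a))
  map_add' := fun a b => by rw [mk_rel (.d_add a b), map_add]
  map_smul' := fun t a => by rw [mk_rel (.d_smul t a), map_smul, RingHom.id_apply]

theorem fn_apply (a : M.Fn U) : fn a = mk (.ι ℝ (.fn a)) := rfl
theorem dfn_apply (a : M.Fn U) : dfn a = mk (.ι ℝ (.d a)) := rfl

theorem dfn_mul {i : ℕ} {a : M.Fn U} (ha : a ∈ M.deg U i) (b : M.Fn U) :
    dfn (a * b) = dfn a * fn b + (-1 : ℝ) ^ i • (fn a * dfn b) := by
  simp only [fn_apply, dfn_apply]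
  rw [mk_rel (.d_mul ha b)]
  simp only [map_add, map_mul, map_smul]

theorem fn_mul_dfn {i j : ℕ} {a b : M.Fn U} (ha : a ∈ M.deg U i) (hb : b ∈ M.deg U j) :
    fn a * dfn b = (-1 : ℝ) ^ (i * (j + 1)) • (dfn b * fn a) := by
  simp only [fn_apply, dfn_apply]
  rw [← map_mul, mk_rel (.fn_d ha hb)]
  simp only [map_mul, map_smul]

theorem dfn_mul_dfn {i j : ℕ} {a b : M.Fn U} (ha : a ∈ M.deg U i) (hb : b ∈ M.deg U j) :
    dfn a * dfn b = (-1 : ℝ) ^ ((i + 1) * (j + 1)) • (dfn b * dfn a) := by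
  simp only [dfn_apply]
  rw [← map_mul, mk_rel (.d_d ha hb)]
  simp only [map_mul, map_smul]

theorem dfn_chain {r : ℕ} (g : (Fin r → ℝ) → ℝ) (hg : ContDiff ℝ ∞ g) (h : Fin r → M.Smooth U) :
    dfn (M.ofSmooth U (smoothComp g hg h)) =
      ∑ i, fn (M.ofSmooth U (smoothComp (partialDeriv g i) (partialDeriv_contDiff hg i) h)) *
        dfn (M.ofSmooth U (h i)) := by
  simp only [fn_apply, dfn_apply]
  rw [mk_rel (.d_chain g hg h)]
  simp only [map_sum, map_mul]

/-- The conditions for a homomorphism with `a ↦ φ a`, `d a ↦ F a` to exist on forms. -/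
structure LiftData {B : Type*} [Ring B] [Algebra ℝ B] (φ : M.Fn U →ₐ[ℝ] B) (F : M.Fn U →ₗ[ℝ] B) :
    Prop where
  leibniz : ∀ {i : ℕ} {a : M.Fn U}, a ∈ M.deg U i → ∀ b : M.Fn U,
    F (a * b) = F a * φ b + (-1 : ℝ) ^ i • (φ a * F b)
  comm : ∀ {i j : ℕ} {a b : M.Fn U}, a ∈ M.deg U i → b ∈ M.deg U j →
    φ a * F b = (-1 : ℝ) ^ (i * (j + 1)) • (F b * φ a)
  comm' : ∀ {i j : ℕ} {a b : M.Fn U}, a ∈ M.deg U i → b ∈ M.deg U j →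
    F a * F b = (-1 : ℝ) ^ ((i + 1) * (j + 1)) • (F b * F a)
  chain : ∀ {r : ℕ} (g : (Fin r → ℝ) → ℝ) (hg : ContDiff ℝ ∞ g) (h : Fin r → M.Smooth U),
    F (M.ofSmooth U (smoothComp g hg h)) =
      ∑ i, φ (M.ofSmooth U (smoothComp (partialDeriv g i) (partialDeriv_contDiff hg i) h)) *
        F (M.ofSmooth U (h i))

/-- The homomorphism with `a ↦ φ a` and `d a ↦ F a`. -/
noncomputable def lift {B : Type*} [Ring B] [Algebra ℝ B] {φ : M.Fn U →ₐ[ℝ] B}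
    {F : M.Fn U →ₗ[ℝ] B} (H : LiftData φ F) : Form M U →ₐ[ℝ] B :=
  RingQuot.liftAlgHom ℝ ⟨FreeAlgebra.lift ℝ fun | .fn a => φ a | .d a => F a, by
    intro x y h
    induction h with
    | fn_one => simp
    | fn_add => simp
    | fn_smul => simp
    | fn_mul => simp
    | d_add => simp
    | d_smul => simp
    | d_mul ha b => simpa using H.leibniz ha b
    | fn_d ha hb => simpa using H.comm ha hb
    | d_d ha hb => simpa using H.comm' ha hb
    | d_chain g hg h => simpa using H.chain g hg h⟩

theorem lift_fn {B : Type*} [Ring B] [Algebra ℝ B] {φ : M.Fn U →ₐ[ℝ] B}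
    {F : M.Fn U →ₗ[ℝ] B} (H : LiftData φ F) (a : M.Fn U) : lift H (fn a) = φ a :=
  (RingQuot.liftAlgHom_mkAlgHom_apply ℝ _ _ _).trans (by simp)

theorem lift_dfn {B : Type*} [Ring B] [Algebra ℝ B] {φ : M.Fn U →ₐ[ℝ] B}
    {F : M.Fn U →ₗ[ℝ] B} (H : LiftData φ F) (a : M.Fn U) : lift H (dfn a) = F a :=
  (RingQuot.liftAlgHom_mkAlgHom_apply ℝ _ _ _).trans (by simp)

theorem lift_unique {B : Type*} [Ring B] [Algebra ℝ B] {f g : Form M U →ₐ[ℝ] B}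
    (h₀ : ∀ a, f (fn a) = g (fn a)) (h₁ : ∀ a, f (dfn a) = g (dfn a)) : f = g := by
  refine RingQuot.ringQuot_ext' ℝ f g (FreeAlgebra.hom_ext (funext fun x => ?_))
  cases x with
  | fn a => exact h₀ a
  | d a => exact h₁ a

end Form

/-- The linear map multiplying functions of degree `i` by `s ^ i`. -/
noncomputable def scaleLin (U : Opens M.Body) (s : ℝ) : M.Fn U →ₗ[ℝ] M.Fn U :=
  (DirectSum.toModule ℝ ℕ (M.Fn U) fun i => s ^ i • (M.deg U i).subtype).comp
    (DirectSum.decomposeLinearEquiv (M.deg U)).toLinearMap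

theorem scaleLin_of_mem {U : Opens M.Body} (s : ℝ) {i : ℕ} {a : M.Fn U} (ha : a ∈ M.deg U i) :
    scaleLin U s a = s ^ i • a := by
  have h : DirectSum.decomposeLinearEquiv (M.deg U) a =
      DirectSum.lof ℝ ℕ (fun i => M.deg U i) i ⟨a, ha⟩ := DirectSum.decompose_of_mem _ ha
  rw [scaleLin, LinearMap.comp_apply, LinearEquiv.coe_coe, h, DirectSum.toModule_lof]
  rfl

/-- The algebra endomorphism multiplying functions of degree `i` by `s ^ i`. -/
noncomputable def scaleFn (U : Opens M.Body) (s : ℝ) : M.Fn U →ₐ[ℝ] M.Fn U :=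
  AlgHom.ofLinearMap (scaleLin U s)
    (by rw [scaleLin_of_mem s (SetLike.GradedOne.one_mem (A := M.deg U)), pow_zero, one_smul])
    (fun a b => by
      induction a using DirectSum.Decomposition.inductionOn (M.deg U) with
      | zero => rw [zero_mul, map_zero, zero_mul]
      | add a a' ha ha' => rw [add_mul, map_add, map_add, add_mul, ha, ha']
      | homogeneous a =>
        induction b using DirectSum.Decomposition.inductionOn (M.deg U) with
        | zero => rw [mul_zero, map_zero, mul_zero]
        | add b b' hb hb' => rw [mul_add, map_add, map_add, mul_add, hb, hb']
        | homogeneous b =>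
          rw [scaleLin_of_mem s a.2, scaleLin_of_mem s b.2,
            scaleLin_of_mem s (SetLike.GradedMul.mul_mem a.2 b.2), smul_mul_smul_comm, pow_add])

theorem scaleFn_of_mem {U : Opens M.Body} (s : ℝ) {i : ℕ} {a : M.Fn U} (ha : a ∈ M.deg U i) :
    scaleFn U s a = s ^ i • a :=
  scaleLin_of_mem s ha

namespace Form

variable {U : Opens M.Body}

theorem scaleLiftData (s : ℝ) :
    LiftData ((fn (U := U)).comp (scaleFn U s)) (s • dfn.comp (scaleFn U s).toLinearMap) where
  leibniz {i a} ha b := by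
    simp only [LinearMap.smul_apply, LinearMap.comp_apply, AlgHom.toLinearMap_apply,
      AlgHom.comp_apply, map_mul, scaleFn_of_mem s ha, smul_mul_assoc, map_smul, dfn_mul ha,
      mul_smul_comm, smul_add, smul_smul]
    ring_nf
  comm {i j a b} ha hb := by
    simp only [LinearMap.smul_apply, LinearMap.comp_apply, AlgHom.toLinearMap_apply,
      AlgHom.comp_apply, scaleFn_of_mem s ha, scaleFn_of_mem s hb, smul_mul_assoc, map_smul,
      mul_smul_comm, smul_smul, fn_mul_dfn ha hb]
    ring_nf
  comm' {i j a b} ha hb := by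
    simp only [LinearMap.smul_apply, LinearMap.comp_apply, AlgHom.toLinearMap_apply,
      scaleFn_of_mem s ha, scaleFn_of_mem s hb, smul_mul_assoc, map_smul,
      mul_smul_comm, smul_smul, dfn_mul_dfn ha hb]
    ring_nf
  chain g hg h := by
    simp only [LinearMap.smul_apply, LinearMap.comp_apply, AlgHom.toLinearMap_apply,
      AlgHom.comp_apply, scaleFn_of_mem s (ofSmooth_mem_deg_zero _), pow_zero, one_smul,
      dfn_chain, Finset.smul_sum, mul_smul_comm]

/-- The algebra endomorphism multiplying forms of total degree `p` by `s ^ p`. -/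
noncomputable def scale (s : ℝ) : Form M U →ₐ[ℝ] Form M U := lift (scaleLiftData s)

theorem scale_fn (s : ℝ) {i : ℕ} {a : M.Fn U} (ha : a ∈ M.deg U i) :
    scale s (fn a) = s ^ i • fn a := by
  simp [scale, lift_fn, scaleFn_of_mem s ha]

theorem scale_dfn (s : ℝ) {i : ℕ} {a : M.Fn U} (ha : a ∈ M.deg U i) :
    scale s (dfn a) = s ^ (i + 1) • dfn a := by
  simp [scale, lift_dfn, scaleFn_of_mem s ha, smul_smul, pow_succ']

/-- The conditions on the values `D₀ a = D a`, `D₁ a = D (d a)` for a derivation `D` of forms to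
exist, with Leibniz rule `D (x y) = D x y + s ^ |x| x D y`. -/
structure DerivData (s : ℝ) (D₀ D₁ : M.Fn U →ₗ[ℝ] Form M U) : Prop where
  map_mul : ∀ a b, D₀ (a * b) = D₀ a * fn b + scale s (fn a) * D₀ b
  leibniz : ∀ {i : ℕ} {a : M.Fn U}, a ∈ M.deg U i → ∀ b : M.Fn U,
    D₁ (a * b) = (D₁ a * fn b + scale s (dfn a) * D₀ b) +
      (-1 : ℝ) ^ i • (D₀ a * dfn b + scale s (fn a) * D₁ b)
  comm : ∀ {i j : ℕ} {a b : M.Fn U}, a ∈ M.deg U i → b ∈ M.deg U j →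
    D₀ a * dfn b + scale s (fn a) * D₁ b =
      (-1 : ℝ) ^ (i * (j + 1)) • (D₁ b * fn a + scale s (dfn b) * D₀ a)
  comm' : ∀ {i j : ℕ} {a b : M.Fn U}, a ∈ M.deg U i → b ∈ M.deg U j →
    D₁ a * dfn b + scale s (dfn a) * D₁ b =
      (-1 : ℝ) ^ ((i + 1) * (j + 1)) • (D₁ b * dfn a + scale s (dfn b) * D₁ a)
  chain : ∀ {r : ℕ} (g : (Fin r → ℝ) → ℝ) (hg : ContDiff ℝ ∞ g) (h : Fin r → M.Smooth U),
    D₁ (M.ofSmooth U (smoothComp g hg h)) =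
      ∑ i, (D₀ (M.ofSmooth U
          (smoothComp (partialDeriv g i) (partialDeriv_contDiff hg i) h)) *
            dfn (M.ofSmooth U (h i)) +
        scale s (fn (M.ofSmooth U
          (smoothComp (partialDeriv g i) (partialDeriv_contDiff hg i) h))) *
            D₁ (M.ofSmooth U (h i)))

/-- Upper triangular matrices, used to construct derivations of forms. -/
noncomputable def triangular {A : Type*} [AddCommGroup A] [Module ℝ A]
    (x y z : A →ₗ[ℝ] Form M U) :
    A →ₗ[ℝ] Matrix (Fin 2) (Fin 2) (Form M U) where
  toFun a := !![x a, y a; 0, z a]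
  map_add' a b := by ext i j; fin_cases i <;> fin_cases j <;> simp
  map_smul' t a := by ext i j; fin_cases i <;> fin_cases j <;> simp

theorem DerivData.map_one {s : ℝ} {D₀ D₁ : M.Fn U →ₗ[ℝ] Form M U} (H : DerivData s D₀ D₁) :
    D₀ 1 = 0 := by
  simpa using H.map_mul 1 1

/-- `a` is sent to the matrix with rows `(s ^ |a| a, D₀ a)` and `(0, a)`. -/
noncomputable def DerivData.hom {s : ℝ} {D₀ D₁ : M.Fn U →ₗ[ℝ] Form M U} (H : DerivData s D₀ D₁) :
    M.Fn U →ₐ[ℝ] Matrix (Fin 2) (Fin 2) (Form M U) :=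
  AlgHom.ofLinearMap
    (triangular ((scale s).toLinearMap.comp fn.toLinearMap) D₀ fn.toLinearMap)
    (by ext i j; fin_cases i <;> fin_cases j <;> simp [triangular, H.map_one])
    (fun a b => by
      ext i j
      fin_cases i <;> fin_cases j <;> simp [triangular, H.map_mul, Matrix.mul_apply, add_comm])

theorem DerivData.liftData {s : ℝ} {D₀ D₁ : M.Fn U →ₗ[ℝ] Form M U} (H : DerivData s D₀ D₁) :
    LiftData H.hom (triangular ((scale s).toLinearMap.comp dfn) D₁ dfn) where
  leibniz {i a} ha b := by
    ext k l
    fin_cases k <;> fin_cases l <;>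
      simp [triangular, hom, dfn_mul ha, H.leibniz ha]
    abel
  comm {i j a b} ha hb := by
    ext k l
    fin_cases k <;> fin_cases l <;>
      simp [triangular, hom, Matrix.mul_apply, fn_mul_dfn ha hb]
    · rw [← _root_.map_mul, fn_mul_dfn ha hb]; simp
    · have := H.comm ha hb
      rw [add_comm, this, smul_add, add_comm]
  comm' {i j a b} ha hb := by
    ext k l
    fin_cases k <;> fin_cases l <;>
      simp [triangular, Matrix.mul_apply]
    · rw [← _root_.map_mul, dfn_mul_dfn ha hb]; simp
    · have := H.comm' ha hb
      rw [add_comm, this, smul_add, add_comm]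
    · rw [dfn_mul_dfn ha hb]
  chain g hg h := by
    ext k l
    fin_cases k <;> fin_cases l <;>
      simp [triangular, hom, Matrix.sum_apply, dfn_chain, H.chain]
    simp [add_comm]

/-- The derivation with `a ↦ D₀ a` and `d a ↦ D₁ a`: the upper right entry of the homomorphism from
forms to upper triangular matrices. -/
noncomputable def DerivData.deriv {s : ℝ} {D₀ D₁ : M.Fn U →ₗ[ℝ] Form M U}
    (H : DerivData s D₀ D₁) : Form M U →ₗ[ℝ] Form M U :=
  (Matrix.entryLinearMap ℝ (Form M U) 0 1).comp (lift H.liftData).toLinearMap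

theorem DerivData.deriv_fn {s : ℝ} {D₀ D₁ : M.Fn U →ₗ[ℝ] Form M U}
    (H : DerivData s D₀ D₁) (a : M.Fn U) : H.deriv (fn a) = D₀ a := by
  simp [deriv, lift_fn, hom, triangular]

theorem DerivData.deriv_dfn {s : ℝ} {D₀ D₁ : M.Fn U →ₗ[ℝ] Form M U}
    (H : DerivData s D₀ D₁) (a : M.Fn U) : H.deriv (dfn a) = D₁ a := by
  simp [deriv, lift_dfn, triangular]

theorem neg_one_pow_congr {m n : ℕ} (h : Even m ↔ Even n) : (-1 : ℝ) ^ m = (-1) ^ n := by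
  rcases Nat.even_or_odd m with hm | hm
  · rw [hm.neg_one_pow, (h.1 hm).neg_one_pow]
  · rw [hm.neg_one_pow, (Nat.not_even_iff_odd.1 fun hn => Nat.not_even_iff_odd.2 hm
      (h.2 hn)).neg_one_pow]

theorem partialDeriv_comm {r : ℕ} {g : (Fin r → ℝ) → ℝ} (hg : ContDiff ℝ ∞ g) (i j : Fin r) :
    partialDeriv (partialDeriv g i) j = partialDeriv (partialDeriv g j) i := by
  have h : ∀ i j y, partialDeriv (partialDeriv g i) j y =
      fderiv ℝ (fderiv ℝ g) y (Pi.single j 1) (Pi.single i 1) := fun i j y => by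
    have hd : DifferentiableAt ℝ (fderiv ℝ g) y :=
      (hg.fderiv_right (m := ∞) (by simp)).differentiable (by simp) y
    unfold partialDeriv
    rw [fderiv_clm_apply hd (differentiableAt_const _)]
    simp
  ext y
  rw [h, h]
  exact (hg.contDiffAt.isSymmSndFDerivAt (by simpa using ENat.LEInfty.out)).eq _ _

theorem dDerivData : DerivData (U := U) (-1) dfn 0 where
  map_mul a b := by
    induction a using DirectSum.Decomposition.inductionOn (M.deg U) with
    | zero => simp
    | homogeneous a => rw [dfn_mul a.2, scale_fn _ a.2, smul_mul_assoc]
    | add a a' ha hb => simp only [add_mul, map_add, ha, hb]; abel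
  leibniz ha b := by
    simp [scale_dfn _ ha, pow_succ]
  comm {i j a b} ha hb := by
    simp only [LinearMap.zero_apply, mul_zero, zero_mul, add_zero, zero_add, scale_dfn _ hb,
      smul_mul_assoc, smul_smul, dfn_mul_dfn ha hb, ← pow_add]
    congr 1
    ring
  comm' ha hb := by simp
  chain g hg h := by
    simp only [LinearMap.zero_apply, mul_zero, add_zero, dfn_chain, Finset.sum_mul]
    have key : ∀ i j, fn (M.ofSmooth U (smoothComp (partialDeriv (partialDeriv g i) j)
          (partialDeriv_contDiff (partialDeriv_contDiff hg i) j) h)) *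
          dfn (M.ofSmooth U (h j)) * dfn (M.ofSmooth U (h i)) =
        -(fn (M.ofSmooth U (smoothComp (partialDeriv (partialDeriv g j) i)
          (partialDeriv_contDiff (partialDeriv_contDiff hg j) i) h)) *
          dfn (M.ofSmooth U (h i)) * dfn (M.ofSmooth U (h j))) := fun i j => by
      rw [mul_assoc, mul_assoc, dfn_mul_dfn (ofSmooth_mem_deg_zero _) (ofSmooth_mem_deg_zero _)]
      simp only [partialDeriv_comm hg i j]
      simp
    set T := ∑ i, ∑ j, fn (M.ofSmooth U (smoothComp (partialDeriv (partialDeriv g i) j)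
          (partialDeriv_contDiff (partialDeriv_contDiff hg i) j) h)) *
          dfn (M.ofSmooth U (h j)) * dfn (M.ofSmooth U (h i)) with hT
    have h2 : T = -T := by
      conv_lhs => rw [hT, Finset.sum_comm]
      rw [hT, ← Finset.sum_neg_distrib]
      refine Finset.sum_congr rfl fun i _ => ?_
      rw [← Finset.sum_neg_distrib]
      exact Finset.sum_congr rfl fun j _ => key j i
    have h3 : (2 : ℝ) • T = 0 := by
      rw [two_smul]
      nth_rewrite 1 [h2]
      simp
    exact ((smul_eq_zero.1 h3).resolve_left (by norm_num)).symm

/-- The de Rham differential: the derivation with `a ↦ d a` and `d a ↦ 0`, of degree one. -/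
noncomputable def d : Form M U →ₗ[ℝ] Form M U := (dDerivData (M := M) (U := U)).deriv

theorem contractDerivData {k : ℤ} {X : M.Fn U →ₗ[ℝ] M.Fn U} (hX : M.IsDerivation U k X) :
    DerivData ((-1 : ℝ) ^ (k - 1).natAbs) 0 (fn.toLinearMap.comp X) where
  map_mul a b := by simp
  leibniz {i a} ha b := by
    have e : ((-1 : ℝ) ^ (k - 1).natAbs) ^ i * (-1) ^ i = (-1 : ℝ) ^ (k * i) := by
      rw [← pow_mul, ← pow_add]
      rcases Int.even_or_odd k with hk | hk
      · rw [(hk.mul_right _).neg_one_zpow, Even.neg_one_pow]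
        have : ¬ Even (k - 1).natAbs := by
          rw [Int.natAbs_even, Int.even_sub]; simp only [hk, Int.not_even_one]; tauto
        rcases Nat.even_or_odd i with hi | hi <;> simp [Nat.even_add, Nat.even_mul, this]
      · have h1 : Even (k - 1).natAbs := by
          rw [Int.natAbs_even, Int.even_sub]; simp only [Int.not_even_iff_odd.2 hk, Int.not_even_one]
        rw [zpow_mul, hk.neg_one_zpow, zpow_natCast]
        exact neg_one_pow_congr (by simp [Nat.even_add, h1])
    simp only [LinearMap.zero_apply, mul_zero, zero_mul, add_zero, zero_add, LinearMap.comp_apply,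
      AlgHom.toLinearMap_apply, hX.leibniz ha, map_add, map_smul, map_mul, scale_fn _ ha,
      smul_mul_assoc, smul_smul]
    rw [mul_comm (_ ^ i) (_ ^ i), e]
  comm {i j a b} ha hb := by
    simp only [LinearMap.zero_apply, mul_zero, zero_mul, add_zero, zero_add, LinearMap.comp_apply,
      AlgHom.toLinearMap_apply, scale_fn _ ha, smul_mul_assoc, ← map_mul, ← map_smul]
    rcases lt_or_ge ((j : ℤ) + k) 0 with hj | hj
    · simp [hX.map_neg hj hb]
    · obtain ⟨n, hn⟩ := Int.eq_ofNat_of_zero_le hj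
      rw [M.comm ha (hX.map_deg hn.symm hb), smul_smul, ← pow_mul, ← pow_add]
      congr 2
      refine neg_one_pow_congr ?_
      have h1 : Even n ↔ (Even j ↔ Even k) := by
        rw [← Int.even_coe_nat n, ← hn, Int.even_add, Int.even_coe_nat]
      simp only [Nat.even_add, Nat.even_mul, Int.natAbs_even, Int.even_sub, h1, Int.not_even_one,
        Nat.not_even_one]
      grind
  comm' {i j a b} ha hb := by
    have key : ∀ {i j : ℕ} {a b : M.Fn U}, a ∈ M.deg U i → b ∈ M.deg U j →
        fn (X a) * dfn b = (-1 : ℝ) ^ ((i + 1) * (j + 1)) •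
          ((((-1 : ℝ) ^ (k - 1).natAbs) ^ (j + 1)) • (dfn b * fn (X a))) := by
      intro i j a b ha hb
      rcases lt_or_ge ((i : ℤ) + k) 0 with hi | hi
      · simp [hX.map_neg hi ha]
      · obtain ⟨n, hn⟩ := Int.eq_ofNat_of_zero_le hi
        rw [fn_mul_dfn (hX.map_deg hn.symm ha) hb, smul_smul, ← pow_mul, ← pow_add]
        congr 1
        refine neg_one_pow_congr ?_
        have h1 : Even n ↔ (Even i ↔ Even k) := by
          rw [← Int.even_coe_nat n, ← hn, Int.even_add, Int.even_coe_nat]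
        simp only [Nat.even_add, Nat.even_mul, Int.natAbs_even, Int.even_sub, h1, Int.not_even_one,
          Nat.not_even_one]
        grind
    simp only [LinearMap.comp_apply, AlgHom.toLinearMap_apply, scale_dfn _ ha, scale_dfn _ hb,
      smul_mul_assoc]
    have hc : (-1 : ℝ) ^ ((i + 1) * (j + 1)) * (-1) ^ ((i + 1) * (j + 1)) = 1 := by
      rw [← pow_add, Even.neg_one_pow ⟨_, rfl⟩]
    rw [key ha hb, key hb ha, mul_comm (j + 1) (i + 1)]
    simp only [smul_add]
    rw [smul_smul _ _ (((-1 : ℝ) ^ (k - 1).natAbs) ^ (i + 1) • (dfn a * fn (X b))), hc, one_smul,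
      add_comm]
  chain g hg h := by
    simp [hX.chain g hg h, scale_fn _ (ofSmooth_mem_deg_zero _)]

/-- The contraction `ι_X`: the derivation with `a ↦ 0` and `d a ↦ X a`, of degree `k - 1`. -/
noncomputable def contract {k : ℤ} {X : M.Fn U →ₗ[ℝ] M.Fn U} (hX : M.IsDerivation U k X) :
    Form M U →ₗ[ℝ] Form M U :=
  (contractDerivData hX).deriv

/-- The Lie derivative `L_X = ι_X d + (-1)^k d ι_X`. -/
noncomputable def lie {k : ℤ} {X : M.Fn U →ₗ[ℝ] M.Fn U} (hX : M.IsDerivation U k X) :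
    Form M U →ₗ[ℝ] Form M U :=
  (contract hX).comp d + (-1 : ℝ) ^ k • d.comp (contract hX)

end Form

/-- Graded commutator of operators of degrees `k`, `l`. -/
noncomputable def bracket {U : Opens M.Body} (k l : ℤ) (X Y : M.Fn U →ₗ[ℝ] M.Fn U) :
    M.Fn U →ₗ[ℝ] M.Fn U :=
  X.comp Y - (-1 : ℝ) ^ (k * l) • Y.comp X

theorem IsDerivation.map_zero_or {U : Opens M.Body} {k : ℤ} {X : M.Fn U →ₗ[ℝ] M.Fn U}
    (hX : M.IsDerivation U k X) {i : ℕ} {a : M.Fn U} (ha : a ∈ M.deg U i) :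
    X a = 0 ∨ ∃ n : ℕ, (n : ℤ) = i + k ∧ X a ∈ M.deg U n := by
  rcases lt_or_ge ((i : ℤ) + k) 0 with hi | hi
  · exact .inl (hX.map_neg hi ha)
  · obtain ⟨n, hn⟩ := Int.eq_ofNat_of_zero_le hi
    exact .inr ⟨n, hn.symm, hX.map_deg hn.symm ha⟩

theorem IsDerivation.bracket {U : Opens M.Body} {k l : ℤ} {X Y : M.Fn U →ₗ[ℝ] M.Fn U}
    (hX : M.IsDerivation U k X) (hY : M.IsDerivation U l Y) :
    M.IsDerivation U (k + l) (bracket k l X Y) where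
  map_deg {i j} hij a ha := by
    have key : ∀ {k l : ℤ} {X Y : M.Fn U →ₗ[ℝ] M.Fn U}, M.IsDerivation U k X →
        M.IsDerivation U l Y → (j : ℤ) = i + (k + l) → X (Y a) ∈ M.deg U j := by
      intro k l X Y hX hY hij
      rcases hY.map_zero_or ha with h0 | ⟨n, hn, hm⟩
      · rw [h0, map_zero]; exact Submodule.zero_mem _
      · exact hX.map_deg (by omega) hm
    exact Submodule.sub_mem _ (key hX hY hij)
      (Submodule.smul_mem _ _ (key hY hX (by omega)))
  map_neg {i} hi a ha := by
    have key : ∀ {k l : ℤ} {X Y : M.Fn U →ₗ[ℝ] M.Fn U}, M.IsDerivation U k X →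
        M.IsDerivation U l Y → (i : ℤ) + (k + l) < 0 → X (Y a) = 0 := by
      intro k l X Y hX hY hij
      rcases hY.map_zero_or ha with h0 | ⟨n, hn, hm⟩
      · rw [h0, map_zero]
      · exact hX.map_neg (by omega) hm
    simp [GradedManifold.bracket, key hX hY hi, key hY hX (by omega)]
  leibniz {i a} ha b := by
    have key : ∀ {k l : ℤ} {X Y : M.Fn U →ₗ[ℝ] M.Fn U}, M.IsDerivation U k X →
        M.IsDerivation U l Y → X (Y (a * b)) = X (Y a) * b +
          (-1 : ℝ) ^ (k * (i + l)) • (Y a * X b) +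
          (-1 : ℝ) ^ (l * i) • (X a * Y b) + (-1 : ℝ) ^ (k * i + l * i) • (a * X (Y b)) := by
      intro k l X Y hX hY
      rw [hY.leibniz ha, map_add, map_smul, hX.leibniz ha]
      have h1 : X (Y a * b) = X (Y a) * b + (-1 : ℝ) ^ (k * (i + l)) • (Y a * X b) := by
        rcases hY.map_zero_or ha with h0 | ⟨n, hn, hm⟩
        · simp [h0]
        · rw [hX.leibniz hm, hn]
      rw [h1, smul_add, smul_smul, ← zpow_add₀ (by norm_num), add_comm (l * (i : ℤ))]
      abel
    simp only [GradedManifold.bracket, LinearMap.sub_apply, LinearMap.smul_apply,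
      LinearMap.comp_apply, key hX hY, key hY hX, smul_add, smul_smul, sub_mul, mul_sub,
      smul_sub, smul_mul_assoc, mul_smul_comm]
    have hsq : ∀ m : ℤ, (-1 : ℝ) ^ m * (-1) ^ m = 1 := fun m => by
      rw [← zpow_add₀ (by norm_num), Even.neg_one_zpow (by simp)]
    have e1 : (-1 : ℝ) ^ (k * l) * (-1) ^ (l * (i + k)) = (-1) ^ (l * i) := by
      rw [mul_add, zpow_add₀ (by norm_num), mul_left_comm, mul_comm l k, hsq, mul_one]
    have e2 : (-1 : ℝ) ^ (k * l) * (-1) ^ (k * i) = (-1) ^ (k * (i + l)) := by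
      rw [← zpow_add₀ (by norm_num)]; ring_nf
    have e3 : (-1 : ℝ) ^ (k * l) * (-1) ^ (l * i + k * i) =
      (-1) ^ ((k + l) * i) * (-1) ^ (k * l) := by
      rw [← zpow_add₀ (by norm_num), ← zpow_add₀ (by norm_num)]; ring_nf
    rw [e1, e2, e3, ← add_mul]
    abel

end GradedManifold

/-! ### Morphisms and Q-manifolds -/

/-- A morphism of graded manifolds from the open part of `M` over `U` to `N`: a smooth map of the
bodies (of which only the values on `U` matter) and degree preserving pull-backs of functions,
compatible with restrictions, which on smooth functions are the composition with the body map. -/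
structure GHom (M : GradedManifold.{u}) (U : Opens M.Body) (N : GradedManifold.{u}) where
  body : M.Body → N.Body
  contMDiffOn_body : ContMDiffOn (𝓡 M.dim) (𝓡 N.dim) ∞ body U
  pull : ∀ (V : Opens N.Body) (W : Opens M.Body), W ≤ U → Set.MapsTo body W V →
    (N.Fn V →ₐ[ℝ] M.Fn W)
  pull_deg : ∀ {V : Opens N.Body} {W : Opens M.Body} (hW : W ≤ U) (h : Set.MapsTo body W V)
    {i : ℕ} {a : N.Fn V}, a ∈ N.deg V i → pull V W hW h a ∈ M.deg W i
  pull_res : ∀ {V V' : Opens N.Body} {W W' : Opens M.Body} (hV : V' ≤ V) (hW' : W' ≤ W)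
    (hW : W ≤ U) (h : Set.MapsTo body W V) (h' : Set.MapsTo body W' V') (a : N.Fn V),
    pull V' W' (hW'.trans hW) h' (N.res hV a) = M.res hW' (pull V W hW h a)
  pull_ofSmooth : ∀ {V : Opens N.Body} {W : Opens M.Body} (hW : W ≤ U)
    (h : Set.MapsTo body W V) (f : N.Smooth V),
    ∃ g : M.Smooth W, (∀ x : W, g x = f ⟨body x, h x.2⟩) ∧
      pull V W hW h (N.ofSmooth V f) = M.ofSmooth W g

/-- A Q-manifold: a graded manifold with a vector field `Q` of degree one with `Q² = 0`. -/
structure QManifold extends GradedManifold.{u} where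
  Q : ∀ U : Opens Body, Fn U →ₗ[ℝ] Fn U
  isDerivation_Q : ∀ U, toGradedManifold.IsDerivation U 1 (Q U)
  Q_res : ∀ {U V : Opens Body} (h : V ≤ U) (a : Fn U), Q V (res h a) = res h (Q U a)
  Q_sq : ∀ (U : Opens Body) (a : Fn U), Q U (Q U a) = 0

namespace GHom

open GradedManifold

variable {M N : GradedManifold.{u}} {U : Opens M.Body}

theorem pull_smoothComp (φ : GHom M U N) {V : Opens N.Body} {W : Opens M.Body} (hW : W ≤ U)
    (h : Set.MapsTo φ.body W V) {r : ℕ} (f : Fin r → N.Smooth V) :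
    ∃ f' : Fin r → M.Smooth W, (∀ i, φ.pull V W hW h (N.ofSmooth V (f i)) = M.ofSmooth W (f' i)) ∧
      ∀ (g : (Fin r → ℝ) → ℝ) (hg : ContDiff ℝ ∞ g),
        φ.pull V W hW h (N.ofSmooth V (smoothComp g hg f)) =
          M.ofSmooth W (smoothComp g hg f') := by
  choose f' hf' hpf' using fun i => φ.pull_ofSmooth hW h (f i)
  refine ⟨f', hpf', fun g hg => ?_⟩
  obtain ⟨k, hk, hpk⟩ := φ.pull_ofSmooth hW h (smoothComp g hg f)
  rw [hpk]
  congr 1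
  ext x
  rw [hk]
  change g _ = g _
  congr 1
  ext i
  exact (hf' i x).symm

theorem formLiftData (φ : GHom M U N) {V : Opens N.Body} {W : Opens M.Body} (hW : W ≤ U)
    (h : Set.MapsTo φ.body W V) :
    Form.LiftData ((Form.fn (M := M)).comp (φ.pull V W hW h))
      ((Form.dfn (M := M)).comp (φ.pull V W hW h).toLinearMap) where
  leibniz ha b := by simp [Form.dfn_mul (φ.pull_deg hW h ha)]
  comm ha hb := Form.fn_mul_dfn (φ.pull_deg hW h ha) (φ.pull_deg hW h hb)
  comm' ha hb := Form.dfn_mul_dfn (φ.pull_deg hW h ha) (φ.pull_deg hW h hb)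
  chain g hg f := by
    obtain ⟨f', hf', hcomp⟩ := φ.pull_smoothComp hW h f
    simp only [LinearMap.comp_apply, AlgHom.toLinearMap_apply, AlgHom.comp_apply, hcomp, hf',
      Form.dfn_chain]

/-- Pull-back of differential forms. -/
noncomputable def pullForm (φ : GHom M U N) (V : Opens N.Body) (W : Opens M.Body) (hW : W ≤ U)
    (h : Set.MapsTo φ.body W V) : Form N V →ₐ[ℝ] Form M W :=
  Form.lift (φ.formLiftData hW h)

/-- The open preimage of `V` under a morphism defined everywhere. -/
def preimage (φ : GHom M ⊤ N) (V : Opens N.Body) : Opens M.Body :=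
  ⟨φ.body ⁻¹' V, V.isOpen.preimage (by
    rw [← continuousOn_univ]; exact φ.contMDiffOn_body.continuousOn)⟩

end GHom

namespace QManifold

open GradedManifold

variable {M N : QManifold.{u}} {U : Opens M.Body}

/-- A Q-morphism: the pull-back of functions commutes with `Q`. -/
def IsQMorphism (φ : GHom M.toGradedManifold U N.toGradedManifold) : Prop :=
  ∀ (V : Opens N.Body) (W : Opens M.Body) (hW : W ≤ U) (h : Set.MapsTo φ.body W V) (a : N.Fn V),
    M.Q W (φ.pull V W hW h a) = φ.pull V W hW h (N.Q V a)

/-- The operator `F = Q φ^* - φ^* Q` on functions. -/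
noncomputable def fieldOp (φ : GHom M.toGradedManifold U N.toGradedManifold) (V : Opens N.Body)
    (W : Opens M.Body) (hW : W ≤ U) (h : Set.MapsTo φ.body W V) : N.Fn V →ₗ[ℝ] M.Fn W :=
  (M.Q W).comp (φ.pull V W hW h).toLinearMap - (φ.pull V W hW h).toLinearMap.comp (N.Q V)

theorem fieldOp_mem (φ : GHom M.toGradedManifold U N.toGradedManifold) {V : Opens N.Body}
    {W : Opens M.Body} (hW : W ≤ U) (h : Set.MapsTo φ.body W V) {i : ℕ} {a : N.Fn V}
    (ha : a ∈ N.deg V i) : fieldOp φ V W hW h a ∈ M.deg W (i + 1) :=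
  Submodule.sub_mem _
    ((M.isDerivation_Q W).map_deg (by push_cast; ring) (φ.pull_deg hW h ha))
    (φ.pull_deg hW h ((N.isDerivation_Q V).map_deg (by push_cast; ring) ha))

theorem fieldLiftData (φ : GHom M.toGradedManifold U N.toGradedManifold) {V : Opens N.Body}
    {W : Opens M.Body} (hW : W ≤ U) (h : Set.MapsTo φ.body W V) :
    Form.LiftData (φ.pull V W hW h) (fieldOp φ V W hW h) where
  leibniz {i a} ha b := by
    have e : (-1 : ℝ) ^ ((1 : ℤ) * (i : ℤ)) = (-1) ^ i := by rw [one_mul, zpow_natCast]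
    simp only [fieldOp, LinearMap.sub_apply, LinearMap.comp_apply, AlgHom.toLinearMap_apply,
      map_mul, (M.isDerivation_Q W).leibniz (φ.pull_deg hW h ha), (N.isDerivation_Q V).leibniz ha,
      map_add, map_smul, e, sub_mul, mul_sub, smul_sub]
    abel
  comm ha hb := M.comm (φ.pull_deg hW h ha) (fieldOp_mem φ hW h hb)
  comm' ha hb := M.comm (fieldOp_mem φ hW h ha) (fieldOp_mem φ hW h hb)
  chain g hg f := by
    obtain ⟨f', hf', hcomp⟩ := φ.pull_smoothComp hW h f
    simp only [fieldOp, LinearMap.sub_apply, LinearMap.comp_apply, AlgHom.toLinearMap_apply,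
      hcomp, hf', (M.isDerivation_Q W).chain, (N.isDerivation_Q V).chain, map_sum, map_mul,
      mul_sub, Finset.sum_sub_distrib]

/-- The pull-back `f^*` of forms along the field strength `f : M → T[1]N` of `φ : M → N`: the
homomorphism of algebras with `a ↦ φ^* a` and `d a ↦ F a`. -/
noncomputable def fieldStrength (φ : GHom M.toGradedManifold U N.toGradedManifold)
    (V : Opens N.Body) (W : Opens M.Body) (hW : W ≤ U) (h : Set.MapsTo φ.body W V) :
    Form N.toGradedManifold V →ₐ[ℝ] M.Fn W :=
  Form.lift (fieldLiftData φ hW h)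

end QManifold

namespace GradedManifold.Form

/-- Products of homogeneous generators of total degree `p`. -/
inductive IsMonomial {M : GradedManifold.{u}} {U : Opens M.Body} : ℕ → Form M U → Prop
  | one : IsMonomial 0 1
  | fn_mul {i p : ℕ} {a : M.Fn U} {w : Form M U} :
      a ∈ M.deg U i → IsMonomial p w → IsMonomial (i + p) (fn a * w)
  | dfn_mul {i p : ℕ} {a : M.Fn U} {w : Form M U} :
      a ∈ M.deg U i → IsMonomial p w → IsMonomial (i + 1 + p) (dfn a * w)

/-- Forms of total degree `p`. -/
noncomputable def deg (M : GradedManifold.{u}) (U : Opens M.Body) (p : ℕ) : Submodule ℝ (Form M U) :=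
  Submodule.span ℝ {w | IsMonomial p w}

end GradedManifold.Form

open GradedManifold in
/-- The total differential `d + L_Q` on forms. -/
noncomputable def QManifold.totalQ (M : QManifold.{u}) (U : Opens M.Body) :
    Form M.toGradedManifold U →ₗ[ℝ] Form M.toGradedManifold U :=
  Form.d + Form.lie (M.isDerivation_Q U)

/-! ### Cohomology of graded complexes -/

namespace GradedComplex

variable {V : Type*} [AddCommGroup V] [Module ℝ V] (C : ℕ → Submodule ℝ V) (D : V →ₗ[ℝ] V)

/-- Cocycles of degree `p`. -/
def cocycles (p : ℕ) : Submodule ℝ V := C p ⊓ LinearMap.ker D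

/-- Coboundaries of degree `p`. -/
def coboundaries : ℕ → Submodule ℝ V
  | 0 => ⊥
  | p + 1 => (C p).map D

/-- The `p`-th cohomology. -/
abbrev Cohomology (p : ℕ) : Type _ :=
  cocycles C D p ⧸ (coboundaries C D p).submoduleOf (cocycles C D p)

/-- The class of a cocycle. -/
def toCohomology (p : ℕ) : cocycles C D p →ₗ[ℝ] Cohomology C D p :=
  ((coboundaries C D p).submoduleOf (cocycles C D p)).mkQ

end GradedComplex

/-! ### Q-bundles -/

open GradedManifold

/-- A holonomy algebra on the fibre: a graded Lie subalgebra, consisting of vector fields of negative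
degree, that is closed under the derived bracket `[X, Y]_Q = [[X, Q], Y]`. -/
structure HolonomyAlgebra (F : QManifold.{u}) where
  space : ℤ → Submodule ℝ (F.Fn ⊤ →ₗ[ℝ] F.Fn ⊤)
  isDerivation : ∀ {k : ℤ} {X : F.Fn ⊤ →ₗ[ℝ] F.Fn ⊤}, X ∈ space k → F.IsDerivation ⊤ k X
  space_of_nonneg : ∀ k : ℤ, 0 ≤ k → space k = ⊥
  bracket_mem : ∀ {k l : ℤ} {X Y : F.Fn ⊤ →ₗ[ℝ] F.Fn ⊤}, X ∈ space k → Y ∈ space l →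
    bracket k l X Y ∈ space (k + l)
  derivedBracket_mem : ∀ {k l : ℤ} {X Y : F.Fn ⊤ →ₗ[ℝ] F.Fn ⊤}, X ∈ space k → Y ∈ space l →
    bracket (k + 1) l (bracket k 1 X (F.Q ⊤)) Y ∈ space (k + 1 + l)

namespace HolonomyAlgebra

variable {F : QManifold.{u}} (G : HolonomyAlgebra F)

/-- Basic forms: those annihilated by `L_ε` and `L_{[Q, ε]}` for all `ε` in the algebra. -/
noncomputable def basicForms : Submodule ℝ (Form F.toGradedManifold ⊤) :=
  ⨅ (k : ℤ) (ε : G.space k),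
    LinearMap.ker (Form.lie (G.isDerivation ε.2)) ⊓
      LinearMap.ker (Form.lie ((F.isDerivation_Q ⊤).bracket (G.isDerivation ε.2)))

/-- Basic forms of total degree `p`. -/
noncomputable def basicDeg (p : ℕ) : Submodule ℝ (Form F.toGradedManifold ⊤) :=
  Form.deg F.toGradedManifold ⊤ p ⊓ G.basicForms

end HolonomyAlgebra

/-- `c t`, `t ∈ T`, is a smooth family of functions over `U` with derivative `c' t`: locally, in graded
coordinates, `c t` is a finite combination of monomials whose coefficients are smooth jointly in `t`
and the point, and `c' t` has the `t`-derivatives of these as coefficients. -/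
def HasFamilyDeriv (M : GradedManifold.{u}) (U : Opens M.Body) (T : Set ℝ) (c c' : ℝ → M.Fn U) :
    Prop :=
  ∀ x ∈ U, ∃ (V : Opens M.Body) (hV : V ≤ U) (ξ : Fin M.genCount → M.Fn V)
    (S : Finset (GradedSpace.Exponent M.genDeg))
    (f f' : GradedSpace.Exponent M.genDeg → ℝ → M.Smooth V),
    x ∈ V ∧ M.IsGenerating V M.genDeg ξ ∧
    (∀ μ ∈ S, ContMDiffOn (𝓘(ℝ, ℝ).prod (𝓡 M.dim)) 𝓘(ℝ, ℝ) ∞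
      (fun q : ℝ × V => f μ q.1 q.2) (T ×ˢ Set.univ)) ∧
    (∀ μ ∈ S, ∀ t ∈ T, ∀ y : V, HasDerivWithinAt (fun t => f μ t y) (f' μ t y) T t) ∧
    (∀ t ∈ T, M.res hV (c t) = ∑ μ ∈ S, M.ofSmooth V (f μ t) * M.monomial ξ μ) ∧
    (∀ t ∈ T, M.res hV (c' t) = ∑ μ ∈ S, M.ofSmooth V (f' μ t) * M.monomial ξ μ)

/-- `Φ` is the flow of the vector field `X` of degree zero on the part of `M` over `P`. -/
structure IsFlow {M : GradedManifold.{u}} {P : Opens M.Body} (X : M.Fn P →ₗ[ℝ] M.Fn P)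
    (Φ : ℝ → GHom M P M) : Prop where
  mapsTo : ∀ t, Set.MapsTo (Φ t).body P P
  zero : (Φ 0).pull P P le_rfl (mapsTo 0) = AlgHom.id ℝ (M.Fn P)
  deriv : ∀ a : M.Fn P, HasFamilyDeriv M P Set.univ
    (fun t => (Φ t).pull P P le_rfl (mapsTo t) a)
    (fun t => (Φ t).pull P P le_rfl (mapsTo t) (X a))

section Trivialization

variable {M N F : QManifold.{u}} (π : GHom M.toGradedManifold ⊤ N.toGradedManifold)

/-- `τ : π⁻¹(U) → F` makes `(π, τ) : π⁻¹(U) → U × F` an isomorphism of Q-manifolds: `τ` is a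
Q-morphism, `(π, τ)` is a diffeomorphism of the bodies, and graded coordinates on `U` and on `F`
together give graded coordinates on `π⁻¹(U)`. -/
structure IsTrivialization (U : Opens N.Body)
    (τ : GHom M.toGradedManifold (π.preimage U) F.toGradedManifold) : Prop where
  isQMorphism : QManifold.IsQMorphism τ
  body_diffeo : ∃ s : N.Body × F.Body → M.Body,
    ContMDiffOn ((𝓡 N.dim).prod (𝓡 F.dim)) (𝓡 M.dim) ∞ s ((U : Set N.Body) ×ˢ Set.univ) ∧
    (∀ x ∈ U, ∀ y, π.body (s (x, y)) = x ∧ τ.body (s (x, y)) = y) ∧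
    ∀ z, π.body z ∈ U → s (π.body z, τ.body z) = z
  generating : ∀ (V : Opens N.Body) (V' : Opens F.Body) (W : Opens M.Body)
    (hW : W ≤ π.preimage U) (hV : Set.MapsTo π.body W V) (hV' : Set.MapsTo τ.body W V')
    {m m' : ℕ} (d : Fin m → ℕ) (d' : Fin m' → ℕ) (ξ : Fin m → N.Fn V) (η : Fin m' → F.Fn V'),
    N.IsGenerating V d ξ → F.IsGenerating V' d' η →
    M.IsGenerating W (Fin.append d d')
      (Fin.append (fun j => π.pull V W le_top hV (ξ j)) (fun j => τ.pull V' W hW hV' (η j)))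

/-- The vector fields `[Q, Y]` of degree zero on `π⁻¹(U) ≃ U × F`, where `Y = ∑ bʲ εⱼ` is a function on
`U` with values in the holonomy algebra, acting on `U × F` as a vertical vector field. -/
def gaugeAlgebra (G : HolonomyAlgebra F) (U : Opens N.Body) {P₀ : Opens M.Body}
    (τ : GHom M.toGradedManifold P₀ F.toGradedManifold) (hP : π.preimage U ≤ P₀) :
    Set (M.Fn (π.preimage U) →ₗ[ℝ] M.Fn (π.preimage U)) :=
  {X | ∃ (Y : M.Fn (π.preimage U) →ₗ[ℝ] M.Fn (π.preimage U)) (r : ℕ) (i : Fin r → ℕ)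
      (b : Fin r → N.Fn U) (k : Fin r → ℤ) (ε : ∀ j, G.space (k j)),
    M.IsDerivation (π.preimage U) (-1) Y ∧
    (∀ j, b j ∈ N.deg U (i j)) ∧ (∀ j, (i j : ℤ) + k j = -1) ∧
    (∀ a : N.Fn U, Y (π.pull U (π.preimage U) le_top (fun _ h => h) a) = 0) ∧
    (∀ h : F.Fn ⊤, Y (τ.pull ⊤ (π.preimage U) hP (fun _ _ => trivial) h) =
      ∑ j, π.pull U (π.preimage U) le_top (fun _ h => h) (b j) *
        τ.pull ⊤ (π.preimage U) hP (fun _ _ => trivial) ((ε j).1 h)) ∧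
    X = bracket 1 (-1) (M.Q (π.preimage U)) Y}

/-- The group generated by the exponentials (flows at time one) of the vector fields in
`gaugeAlgebra`, as automorphisms of the algebra of functions on `π⁻¹(U)`. -/
def expGauge (G : HolonomyAlgebra F) (U : Opens N.Body) {P₀ : Opens M.Body}
    (τ : GHom M.toGradedManifold P₀ F.toGradedManifold) (hP : π.preimage U ≤ P₀) :
    Submonoid (M.Fn (π.preimage U) →ₐ[ℝ] M.Fn (π.preimage U)) :=
  Submonoid.closure {Ψ | ∃ X ∈ gaugeAlgebra π G U τ hP,
    ∃ (Φ : ℝ → GHom M.toGradedManifold (π.preimage U) M.toGradedManifold) (hΦ : IsFlow X Φ),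
      Ψ = (Φ 1).pull _ _ le_rfl (hΦ.mapsTo 1)}

end Trivialization

/-- A Q-bundle with fibre `F` and holonomy algebra `G`: a surjective Q-morphism with local
trivializations over an open cover, glued over `U i ∩ U j` by elements of `exp G'`. -/
structure QBundle (M N F : QManifold.{u}) (G : HolonomyAlgebra F) where
  π : GHom M.toGradedManifold ⊤ N.toGradedManifold
  isQMorphism : QManifold.IsQMorphism π
  surjective : Function.Surjective π.body
  Index : Type u
  U : Index → Opens N.Body
  cover : ∀ x, ∃ i, x ∈ U i
  τ : ∀ i, GHom M.toGradedManifold (π.preimage (U i)) F.toGradedManifold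
  isTrivialization : ∀ i, IsTrivialization π (U i) (τ i)
  transition : ∀ i j, ∃ Ψ ∈ expGauge π G (U i ⊓ U j) (τ i) (fun _ h => h.1), ∀ h : F.Fn ⊤,
    (τ j).pull ⊤ (π.preimage (U i ⊓ U j)) (fun _ h => h.2) (fun _ _ => trivial) h =
      Ψ ((τ i).pull ⊤ (π.preimage (U i ⊓ U j)) (fun _ h => h.1) (fun _ _ => trivial) h)

namespace QBundle

variable {M N F : QManifold.{u}} {G : HolonomyAlgebra F} (B : QBundle M N F G)

/-- A gauge field: a section of `π` in the category of graded manifolds. -/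
structure GaugeField extends GHom N.toGradedManifold ⊤ M.toGradedManifold where
  section_body : ∀ x, B.π.body (body x) = x
  section_pull : ∀ (U : Opens N.Body) (b : N.Fn U),
    pull (B.π.preimage U) U le_top
      (fun x hx => show B.π.body (body x) ∈ U from (section_body x).symm ▸ hx)
      (B.π.pull U (B.π.preimage U) le_top (fun _ h => h) b) = b

variable {B}

theorem GaugeField.mapsTo (φ : B.GaugeField) (U : Opens N.Body) :
    Set.MapsTo φ.body U (B.π.preimage U) := fun x hx =>
  show B.π.body (φ.body x) ∈ U from (φ.section_body x).symm ▸ hx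

/-- The pull-back `φ^*` of functions over `U`. -/
def GaugeField.pullOn (φ : B.GaugeField) (U : Opens N.Body) :
    M.Fn (B.π.preimage U) →ₐ[ℝ] N.Fn U :=
  φ.pull (B.π.preimage U) U le_top (φ.mapsTo U)

/-- The pull-back of functions on the fibre along the trivialization over `U i`. -/
def trivPull (B : QBundle M N F G) (i : B.Index) : F.Fn ⊤ →ₐ[ℝ] M.Fn (B.π.preimage (B.U i)) :=
  (B.τ i).pull ⊤ _ le_rfl fun _ _ => trivial

/-- `f^*` of the trivial extension of the form `w` to `π⁻¹(U i) ≃ U i × F`, where `f` is the field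
strength of `φ`. -/
noncomputable def GaugeField.localChar (φ : B.GaugeField) (i : B.Index)
    (w : Form F.toGradedManifold ⊤) : N.Fn (B.U i) :=
  QManifold.fieldStrength φ.toGHom (B.π.preimage (B.U i)) (B.U i) le_top (φ.mapsTo (B.U i))
    ((B.τ i).pullForm ⊤ _ le_rfl (fun _ _ => trivial) w)

/-- `c` is the function on the base given over each `U i` by `localChar`. -/
def GaugeField.IsCharacteristicForm (φ : B.GaugeField) (w : Form F.toGradedManifold ⊤)
    (c : N.Fn ⊤) : Prop :=
  ∀ i, N.res le_top c = φ.localChar i w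

/-- The cohomology of basic forms on the fibre, with respect to the total differential. -/
abbrev FiberCohomology (G : HolonomyAlgebra F) (p : ℕ) : Type u :=
  GradedComplex.Cohomology G.basicDeg (F.totalQ ⊤) p

/-- The cohomology of functions on the base. -/
abbrev BaseCohomology (N : QManifold.{u}) (p : ℕ) : Type u :=
  GradedComplex.Cohomology (N.deg ⊤) (N.Q ⊤) p

/-- `χ` is the map in cohomology induced by pulling back basic forms along the field strength. -/
def GaugeField.IsCharacteristicMap (φ : B.GaugeField) (p : ℕ)
    (χ : FiberCohomology G p →ₗ[ℝ] BaseCohomology N p) : Prop :=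
  ∀ w : GradedComplex.cocycles G.basicDeg (F.totalQ ⊤) p,
    ∃ c : GradedComplex.cocycles (N.deg ⊤) (N.Q ⊤) p,
      φ.IsCharacteristicForm w c ∧
        χ (GradedComplex.toCohomology _ _ p w) = GradedComplex.toCohomology _ _ p c

/-- `φ₀` and `φ₁` are joined by a smooth family of sections parametrized by `[0, 1]`. -/
def GaugeField.Homotopic (φ₀ φ₁ : B.GaugeField) : Prop :=
  ∃ Φ : ℝ → B.GaugeField, Φ 0 = φ₀ ∧ Φ 1 = φ₁ ∧
    ContMDiffOn (𝓘(ℝ, ℝ).prod (𝓡 N.dim)) (𝓡 M.dim) ∞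
      (fun q : ℝ × N.Body => (Φ q.1).body q.2) (Set.Icc 0 1 ×ˢ Set.univ) ∧
    ∀ (U : Opens N.Body) (a : M.Fn (B.π.preimage U)), ∃ c' : ℝ → N.Fn U,
      HasFamilyDeriv N.toGradedManifold U (Set.Icc 0 1) (fun t => (Φ t).pullOn U a) c'

end QBundle

/-! ### Principal bundles and their Atiyah algebroids -/

/-- `N` is the odd tangent bundle `T[1]X` of its body `X`, with the de Rham differential as `Q`:
locally there are `dim X` smooth functions `yᵢ` such that the `Q yᵢ` are graded coordinates (then the
`yᵢ` are coordinates: writing `Q f = ∑ aᵢ(f) Q yᵢ` gives vector fields `aᵢ` with `aᵢ(yⱼ) = δᵢⱼ`). -/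
def QManifold.IsOddTangent (N : QManifold.{u}) : Prop :=
  ∀ x : N.Body, ∃ (U : Opens N.Body) (y : Fin N.dim → N.Smooth U), x ∈ U ∧
    N.IsGenerating U (fun _ => 1) (fun i => N.Q U (N.ofSmooth U (y i)))

/-- `F` is `𝔤[1]` with the Chevalley–Eilenberg differential: the body is a point, and the linear
functions `ξ α`, `α ∈ 𝔤^*`, are of degree one, freely generate the functions, and satisfy
`Q ξ^c = -½ C^c_{ab} ξ^a ξ^b`. -/
structure IsShiftedLieAlgebra (F : QManifold.{u}) {𝔤 : Type*} [AddCommGroup 𝔤] [Module ℝ 𝔤]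
    [Bracket 𝔤 𝔤] {r : ℕ} (e : Module.Basis (Fin r) ℝ 𝔤) (ξ : Module.Dual ℝ 𝔤 →ₗ[ℝ] F.Fn ⊤) :
    Prop where
  point : ∃! x : F.Body, x ∈ (⊤ : Opens F.Body)
  generating : F.IsGenerating ⊤ (fun _ => 1) (fun a => ξ (e.coord a))
  Q_apply : ∀ α, F.Q ⊤ (ξ α) =
    -(1 / 2 : ℝ) • ∑ a, ∑ b, α ⁅e a, e b⁆ • (ξ (e.coord a) * ξ (e.coord b))

/-- The holonomy algebra consists of the contractions `ι_ε` with the elements `ε` of `𝔤`. -/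
def HolonomyAlgebra.IsContractions {F : QManifold.{u}} (G : HolonomyAlgebra F) {𝔤 : Type*}
    [AddCommGroup 𝔤] [Module ℝ 𝔤] (ξ : Module.Dual ℝ 𝔤 →ₗ[ℝ] F.Fn ⊤) : Prop :=
  (∀ k, k ≠ -1 → G.space k = ⊥) ∧
  ∀ X, X ∈ G.space (-1) ↔ F.IsDerivation ⊤ (-1) X ∧
    ∃ ε : 𝔤, ∀ α, X (ξ α) = algebraMap ℝ (F.Fn ⊤) (α ε)

/-- The adjoint action `Ad g` on the Lie algebra: the differential at `1` of `k ↦ g k g⁻¹`. -/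
noncomputable def adjointMap {r : ℕ} {K : Type*} [TopologicalSpace K]
    [ChartedSpace (EuclideanSpace ℝ (Fin r)) K] [Group K] (g : K) :
    GroupLieAlgebra (𝓡 r) K →ₗ[ℝ] GroupLieAlgebra (𝓡 r) K :=
  (mfderiv (𝓡 r) (𝓡 r) (fun k : K => g * k * g⁻¹) 1).toLinearMap

/-- A principal bundle with structure group `K`: a smooth right action whose orbits are exactly
the fibres of `proj`, simply transitive on the fibres, with smooth local sections. -/
structure PrincipalBundle (r : ℕ) (K : Type*) [TopologicalSpace K]
    [ChartedSpace (EuclideanSpace ℝ (Fin r)) K] [Group K] (P X : GradedSpace.{u}) where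
  proj : P.Body → X.Body
  act : P.Body → K → P.Body
  contMDiff_proj : ContMDiff (𝓡 P.dim) (𝓡 X.dim) ∞ proj
  contMDiff_act : ContMDiff ((𝓡 P.dim).prod (𝓡 r)) (𝓡 P.dim) ∞
    (fun q : P.Body × K => act q.1 q.2)
  act_one : ∀ u, act u 1 = u
  act_mul : ∀ u g h, act u (g * h) = act (act u g) h
  proj_act : ∀ u g, proj (act u g) = proj u
  simplyTransitive : ∀ u v, proj u = proj v → ∃! g, act u g = v
  exists_section : ∀ x, ∃ (U : Opens X.Body) (s : X.Body → P.Body), x ∈ U ∧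
    ContMDiffOn (𝓡 X.dim) (𝓡 P.dim) ∞ s U ∧ ∀ y ∈ U, proj (s y) = y

/-- A principal `K`-bundle `P → X` over the body `X` of `N = T[1]X`, together with its tangent
data: `TP = T[1]P`, whose functions are the differential forms on `P` and whose `Q` is the de Rham
differential; the pull-back `projT` of forms along the projection; the pull-backs `actT g` of forms
along the right translations; the contractions `contr W ε` of forms with the fundamental vector
field of `ε` (each of these is determined by the stated properties). -/
structure TangentPrincipalBundle (r : ℕ) (K : Type*) [TopologicalSpace K]
    [ChartedSpace (EuclideanSpace ℝ (Fin r)) K] [Group K] (N : QManifold.{u}) where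
  base : N.IsOddTangent
  TP : QManifold.{u}
  total : TP.IsOddTangent
  bundle : PrincipalBundle r K TP.toGradedSpace N.toGradedSpace
  projT : GHom TP.toGradedManifold ⊤ N.toGradedManifold
  projT_Q : QManifold.IsQMorphism projT
  projT_body : projT.body = bundle.proj
  actT : K → GHom TP.toGradedManifold ⊤ TP.toGradedManifold
  actT_Q : ∀ g, QManifold.IsQMorphism (actT g)
  actT_body : ∀ g, (actT g).body = fun u => bundle.act u g
  contr : ∀ W : Opens TP.Body, GroupLieAlgebra (𝓡 r) K → TP.Fn W →ₗ[ℝ] TP.Fn W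
  contr_derivation : ∀ W ε, TP.IsDerivation W (-1) (contr W ε)
  contr_Q : ∀ (W : Opens TP.Body) (ε : GroupLieAlgebra (𝓡 r) K) (f : TP.Smooth W),
    ∃ f' : TP.Smooth W, contr W ε (TP.Q W (TP.ofSmooth W f)) = TP.ofSmooth W f' ∧
      ∀ u : W, f' u = mfderiv (𝓡 r) 𝓘(ℝ, ℝ)
        (fun g : K => Function.extend Subtype.val f 0 (bundle.act u g)) 1 ε

namespace TangentPrincipalBundle

variable {r : ℕ} {K : Type*} [TopologicalSpace K] [ChartedSpace (EuclideanSpace ℝ (Fin r)) K]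
  [Group K] {N : QManifold.{u}} (T : TangentPrincipalBundle r K N)

/-- The part of `P` over `U`. -/
def above (U : Opens N.Body) : Opens T.TP.Body := T.projT.preimage U

/-- Pull-back of forms on `U` to the part of `P` over `U`. -/
def projOn (U : Opens N.Body) : N.Fn U →ₐ[ℝ] T.TP.Fn (T.above U) :=
  T.projT.pull U (T.above U) le_top fun _ h => h

/-- Pull-back along the right translation by `g` of forms on the part of `P` over `U`. -/
def actOn (U : Opens N.Body) (g : K) : T.TP.Fn (T.above U) →ₐ[ℝ] T.TP.Fn (T.above U) :=
  (T.actT g).pull (T.above U) (T.above U) le_top fun u hu => by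
    change T.projT.body ((T.actT g).body u) ∈ U
    have hu' : T.projT.body u ∈ U := hu
    rwa [T.actT_body, T.projT_body, T.bundle.proj_act, ← T.projT_body]

/-- A connection form: `θ α` is the 1-form `⟨α, θ⟩` on `P`. It reproduces the generators of the
fundamental vector fields and satisfies `R_g^* θ = Ad (g⁻¹) θ`. -/
structure IsConnection (θ : Module.Dual ℝ (GroupLieAlgebra (𝓡 r) K) →ₗ[ℝ] T.TP.Fn ⊤) : Prop where
  mem : ∀ α, θ α ∈ T.TP.deg ⊤ 1
  contr : ∀ ε α, T.contr ⊤ ε (θ α) = algebraMap ℝ _ (α ε)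
  equivariant : ∀ g α, (T.actT g).pull ⊤ ⊤ le_top (fun _ _ => trivial) (θ α) =
    θ (α.comp (adjointMap g⁻¹))

/-- The curvature `dθ + ½ [θ, θ]`, evaluated on `α`. -/
noncomputable def curvature (e : Module.Basis (Fin r) ℝ (GroupLieAlgebra (𝓡 r) K))
    (θ : Module.Dual ℝ (GroupLieAlgebra (𝓡 r) K) →ₗ[ℝ] T.TP.Fn ⊤)
    (α : Module.Dual ℝ (GroupLieAlgebra (𝓡 r) K)) : T.TP.Fn ⊤ :=
  T.TP.Q ⊤ (θ α) +
    (1 / 2 : ℝ) • ∑ a, ∑ b, α ⁅e a, e b⁆ • (θ (e.coord a) * θ (e.coord b))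

end TangentPrincipalBundle

/-- The Q-bundle `B` is the Atiyah algebroid `T[1]P / K → T[1]X` of the principal bundle, with its
canonical bundle structure:
* the fibre is `𝔨[1]` and the holonomy algebra is `𝔨`;
* `quot : T[1]P → M` identifies the functions on `M` with the invariant forms on `P`,
  compatibly with `Q` and with the projections;
* the local trivialization over `U i` comes from a local section `s` of `P`: the invariant
  `𝔨`-valued 1-form on `P` that it defines vanishes along `s` and takes the value `-ε` on the
  fundamental vector field of `ε` at the points of `s`. -/
structure AtiyahData {r : ℕ} {K : Type*} [TopologicalSpace K]
    [ChartedSpace (EuclideanSpace ℝ (Fin r)) K] [Group K] {M N F : QManifold.{u}}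
    {G : HolonomyAlgebra F} (B : QBundle M N F G) (T : TangentPrincipalBundle r K N)
    (e : Module.Basis (Fin r) ℝ (GroupLieAlgebra (𝓡 r) K)) where
  ξ : Module.Dual ℝ (GroupLieAlgebra (𝓡 r) K) →ₗ[ℝ] F.Fn ⊤
  fiber : IsShiftedLieAlgebra F e ξ
  holonomy : G.IsContractions ξ
  quot : GHom T.TP.toGradedManifold ⊤ M.toGradedManifold
  quot_Q : QManifold.IsQMorphism quot
  quot_body : ∀ U : Opens N.Body, Set.MapsTo quot.body (T.above U) (B.π.preimage U)
  quot_proj : ∀ (U : Opens N.Body) (b : N.Fn U),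
    quot.pull (B.π.preimage U) (T.above U) le_top (quot_body U)
        (B.π.pull U _ le_top (fun _ h => h) b) = T.projOn U b
  quot_injective : ∀ U : Opens N.Body, Function.Injective
    (quot.pull (B.π.preimage U) (T.above U) le_top (quot_body U))
  quot_range : ∀ (U : Opens N.Body) (a : T.TP.Fn (T.above U)),
    a ∈ Set.range (quot.pull (B.π.preimage U) (T.above U) le_top (quot_body U)) ↔
      ∀ g, T.actOn U g a = a
  sec : ∀ i, GHom N.toGradedManifold (B.U i) T.TP.toGradedManifold
  sec_Q : ∀ i, QManifold.IsQMorphism (sec i)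
  sec_body : ∀ i, ∀ x ∈ B.U i, T.bundle.proj ((sec i).body x) = x
  sec_mapsTo : ∀ i, Set.MapsTo (sec i).body (B.U i) (T.above (B.U i))
  sec_triv : ∀ i α,
    (sec i).pull (T.above (B.U i)) (B.U i) le_rfl (sec_mapsTo i)
      (quot.pull (B.π.preimage (B.U i)) (T.above (B.U i)) le_top (quot_body (B.U i))
        (B.trivPull i (ξ α))) = 0
  sec_contr : ∀ i α ε,
    (sec i).pull (T.above (B.U i)) (B.U i) le_rfl (sec_mapsTo i)
      (T.contr _ ε (quot.pull (B.π.preimage (B.U i)) (T.above (B.U i)) le_top (quot_body (B.U i))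
        (B.trivPull i (ξ α)))) = algebraMap ℝ _ (-α ε)

namespace AtiyahData

variable {r : ℕ} {K : Type*} [TopologicalSpace K] [ChartedSpace (EuclideanSpace ℝ (Fin r)) K]
  [Group K] {M N F : QManifold.{u}} {G : HolonomyAlgebra F} {B : QBundle M N F G}
  {T : TangentPrincipalBundle r K N} {e : Module.Basis (Fin r) ℝ (GroupLieAlgebra (𝓡 r) K)}
  (A : AtiyahData B T e)

/-- The gauge field `φ : TX → TP / K` is the horizontal lift of the connection `θ`: for every
invariant 1-form `a` on `P`, the form `φ^* a` on `X` is the horizontal part of `a`. -/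
def IsHorizontalLift (φ : B.GaugeField)
    (θ : Module.Dual ℝ (GroupLieAlgebra (𝓡 r) K) →ₗ[ℝ] T.TP.Fn ⊤) : Prop :=
  ∀ (U : Opens N.Body) (a : M.Fn (B.π.preimage U)), a ∈ M.deg _ 1 →
    T.projOn U (φ.pullOn U a) =
      A.quot.pull (B.π.preimage U) (T.above U) le_top (A.quot_body U) a -
        ∑ b, T.contr (T.above U) (e b)
            (A.quot.pull (B.π.preimage U) (T.above U) le_top (A.quot_body U) a) *
          T.TP.res le_top (θ (e.coord b))

/-- The pull-back of forms on `P` along the local section over `U i`. -/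
def secPull (i : B.Index) : T.TP.Fn ⊤ →ₐ[ℝ] N.Fn (B.U i) :=
  (A.sec i).pull ⊤ (B.U i) le_rfl fun _ _ => trivial

end AtiyahData

/-- Symmetric multilinear forms of degree `q` on `𝔤` that are invariant under the adjoint
representation, i.e. invariant homogeneous polynomials of degree `q` on `𝔤`. -/
structure IsInvariantPolynomial {𝔤 : Type*} [AddCommGroup 𝔤] [Module ℝ 𝔤] [Bracket 𝔤 𝔤] {q : ℕ}
    (w : MultilinearMap ℝ (fun _ : Fin q => 𝔤) ℝ) : Prop where
  symm : ∀ (σ : Equiv.Perm (Fin q)) (v : Fin q → 𝔤), w (fun k => v (σ k)) = w v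
  invariant : ∀ (η : 𝔤) (v : Fin q → 𝔤), ∑ k, w (Function.update v k ⁅η, v k⁆) = 0

/-- The value `(1 / q!) ∑ w(e_{a₁}, …, e_{a_q}) z^{a₁} ⋯ z^{a_q}` of the polynomial `w` on elements
`z^a` of an algebra. -/
noncomputable def evalPolynomial {𝔤 : Type*} [AddCommGroup 𝔤] [Module ℝ 𝔤] {r q : ℕ}
    (e : Module.Basis (Fin r) ℝ 𝔤) (w : MultilinearMap ℝ (fun _ : Fin q => 𝔤) ℝ)
    {R : Type*} [Ring R] [Algebra ℝ R] (z : Fin r → R) : R :=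
  (1 / (q.factorial : ℝ)) • ∑ a : Fin q → Fin r,
    w (fun k => e (a k)) • (List.ofFn fun k => z (a k)).prod

/-! The field strength of any gauge field is a Q-morphism to `T[1]M`. By the definition of `F = Q
φ^* - φ^* Q` one has `Q φ^* a = f^* (da + Q a)`, and `Q² = 0` gives `Q F a = -F (Q a) = f^* (-d (Q
a))`. These are the values of `f^* Q_TM` on generators, so `f^*` is a chain map
(`Variation.hom_totalQ`) whether or not `φ` respects `Q`. What needs proof is that the local
expressions agree. Over an overlap the two extensions of a form differ by flows of `[Q, ∑ b ε]`.
Along such a flow the derivative of `f^*` of the extension is a sum of terms `(Q b) L_ε`, `± b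
L_{[Q, ε]}`, and terms with a factor `db` or `d (Q b)`. The first two kinds vanish on basic forms.
The last is killed by `f^*`, because `F` vanishes on functions from the base (`fieldOn_base`). So
the value is constant along the flow (`IsTransverse.flow`), the local functions glue, and a map in
cohomology results (`existsUnique_characteristicMap`).

For a family `φ_t` with derivative `δ_t`, let `K_t` be the derivation along `f_t^*` with `K_t a = 0`
and `K_t (da) = δ_t a`. Then `d/dt f_t^* = Q K_t + K_t Q_TM`, as one checks on products of
generators (`isFamily_hom`). On a closed basic form the derivative is therefore exact, and
integrating `K_t` over `[0, 1]` gives the primitive (`sub_mem_coboundaries`). For this `K_t` must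
glue as well. A derivation along a homomorphism is the off-diagonal entry of a homomorphism to upper
triangular matrices, so `f^*` and `K` are put into a single homomorphism (`Variation.hom`). The
gluing argument is carried out for matrix-valued homomorphisms, and both entries glue at once.

The algebras of functions carry no topology, so differentiation in `t` goes through families:
locally, finite sums of `g (t, h₁, …, h_n) b` paired with their `t`-derivatives. This notion uses no
coordinates and is stable under products, pull-backs and derivations along pull-backs
(`IsFamily.map_along`). Read in graded coordinates, its coefficients are ordinary functions of `t`,
which gives uniqueness of derivatives and constancy when the derivative is zero.

For the Atiyah algebroid, a dimension count identifies the functions on `𝔨[1]` with the exterior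
algebra of the dual of `𝔨`. The Lie derivative along a contraction differentiates the coordinates
`ξ` and treats `dξ` as constant. A form killed by all of them is thus a polynomial in the commuting
elements `dξ^a` of total degree two, which rules out odd degrees. The field `[Q, ι_ε]` acts on `dξ`
by the coadjoint action, so the remaining condition is invariance of `w`. On such polynomials `Q_TF
= ∑ ξ^a L_{[Q, ι_a]}`, whence closedness. Setting `ξ = 0` and sending `dξ^a` to a variable shows
that `w` is unique. Finally, for a horizontal lift `φ^* ξ = s_i^* θ`, so `F ξ = s_i^* (dθ + ½ [θ,
θ])` is the local curvature (`IsHorizontalLift.fieldOn_linear`). -/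

namespace GradedManifold.Form

variable {M : GradedManifold.{u}} {U : Opens M.Body}

/-! ### Derivations of forms on products -/

/-- Once the entries other than the upper right one are known, multiplicativity of the matrix
homomorphism is the Leibniz rule of the derivation. They are checked on generators of the free
algebra. -/
theorem DerivData.lift_entries {s : ℝ} {D₀ D₁ : M.Fn U →ₗ[ℝ] Form M U} (H : DerivData s D₀ D₁)
    (x : Form M U) : lift H.liftData x 0 0 = scale s x ∧ lift H.liftData x 1 0 = 0 ∧
      lift H.liftData x 1 1 = x := by
  obtain ⟨y, rfl⟩ : ∃ y, Form.mk (M := M) (U := U) y = x := RingQuot.mkAlgHom_surjective ℝ (FormRel M U) x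
  induction y using FreeAlgebra.induction with
  | grade0 r => simp [Matrix.algebraMap_matrix_apply]
  | grade1 g =>
    cases g with
    | fn a =>
      rw [← fn_apply, lift_fn]
      simp [hom, triangular]
    | d a =>
      rw [← dfn_apply, lift_dfn]
      simp [triangular]
  | mul a b ha hb =>
    simp only [_root_.map_mul, Matrix.mul_apply, Fin.sum_univ_two]
    simp [ha, hb]
  | add a b ha hb =>
    simp only [map_add, Matrix.add_apply]
    simp [ha, hb]

theorem DerivData.deriv_mul {s : ℝ} {D₀ D₁ : M.Fn U →ₗ[ℝ] Form M U} (H : DerivData s D₀ D₁)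
    (x y : Form M U) : H.deriv (x * y) = H.deriv x * y + scale s x * H.deriv y := by
  simp only [deriv, LinearMap.comp_apply, AlgHom.toLinearMap_apply, _root_.map_mul,
    Matrix.entryLinearMap_apply, Matrix.mul_apply, Fin.sum_univ_two, (H.lift_entries x).1,
    (H.lift_entries y).2.2]
  abel

theorem DerivData.deriv_one {s : ℝ} {D₀ D₁ : M.Fn U →ₗ[ℝ] Form M U} (H : DerivData s D₀ D₁) :
    H.deriv 1 = 0 := by
  simp [deriv]

theorem scale_monomial (s : ℝ) {p : ℕ} {w : Form M U} (hw : IsMonomial p w) :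
    scale s w = s ^ p • w := by
  induction hw with
  | one => simp
  | fn_mul ha _ ih => rw [map_mul, scale_fn s ha, ih, smul_mul_smul_comm, pow_add]
  | dfn_mul ha _ ih => rw [map_mul, scale_dfn s ha, ih, smul_mul_smul_comm, ← pow_add]

theorem scale_of_mem_deg (s : ℝ) {p : ℕ} {w : Form M U} (hw : w ∈ deg M U p) :
    scale s w = s ^ p • w := by
  induction hw using Submodule.span_induction with
  | mem x hx => exact scale_monomial s hx
  | zero => simp
  | add x y _ _ hx hy => rw [map_add, hx, hy, smul_add]
  | smul t x _ hx => rw [map_smul, hx, smul_comm]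

theorem d_one : d (1 : Form M U) = 0 := DerivData.deriv_one _

theorem d_fn_mul {i : ℕ} {a : M.Fn U} (ha : a ∈ M.deg U i) (w : Form M U) :
    d (fn a * w) = dfn a * w + (-1 : ℝ) ^ i • (fn a * d w) := by
  rw [d, DerivData.deriv_mul, DerivData.deriv_fn, scale_fn _ ha, smul_mul_assoc]

theorem d_dfn_mul {i : ℕ} {a : M.Fn U} (ha : a ∈ M.deg U i) (w : Form M U) :
    d (dfn a * w) = (-1 : ℝ) ^ (i + 1) • (dfn a * d w) := by
  rw [d, DerivData.deriv_mul, DerivData.deriv_dfn, scale_dfn _ ha, smul_mul_assoc]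
  simp

/-! ### Contractions and Lie derivatives on products of generators -/

section Lie

variable {k : ℤ} {X : M.Fn U →ₗ[ℝ] M.Fn U} (hX : M.IsDerivation U k X)

theorem contract_one : contract hX 1 = 0 := DerivData.deriv_one _

theorem neg_one_natAbs (k : ℤ) : (-1 : ℝ) ^ k.natAbs = (-1) ^ k := by
  rcases Int.even_or_odd k with hk | hk
  · rw [hk.neg_one_zpow, (Int.natAbs_even.2 hk).neg_one_pow]
  · rw [hk.neg_one_zpow, (Int.natAbs_odd.2 hk).neg_one_pow]

theorem contract_fn_mul {i : ℕ} {a : M.Fn U} (ha : a ∈ M.deg U i) (w : Form M U) :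
    contract hX (fn a * w) = (-1 : ℝ) ^ ((k - 1) * i) • (fn a * contract hX w) := by
  have e : ((-1 : ℝ) ^ (k - 1).natAbs) ^ i = (-1) ^ ((k - 1) * i) := by
    rw [neg_one_natAbs, zpow_mul, zpow_natCast]
  rw [contract, DerivData.deriv_mul, DerivData.deriv_fn, scale_fn _ ha, smul_mul_assoc, e]
  simp

theorem contract_dfn_mul {i : ℕ} {a : M.Fn U} (ha : a ∈ M.deg U i) (w : Form M U) :
    contract hX (dfn a * w) =
      fn (X a) * w + (-1 : ℝ) ^ ((k - 1) * (i + 1)) • (dfn a * contract hX w) := by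
  have e : ((-1 : ℝ) ^ (k - 1).natAbs) ^ (i + 1) = (-1) ^ ((k - 1) * (i + 1)) := by
    rw [neg_one_natAbs, zpow_mul, ← zpow_natCast]
    push_cast
    rfl
  rw [contract, DerivData.deriv_mul, DerivData.deriv_dfn, scale_dfn _ ha, smul_mul_assoc, e]
  simp

theorem neg_one_zpow_mul (m n : ℤ) : (-1 : ℝ) ^ m * (-1) ^ n = (-1) ^ (m + n) :=
  (zpow_add₀ (by norm_num) _ _).symm

theorem neg_one_zpow_congr {m n : ℤ} (h : Even (m + n)) : (-1 : ℝ) ^ m = (-1) ^ n := by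
  have h1 : (-1 : ℝ) ^ m * (-1) ^ n = 1 := by rw [neg_one_zpow_mul, h.neg_one_zpow]
  have h2 : (-1 : ℝ) ^ n * (-1) ^ n = 1 := by
    rw [neg_one_zpow_mul, Even.neg_one_zpow ⟨n, rfl⟩]
  calc (-1 : ℝ) ^ m = (-1) ^ m * ((-1) ^ n * (-1) ^ n) := by rw [h2, mul_one]
    _ = (-1) ^ n := by rw [← mul_assoc, h1, one_mul]

theorem lie_one : lie hX 1 = 0 := by
  simp [lie, d_one, contract_one]

theorem lie_fn_mul {i : ℕ} {a : M.Fn U} (ha : a ∈ M.deg U i) (w : Form M U) :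
    lie hX (fn a * w) = fn (X a) * w + (-1 : ℝ) ^ (k * i) • (fn a * lie hX w) := by
  simp only [lie, LinearMap.add_apply, LinearMap.smul_apply, LinearMap.comp_apply, d_fn_mul ha,
    contract_fn_mul hX ha, contract_dfn_mul hX ha, map_add, map_smul, smul_add, mul_add,
    mul_smul_comm, smul_smul, ← zpow_natCast, neg_one_zpow_mul]
  have e1 : (-1 : ℝ) ^ (k + (k - 1) * i) = - (-1 : ℝ) ^ ((k - 1) * i + (k - 1) * 1) := by
    have : k + (k - 1) * i = (k - 1) * i + (k - 1) * 1 + 1 := by ring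
    rw [this, zpow_add₀ (by norm_num)]; simp
  have e2 : (-1 : ℝ) ^ ((i : ℤ) + (k - 1) * i) = (-1) ^ (k * i) := by congr 1; ring
  have e3 : (-1 : ℝ) ^ (k + ((k - 1) * i + (i : ℤ))) = (-1) ^ (k * i + k) := by congr 1; ring
  rw [e1, e2, e3, neg_smul]
  abel

theorem lie_dfn_mul {i : ℕ} {a : M.Fn U} (ha : a ∈ M.deg U i) (w : Form M U) :
    lie hX (dfn a * w) =
      (-1 : ℝ) ^ k • (dfn (X a) * w) + (-1 : ℝ) ^ (k * (i + 1)) • (dfn a * lie hX w) := by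
  -- `X a` has degree `i + k`, so the two terms in `X a` and `d w` cancel. This leaves `L_X (da) =
  -- (-1)^k d (X a)`.
  have hd : (-1 : ℝ) ^ (i + 1) • (fn (X a) * d w) +
      (-1 : ℝ) ^ k • d (fn (X a) * w) = (-1 : ℝ) ^ k • (dfn (X a) * w) := by
    rcases hX.map_zero_or ha with h0 | ⟨n, hn, hm⟩
    · simp [h0]
    · rw [d_fn_mul hm, smul_add, smul_smul, ← zpow_natCast, ← zpow_natCast, neg_one_zpow_mul]
      have : (-1 : ℝ) ^ (k + n) = - (-1) ^ (((i + 1 : ℕ)) : ℤ) := by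
        have h1 : (-1 : ℝ) ^ (k + n) = (-1) ^ ((i : ℤ)) := neg_one_zpow_congr (by
          rw [hn]; exact ⟨k + i, by ring⟩)
        rw [h1]; push_cast; rw [zpow_add₀ (by norm_num)]; simp
      rw [this, neg_smul]
      abel
  simp only [lie, LinearMap.add_apply, LinearMap.smul_apply, LinearMap.comp_apply, d_dfn_mul ha,
    contract_dfn_mul hX ha, map_add, map_smul, smul_add, mul_add,
    mul_smul_comm, smul_smul]
  rw [← hd]
  simp only [← zpow_natCast, neg_one_zpow_mul]
  have e2 : (-1 : ℝ) ^ (((i + 1 : ℕ) : ℤ) + ((k - 1) * i + (k - 1) * 1)) =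
      (-1) ^ (k * i + k * 1) := by
    congr 1; push_cast; ring
  have e3 : (-1 : ℝ) ^ (k + ((k - 1) * i + (k - 1) * 1 + ((i + 1 : ℕ) : ℤ))) =
      (-1) ^ (k * i + k * 1 + k) := by
    congr 1; push_cast; ring
  rw [e2, e3]
  abel

end Lie

/-! ### Homomorphisms of algebras of forms -/

theorem _root_.GHom.pullForm_fn {N : GradedManifold.{u}} {V : Opens N.Body} {P : Opens M.Body}
    (φ : GHom M P N) (hU : U ≤ P) (h : Set.MapsTo φ.body U V) (a : N.Fn V) :
    φ.pullForm V U hU h (fn a) = fn (φ.pull V U hU h a) := lift_fn _ a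

theorem _root_.GHom.pullForm_dfn {N : GradedManifold.{u}} {V : Opens N.Body} {P : Opens M.Body}
    (φ : GHom M P N) (hU : U ≤ P) (h : Set.MapsTo φ.body U V) (a : N.Fn V) :
    φ.pullForm V U hU h (dfn a) = dfn (φ.pull V U hU h a) := lift_dfn _ a

theorem _root_.GHom.pullForm_monomial {N : GradedManifold.{u}} {V : Opens N.Body}
    {P : Opens M.Body} (φ : GHom M P N) (hU : U ≤ P) (h : Set.MapsTo φ.body U V) {p : ℕ}
    {w : Form N V} (hw : IsMonomial p w) : IsMonomial p (φ.pullForm V U hU h w) := by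
  induction hw with
  | one => rw [map_one]; exact .one
  | fn_mul ha _ ih => rw [map_mul, φ.pullForm_fn]; exact .fn_mul (φ.pull_deg hU h ha) ih
  | dfn_mul ha _ ih => rw [map_mul, φ.pullForm_dfn]; exact .dfn_mul (φ.pull_deg hU h ha) ih

end GradedManifold.Form

/-! ### The total differential on products of generators -/

namespace QManifold


variable (M : QManifold.{u}) (U : Opens M.Body)

theorem totalQ_one : M.totalQ U 1 = 0 := by
  simp [totalQ, Form.d_one, Form.lie_one]

theorem Q_leibniz {i : ℕ} {a : M.Fn U} (ha : a ∈ M.deg U i) (b : M.Fn U) :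
    M.Q U (a * b) = M.Q U a * b + (-1 : ℝ) ^ i • (a * M.Q U b) := by
  have := (M.isDerivation_Q U).leibniz ha b
  rwa [one_mul, zpow_natCast] at this

theorem Q_mem {i : ℕ} {a : M.Fn U} (ha : a ∈ M.deg U i) : M.Q U a ∈ M.deg U (i + 1) :=
  (M.isDerivation_Q U).map_deg (by push_cast; ring) ha

/-- The rules `Q_TM a = da + Q a` and `Q_TM (da) = -d (Q a)`, in a form suited to induction over
monomials. Later statements about the total differential reduce to them. -/
theorem totalQ_fn_mul {i : ℕ} {a : M.Fn U} (ha : a ∈ M.deg U i)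
    (w : Form M.toGradedManifold U) :
    M.totalQ U (Form.fn a * w) = Form.dfn a * w + Form.fn (M.Q U a) * w +
      (-1 : ℝ) ^ i • (Form.fn a * M.totalQ U w) := by
  simp only [totalQ, LinearMap.add_apply, Form.d_fn_mul ha, Form.lie_fn_mul _ ha, one_mul,
    zpow_natCast, mul_add, smul_add]
  abel

theorem totalQ_dfn_mul {i : ℕ} {a : M.Fn U} (ha : a ∈ M.deg U i)
    (w : Form M.toGradedManifold U) :
    M.totalQ U (Form.dfn a * w) = -(Form.dfn (M.Q U a) * w) +
      (-1 : ℝ) ^ (i + 1) • (Form.dfn a * M.totalQ U w) := by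
  have e : (-1 : ℝ) ^ ((i : ℤ) + 1) = (-1) ^ (i + 1) := by exact_mod_cast zpow_natCast (-1 : ℝ) (i + 1)
  simp only [totalQ, LinearMap.add_apply, Form.d_dfn_mul ha, Form.lie_dfn_mul _ ha, one_mul, e,
    mul_add, smul_add, zpow_one, neg_smul, one_smul]
  abel

end QManifold

namespace GradedManifold

variable {M N : GradedManifold.{u}}

/-! ### Gluing, cut-off functions and coefficients -/

theorem eq_of_local {U : Opens M.Body} {a b : M.Fn U}
    (h : ∀ x ∈ U, ∃ (V : Opens M.Body) (hV : V ≤ U), x ∈ V ∧ M.res hV a = M.res hV b) : a = b := by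
  rw [← sub_eq_zero]
  refine eq_zero_of_local fun x hx => ?_
  obtain ⟨V, hV, hxV, h0⟩ := h x hx
  exact ⟨V, hV, hxV, by rw [map_sub, h0, sub_self]⟩

theorem exists_glue {ι : Type*} {U : Opens M.Body} (V : ι → Opens M.Body) (hV : ∀ i, V i ≤ U)
    (cover : ∀ x ∈ U, ∃ i, x ∈ V i) (k : ℕ) (s : ∀ i, M.Fn (V i)) (hs : ∀ i, s i ∈ M.deg (V i) k)
    (compat : ∀ i j, M.res (inf_le_left : V i ⊓ V j ≤ V i) (s i) = M.res inf_le_right (s j)) :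
    ∃ a ∈ M.deg U k, ∀ i, M.res (hV i) a = s i := by
  have hU : U = sSup (Set.range V) := by
    apply le_antisymm
    · intro x hx
      obtain ⟨i, hi⟩ := cover x hx
      exact (le_sSup (Set.mem_range_self i) : V i ≤ _) hi
    · rintro x hx
      obtain ⟨W, ⟨i, rfl⟩, hi⟩ := Opens.mem_sSup.1 hx
      exact hV i hi
  subst hU
  -- The sheaf axiom is indexed by the set of values of `V`, so every open set gets a chosen index.
  -- By `compat` the choice does not matter.
  choose idx hidx using fun W : Set.range V => W.2
  obtain ⟨a, ⟨ha, hres⟩, -⟩ := M.glue k (Set.range V)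
    (fun W => M.res (hidx W).ge (s (idx W))) (fun W => M.res_deg _ (hs _)) (by
      intro W W'
      have h1 : W.1 ⊓ W'.1 ≤ V (idx W) ⊓ V (idx W') := inf_le_inf (hidx W).ge (hidx W').ge
      have := congrArg (M.res h1) (compat (idx W) (idx W'))
      rw [M.res_res, M.res_res] at this
      rw [M.res_res, M.res_res, this])
  refine ⟨a, ha, fun i => ?_⟩
  have h1 := hres ⟨V i, i, rfl⟩
  refine h1.trans ?_
  have h2 := congrArg (M.res (le_inf (hidx ⟨V i, i, rfl⟩).ge le_rfl))
    (compat (idx ⟨V i, i, rfl⟩) i)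
  rw [M.res_res, M.res_res, M.res_self] at h2
  exact h2

/-- The complement of the support is open and covers the body together with `V`. A function over `V`
multiplied by `ρ` can therefore be glued with zero. -/
theorem exists_cutoff {V : Opens M.Body} {x : M.Body} (hx : x ∈ V) :
    ∃ (ρ : M.Body → ℝ) (V' O : Opens M.Body), ContMDiff (𝓡 M.dim) 𝓘(ℝ, ℝ) ∞ ρ ∧ x ∈ V' ∧ V' ≤ V ∧
      (∀ y ∈ V', ρ y = 1) ∧ (∀ y ∈ O, ρ y = 0) ∧ ∀ y, y ∈ V ∨ y ∈ O := by
  obtain ⟨f, -, hf⟩ := (SmoothBumpFunction.nhds_basis_tsupport (I := 𝓡 M.dim) x).mem_iff.1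
    (V.isOpen.mem_nhds hx)
  have h1 : {y | f y = 1} ∩ V ∈ nhds x :=
    Filter.inter_mem f.eventuallyEq_one (V.isOpen.mem_nhds hx)
  obtain ⟨W, hW, hWo, hxW⟩ := mem_nhds_iff.1 h1
  refine ⟨f, ⟨W, hWo⟩, ⟨(tsupport f)ᶜ, (isClosed_tsupport f).isOpen_compl⟩, f.contMDiff, hxW,
    fun y hy => (hW hy).2, fun y hy => (hW hy).1,
    fun y hy => image_eq_zero_of_notMem_tsupport hy, fun y => ?_⟩
  by_cases hy : y ∈ tsupport f
  · exact .inl (hf hy)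
  · exact .inr hy

/-- The restriction to `U` of a smooth function on the body. -/
def smoothRestrict (U : Opens M.Body) {ρ : M.Body → ℝ} (hρ : ContMDiff (𝓡 M.dim) 𝓘(ℝ, ℝ) ∞ ρ) :
    M.Smooth U :=
  ⟨fun y => ρ y, hρ.comp contMDiff_subtype_val⟩

theorem res_smoothRestrict {U V : Opens M.Body} (h : V ≤ U) {ρ : M.Body → ℝ}
    (hρ : ContMDiff (𝓡 M.dim) 𝓘(ℝ, ℝ) ∞ ρ) :
    M.res h (M.ofSmooth U (smoothRestrict U hρ)) = M.ofSmooth V (smoothRestrict V hρ) := by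
  rw [M.res_ofSmooth]
  rfl

theorem ofSmooth_smoothRestrict_one {U : Opens M.Body} {ρ : M.Body → ℝ}
    (hρ : ContMDiff (𝓡 M.dim) 𝓘(ℝ, ℝ) ∞ ρ) (h : ∀ y ∈ U, ρ y = 1) :
    M.ofSmooth U (smoothRestrict U hρ) = 1 := by
  rw [← map_one (M.ofSmooth U)]
  congr 1
  ext y
  exact h y y.2

theorem ofSmooth_smoothRestrict_zero {U : Opens M.Body} {ρ : M.Body → ℝ}
    (hρ : ContMDiff (𝓡 M.dim) 𝓘(ℝ, ℝ) ∞ ρ) (h : ∀ y ∈ U, ρ y = 0) :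
    M.ofSmooth U (smoothRestrict U hρ) = 0 := by
  rw [← map_zero (M.ofSmooth U)]
  congr 1
  ext y
  exact h y y.2

/-- Near a given point, functions over `V` are restrictions of functions over a larger `U`. -/
theorem exists_extension {U V : Opens M.Body} (hVU : V ≤ U) {x : M.Body} (hx : x ∈ V) :
    ∃ (V' : Opens M.Body) (hV' : V' ≤ V), x ∈ V' ∧ ∀ (k : ℕ) (b : M.Fn V), b ∈ M.deg V k →
      ∃ b' ∈ M.deg U k, M.res (hV'.trans hVU) b' = M.res hV' b := by
  obtain ⟨ρ, V', O, hρ, hxV', hV', h1, h0, hcov⟩ := exists_cutoff hx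
  -- `V'` is fixed before `b`, so one neighbourhood serves all functions that enter a family. `U` is
  -- covered by `V`, carrying `ρ b`, and `U ⊓ O`, carrying zero.
  refine ⟨V', hV', hxV', fun k b hb => ?_⟩
  let W : Bool → Opens M.Body := fun i => bif i then V else U ⊓ O
  have hres : M.res (inf_le_left : V ⊓ (U ⊓ O) ≤ V) (M.ofSmooth V (smoothRestrict V hρ) * b) = 0 := by
    rw [map_mul, res_smoothRestrict,
      ofSmooth_smoothRestrict_zero (U := V ⊓ (U ⊓ O)) _ fun y hy => h0 y hy.2.2, zero_mul]
  obtain ⟨a, ha, hres'⟩ := exists_glue (M := M) (U := U) W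
    (by rintro (_ | _); exacts [inf_le_left, hVU])
    (fun y hy => (hcov y).elim (fun h => ⟨true, h⟩) fun h => ⟨false, hy, h⟩) k
    (fun i => match i with
      | true => M.ofSmooth V (smoothRestrict V hρ) * b
      | false => 0)
    (by
      rintro (_ | _)
      · exact Submodule.zero_mem _
      · have := SetLike.GradedMul.mul_mem (ofSmooth_mem_deg_zero (smoothRestrict V hρ)) hb
        rwa [zero_add] at this)
    (by
      rintro (_ | _) (_ | _)
      · rfl
      · change M.res _ 0 = M.res (inf_le_right : (U ⊓ O) ⊓ V ≤ V) _
        rw [map_zero, map_mul, res_smoothRestrict,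
          ofSmooth_smoothRestrict_zero (U := (U ⊓ O) ⊓ V) _ fun y hy => h0 y hy.1.2, zero_mul]
      · change M.res (inf_le_left : V ⊓ (U ⊓ O) ≤ V) _ = M.res _ 0
        rw [map_zero, hres]
      · rfl)
  refine ⟨a, ha, ?_⟩
  have h2 : M.res hVU a = M.ofSmooth V (smoothRestrict V hρ) * b := hres' true
  rw [← M.res_res hVU hV', h2, map_mul, res_smoothRestrict, ofSmooth_smoothRestrict_one _ h1,
    one_mul]

theorem exists_extension_smooth {U V V' : Opens M.Body} (hVU : V ≤ U) (hV' : V' ≤ V)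
    (h : ∀ (k : ℕ) (b : M.Fn V), b ∈ M.deg V k →
      ∃ b' ∈ M.deg U k, M.res (hV'.trans hVU) b' = M.res hV' b) (f : M.Smooth V) :
    ∃ f' : M.Smooth U, M.res (hV'.trans hVU) (M.ofSmooth U f') = M.res hV' (M.ofSmooth V f) := by
  obtain ⟨b', hb', hres⟩ := h 0 _ (ofSmooth_mem_deg_zero f)
  obtain ⟨f', rfl⟩ := M.mem_deg_zero.1 hb'
  exact ⟨f', hres⟩

theorem exists_extension_fn {U V V' : Opens M.Body} (hVU : V ≤ U) (hV' : V' ≤ V)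
    (h : ∀ (k : ℕ) (b : M.Fn V), b ∈ M.deg V k →
      ∃ b' ∈ M.deg U k, M.res (hV'.trans hVU) b' = M.res hV' b) (b : M.Fn V) :
    ∃ b' : M.Fn U, M.res (hV'.trans hVU) b' = M.res hV' b := by
  induction b using DirectSum.Decomposition.inductionOn (M.deg V) with
  | zero => exact ⟨0, by simp⟩
  | homogeneous b => exact (h _ b b.2).imp fun _ hb => hb.2
  | add b c hb hc =>
    obtain ⟨b', hb'⟩ := hb
    obtain ⟨c', hc'⟩ := hc
    exact ⟨b' + c', by rw [map_add, map_add, hb', hc']⟩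

/-- Freeness as an isomorphism that is linear over the smooth functions. Multiplying by a smooth
function multiplies every coefficient, so a family `g (t, h) b` can be differentiated
coefficientwise. -/
theorem exists_coefficients {U V : Opens M.Body} {m : ℕ} {d : Fin m → ℕ} {ξ : Fin m → M.Fn U}
    (hξ : M.IsGenerating U d ξ) (hV : V ≤ U) :
    ∃ T : (GradedSpace.Exponent d →₀ M.Smooth V) ≃ₗ[ℝ] M.Fn V,
      (∀ c, T c = c.sum fun μ f => M.ofSmooth V f * M.res hV (M.monomial ξ μ)) ∧
      ∀ (f : M.Smooth V) c, T (f • c) = M.ofSmooth V f * T c := by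
  let T : (GradedSpace.Exponent d →₀ M.Smooth V) →ₗ[ℝ] M.Fn V :=
    { toFun := fun c => c.sum fun μ f => M.ofSmooth V f * M.res hV (M.monomial ξ μ)
      map_add' := fun c c' => Finsupp.sum_add_index' (by simp) (by intros; rw [map_add, add_mul])
      map_smul' := fun t c => by
        rw [Finsupp.sum_smul_index' (by simp), RingHom.id_apply, Finsupp.smul_sum]
        simp only [map_smul, smul_mul_assoc] }
  have hT : ∀ c, T c = c.sum fun μ f => M.ofSmooth V f * M.res hV (M.monomial ξ μ) :=
    fun c => rfl
  have hb : Function.Bijective T := by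
    refine Function.bijective_iff_existsUnique _ |>.2 fun a => ?_
    obtain ⟨c, hc, hu⟩ := hξ.existsUnique V hV a
    exact ⟨c, hc.symm, fun c' hc' => hu c' (hc'.symm.trans (hT c'))⟩
  refine ⟨LinearEquiv.ofBijective T hb, fun c => rfl, fun f c => ?_⟩
  simp only [LinearEquiv.ofBijective_apply, hT]
  rw [Finsupp.sum_smul_index (by simp), Finsupp.mul_sum]
  simp only [map_mul, mul_assoc]

/-! ### Derivations along homomorphisms -/

theorem smoothComp_apply {U : Opens M.Body} {r : ℕ} (g : (Fin r → ℝ) → ℝ) (hg : ContDiff ℝ ∞ g)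
    (h : Fin r → M.Smooth U) (x : U) : smoothComp g hg h x = g fun i => h i x := rfl

/-- The chain rule for a derivation along the pull-back by a morphism. -/
theorem chain_along {P : Opens M.Body} (φ : GHom M P N) {V : Opens N.Body} {W : Opens M.Body}
    (hW : W ≤ P) (h : Set.MapsTo φ.body W V) {D : N.Fn V →ₗ[ℝ] M.Fn W}
    (hD : ∀ (f : N.Smooth V) b, D (N.ofSmooth V f * b) =
      D (N.ofSmooth V f) * φ.pull V W hW h b + φ.pull V W hW h (N.ofSmooth V f) * D b)
    {r : ℕ} (g : (Fin r → ℝ) → ℝ) (hg : ContDiff ℝ ∞ g) (k : Fin r → N.Smooth V) :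
    D (N.ofSmooth V (smoothComp g hg k)) =
      ∑ i, φ.pull V W hW h
        (N.ofSmooth V (smoothComp (partialDeriv g i) (partialDeriv_contDiff hg i) k)) *
        D (N.ofSmooth V (k i)) := by
  have hone : D 1 = 0 := by simpa using hD 1 1
  rw [← sub_eq_zero]
  refine eq_zero_of_pointwise fun x => ?_
  set x' : V := ⟨φ.body x, h x.2⟩
  -- Hadamard's lemma at the image point writes the difference of the two sides as a sum of products
  -- whose first factors vanish at `x`: pull-backs of `k i - k i x'`, and pull-backs of `G i - ∂ᵢg`
  -- composed with `k`.
  obtain ⟨G, hG, hG0, hgG⟩ := hadamard hg fun i => k i x'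
  have e : smoothComp g hg k = algebraMap ℝ _ (g fun i => k i x') +
      ∑ i, (k i - algebraMap ℝ _ (k i x')) * smoothComp (G i) (hG i) k := by
    ext y
    have h2 : ∀ (p : Fin r → N.Smooth V), (∑ j, p j) y = ∑ j, p j y := fun p =>
      map_sum (ContMDiffMap.evalRingHom y) p _
    rw [ContMDiffMap.coe_add, Pi.add_apply, h2]
    exact hgG _
  have hconst : ∀ t : ℝ, D (N.ofSmooth V (algebraMap ℝ _ t)) = 0 := fun t => by
    rw [AlgHom.commutes, Algebra.algebraMap_eq_smul_one, map_smul, hone, smul_zero]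
  choose p hp hp' using fun f => φ.pull_ofSmooth hW h f
  refine ⟨r + r, Fin.append (fun i => p (k i - algebraMap ℝ _ (k i x')))
      (fun i => p (smoothComp (G i) (hG i) k -
        smoothComp (partialDeriv g i) (partialDeriv_contDiff hg i) k)),
    Fin.append (fun i => D (N.ofSmooth V (smoothComp (G i) (hG i) k)))
      (fun i => D (N.ofSmooth V (k i))), ?_, ?_⟩
  · intro j
    refine Fin.addCases (fun i => ?_) (fun i => ?_) j
    · simp only [Fin.append_left]
      rw [hp]
      exact sub_self (k i x')
    · simp only [Fin.append_right]
      rw [hp]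
      exact sub_eq_zero.2 (hG0 i)
  · rw [Fin.sum_univ_add, e]
    simp only [Fin.append_left, Fin.append_right, ← hp']
    simp only [map_add, map_sum, map_mul, hD, map_sub, hconst,
      zero_add, zero_mul, sub_mul, Finset.sum_add_distrib, Finset.sum_sub_distrib]
    have hc : ∀ f a, φ.pull V W hW h (N.ofSmooth V f) * a =
        a * φ.pull V W hW h (N.ofSmooth V f) := fun f a => by
      rw [hp', ofSmooth_commute]
    simp only [hc (smoothComp (G _) (hG _) k)]
    abel

/-- A derivation along a pull-back is local. -/
theorem local_along {P : Opens M.Body} (φ : GHom M P N) {V V' : Opens N.Body} {W W' : Opens M.Body}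
    (hW : W ≤ P) (h : Set.MapsTo φ.body W V) {D : N.Fn V →ₗ[ℝ] M.Fn W}
    (hD : ∀ (f : N.Smooth V) b, D (N.ofSmooth V f * b) =
      D (N.ofSmooth V f) * φ.pull V W hW h b + φ.pull V W hW h (N.ofSmooth V f) * D b)
    (hV' : V' ≤ V) (hW' : W' ≤ W) (h' : Set.MapsTo φ.body W' V') {a b : N.Fn V}
    (hab : N.res hV' a = N.res hV' b) : M.res hW' (D a) = M.res hW' (D b) := by
  rw [← sub_eq_zero, ← map_sub, ← map_sub]
  have ha : N.res hV' (a - b) = 0 := by rw [map_sub, hab, sub_self]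
  generalize a - b = c at ha
  refine eq_zero_of_local fun x hx => ?_
  obtain ⟨ρ, V₁, O, hρ, hxV₁, hV₁, h1, h0, hcov⟩ := exists_cutoff (h' hx)
  -- `ρ` is one near the image of `x` and is zero off `V'`, where `c` vanishes, so `ρ c = 0`.
  -- Applying `D` and restricting to the set where `ρ = 1` leaves only `D c`.
  have hz : N.ofSmooth V (smoothRestrict V hρ) * c = 0 := by
    refine eq_zero_of_local fun y hy => ?_
    rcases hcov y with hy' | hy'
    · exact ⟨V', hV', hy', by rw [map_mul, ha, mul_zero]⟩
    · exact ⟨V ⊓ O, inf_le_left, ⟨hy, hy'⟩, by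
        rw [map_mul, res_smoothRestrict,
          ofSmooth_smoothRestrict_zero (U := V ⊓ O) _ fun y hy => h0 y hy.2, zero_mul]⟩
  have hcont : ContinuousOn φ.body W' :=
    φ.contMDiffOn_body.continuousOn.mono (hW'.trans hW)
  let W₁ : Opens M.Body := ⟨W' ∩ φ.body ⁻¹' V₁, hcont.isOpen_inter_preimage W'.isOpen V₁.isOpen⟩
  have hW₁ : W₁ ≤ W' := fun y hy => hy.1
  refine ⟨W₁, hW₁, ⟨hx, hxV₁⟩, ?_⟩
  have hmaps : Set.MapsTo φ.body W₁ V₁ := fun y hy => hy.2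
  have key := congrArg (M.res (hW₁.trans hW')) (hD (smoothRestrict V hρ) c)
  rw [hz, map_zero, map_zero, map_add, map_mul, map_mul,
    ← φ.pull_res (hV₁.trans hV') (hW₁.trans hW') hW h hmaps c,
    ← φ.pull_res (hV₁.trans hV') (hW₁.trans hW') hW h hmaps, res_smoothRestrict,
    ofSmooth_smoothRestrict_one _ h1, map_one, one_mul, ← N.res_res hV' hV₁, ha, map_zero, map_zero,
    mul_zero, zero_add] at key
  rw [M.res_res, ← key]

end GradedManifold

/-- Multiplication of functions of degree `i` by `s ^ i`, as a morphism. -/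
noncomputable def GHom.scaling (M : GradedManifold.{u}) (s : ℝ) : GHom M ⊤ M where
  body := id
  contMDiffOn_body := contMDiffOn_id
  pull V W _ h := (GradedManifold.scaleFn W s).comp (M.res (show W ≤ V from fun _ hx => h hx))
  pull_deg _ _ _ _ ha := by
    rw [AlgHom.comp_apply, GradedManifold.scaleFn_of_mem s (M.res_deg _ ha)]
    exact Submodule.smul_mem _ _ (M.res_deg _ ha)
  pull_res {V V' W W'} hV hW' hW h h' a := by
    induction a using DirectSum.Decomposition.inductionOn (M.deg V) with
    | zero => simp
    | homogeneous a =>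
      simp only [AlgHom.comp_apply]
      rw [GradedManifold.scaleFn_of_mem s (M.res_deg _ (M.res_deg _ a.2)),
        GradedManifold.scaleFn_of_mem s (M.res_deg _ a.2), map_smul, M.res_res, M.res_res]
    | add a b ha hb => simp only [map_add, ha, hb]
  pull_ofSmooth {V W} hW h f := by
    refine ⟨ContMDiffMap.restrictRingHom (𝓡 M.dim) 𝓘(ℝ, ℝ) ℝ (fun _ hx => h hx) f,
      fun x => rfl, ?_⟩
    rw [AlgHom.comp_apply, M.res_ofSmooth,
      GradedManifold.scaleFn_of_mem s (GradedManifold.ofSmooth_mem_deg_zero _), pow_zero, one_smul]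

namespace GradedManifold

variable {M N : GradedManifold.{u}}

theorem scaleFn_one (U : Opens M.Body) : scaleFn (M := M) U 1 = AlgHom.id ℝ _ := by
  ext a
  induction a using DirectSum.Decomposition.inductionOn (M.deg U) with
  | zero => simp
  | homogeneous a => rw [scaleFn_of_mem _ a.2]; simp
  | add a b ha hb => rw [map_add, ha, hb, map_add]

/-- For `s = 1` the scaling morphism pulls back by restriction. Results on pull-backs thus
specialise to restrictions, and results on derivations along a pull-back to ordinary derivations. -/
theorem scaling_one_pull {V W : Opens M.Body} (hW : W ≤ ⊤) (h : W ≤ V)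
    (a : M.Fn V) : (GHom.scaling M 1).pull V W hW (fun _ hx => h hx) a = M.res h a := by
  simp [GHom.scaling, scaleFn_one]

theorem scaling_pull_self {W : Opens M.Body} (s : ℝ) (hW : W ≤ ⊤)
    (a : M.Fn W) : (GHom.scaling M s).pull W W hW (fun _ hx => hx) a = scaleFn W s a := by
  simp [GHom.scaling, M.res_self]

/-! ### Smooth families of functions -/

/-- The family `t ↦ g (t, h₁, …, h_n) b` of functions over `U`. -/
noncomputable def elemFamily {U : Opens M.Body} {n : ℕ} (g : (Fin (n + 1) → ℝ) → ℝ)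
    (hg : ContDiff ℝ ∞ g) (h : Fin n → M.Smooth U) (b : M.Fn U) (t : ℝ) : M.Fn U :=
  M.ofSmooth U (smoothComp g hg (Fin.cons (algebraMap ℝ (M.Smooth U) t) h)) * b

/-- Finite sums of the families `elemFamily`, paired with their derivatives in the parameter. -/
noncomputable def elemFamilies (M : GradedManifold.{u}) (U : Opens M.Body) :
    Submodule ℝ ((ℝ → M.Fn U) × (ℝ → M.Fn U)) :=
  Submodule.span ℝ {p | ∃ (n : ℕ) (g : (Fin (n + 1) → ℝ) → ℝ) (hg : ContDiff ℝ ∞ g)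
    (h : Fin n → M.Smooth U) (b : M.Fn U),
    p = (elemFamily g hg h b, elemFamily (partialDeriv g 0) (partialDeriv_contDiff hg 0) h b)}

theorem elemFamily_mem {U : Opens M.Body} {n : ℕ} (g : (Fin (n + 1) → ℝ) → ℝ)
    (hg : ContDiff ℝ ∞ g) (h : Fin n → M.Smooth U) (b : M.Fn U) :
    (elemFamily g hg h b, elemFamily (partialDeriv g 0) (partialDeriv_contDiff hg 0) h b) ∈
      elemFamilies M U :=
  Submodule.subset_span ⟨n, g, hg, h, b, rfl⟩

/-- `c` is a smooth family, with parameter in `ℝ`, of functions over `U`, with derivative `c'`. -/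
def IsFamily (M : GradedManifold.{u}) (U : Opens M.Body) (c c' : ℝ → M.Fn U) : Prop :=
  ∀ x ∈ U, ∃ (V : Opens M.Body) (hV : V ≤ U) (e de : ℝ → M.Fn V), x ∈ V ∧
    (e, de) ∈ elemFamilies M V ∧ ∀ t, M.res hV (c t) = e t ∧ M.res hV (c' t) = de t

/-- Linear maps send elementary families to such families if they do so on the generators. -/
theorem map_elemFamilies {U : Opens M.Body} {V : Opens N.Body} (D : M.Fn U →ₗ[ℝ] N.Fn V)
    (H : ∀ {n : ℕ} (g : (Fin (n + 1) → ℝ) → ℝ) (hg : ContDiff ℝ ∞ g) (h : Fin n → M.Smooth U)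
      (b : M.Fn U), ((fun t => D (elemFamily g hg h b t)),
        fun t => D (elemFamily (partialDeriv g 0) (partialDeriv_contDiff hg 0) h b t)) ∈
          elemFamilies N V) {e e' : ℝ → M.Fn U} (he : (e, e') ∈ elemFamilies M U) :
    ((fun t => D (e t)), fun t => D (e' t)) ∈ elemFamilies N V := by
  let L : ((ℝ → M.Fn U) × (ℝ → M.Fn U)) →ₗ[ℝ] ((ℝ → N.Fn V) × (ℝ → N.Fn V)) :=
    (LinearMap.compLeft D ℝ).prodMap (LinearMap.compLeft D ℝ)
  suffices elemFamilies M U ≤ (elemFamilies N V).comap L from this he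
  refine Submodule.span_le.2 ?_
  rintro _ ⟨n, g, hg, h, b, rfl⟩
  exact H g hg h b

/-- Pull-backs fix constants, hence the parameter. The functions `k'` do not depend on `g`, so they
serve a family and its derivative alike, and pull-back respects the pairing of the two. -/
theorem pull_elemFamily {P : Opens M.Body} (φ : GHom M P N) {V : Opens N.Body} {W : Opens M.Body}
    (hW : W ≤ P) (h : Set.MapsTo φ.body W V) {n : ℕ} (k : Fin n → N.Smooth V) :
    ∃ k' : Fin n → M.Smooth W, ∀ (g : (Fin (n + 1) → ℝ) → ℝ) (hg : ContDiff ℝ ∞ g) (b : N.Fn V)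
      (t : ℝ), φ.pull V W hW h (elemFamily g hg k b t) =
        elemFamily g hg k' (φ.pull V W hW h b) t := by
  choose k' hk' hpk' using fun i => φ.pull_ofSmooth hW h (k i)
  refine ⟨k', fun g hg b t => ?_⟩
  obtain ⟨f', hf', hcomp⟩ := φ.pull_smoothComp hW h
    (Fin.cons (algebraMap ℝ (N.Smooth V) t) k : Fin (n + 1) → N.Smooth V)
  rw [elemFamily, map_mul, hcomp, elemFamily]
  congr 3
  funext i
  apply M.ofSmooth_injective
  rw [← hf']
  refine Fin.cases ?_ (fun i => ?_) i
  · simp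
  · simp [hpk']

theorem pull_mem_elemFamilies {P : Opens M.Body} (φ : GHom M P N) {V : Opens N.Body}
    {W : Opens M.Body} (hW : W ≤ P) (h : Set.MapsTo φ.body W V) {e e' : ℝ → N.Fn V}
    (he : (e, e') ∈ elemFamilies N V) :
    ((fun t => φ.pull V W hW h (e t)), fun t => φ.pull V W hW h (e' t)) ∈ elemFamilies M W := by
  refine map_elemFamilies (φ.pull V W hW h).toLinearMap (fun g hg k b => ?_) he
  obtain ⟨k', hk'⟩ := pull_elemFamily φ hW h k
  simp only [AlgHom.toLinearMap_apply, hk']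
  exact elemFamily_mem _ _ _ _

theorem res_mem_elemFamilies {U V : Opens M.Body} (h : V ≤ U) {e e' : ℝ → M.Fn U}
    (he : (e, e') ∈ elemFamilies M U) :
    ((fun t => M.res h (e t)), fun t => M.res h (e' t)) ∈ elemFamilies M V := by
  have := pull_mem_elemFamilies (GHom.scaling M 1) (V := U) (W := V) le_top (fun _ hx => h hx) he
  simpa only [scaling_one_pull le_top h] using this

theorem partialDeriv_comp_clm {m n : ℕ} {g : (Fin m → ℝ) → ℝ} (hg : ContDiff ℝ ∞ g)
    (A : (Fin n → ℝ) →L[ℝ] (Fin m → ℝ)) (i : Fin n) (j : Fin m)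
    (hA : A (Pi.single i 1) = Pi.single j 1) (y : Fin n → ℝ) :
    partialDeriv (fun y => g (A y)) i y = partialDeriv g j (A y) := by
  have h1 := (hg.differentiable (by simp) (A y)).hasFDerivAt.comp y A.hasFDerivAt
  unfold partialDeriv
  rw [show (fun y => g (A y)) = g ∘ A from rfl, h1.fderiv, ContinuousLinearMap.comp_apply, hA]

theorem partialDeriv_mul {n : ℕ} {f g : (Fin n → ℝ) → ℝ} (hf : ContDiff ℝ ∞ f)
    (hg : ContDiff ℝ ∞ g) (i : Fin n) (y : Fin n → ℝ) :
    partialDeriv (fun y => f y * g y) i y = partialDeriv f i y * g y + f y * partialDeriv g i y := by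
  unfold partialDeriv
  rw [fderiv_fun_mul (hf.differentiable (by simp) y) (hg.differentiable (by simp) y)]
  simp
  ring

theorem elemFamily_mul {U : Opens M.Body} {n m : ℕ} (g : (Fin (n + 1) → ℝ) → ℝ)
    (hg : ContDiff ℝ ∞ g) (h : Fin n → M.Smooth U) (b : M.Fn U) (g' : (Fin (m + 1) → ℝ) → ℝ)
    (hg' : ContDiff ℝ ∞ g') (h' : Fin m → M.Smooth U) (b' : M.Fn U) :
    ((fun t => elemFamily g hg h b t * elemFamily g' hg' h' b' t),
      fun t => elemFamily (partialDeriv g 0) (partialDeriv_contDiff hg 0) h b t *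
          elemFamily g' hg' h' b' t + elemFamily g hg h b t *
          elemFamily (partialDeriv g' 0) (partialDeriv_contDiff hg' 0) h' b' t) ∈
      elemFamilies M U := by
  -- The two projections share coordinate zero, the parameter, and split the remaining coordinates.
  -- Both send the parameter direction to the parameter direction, so `∂₀` of the product is given
  -- by the product rule.
  let A : (Fin (n + m + 1) → ℝ) →L[ℝ] (Fin (n + 1) → ℝ) :=
    ContinuousLinearMap.pi fun i => ContinuousLinearMap.proj
      ((Fin.cons 0 fun j => (Fin.castAdd m j).succ : Fin (n + 1) → Fin (n + m + 1)) i)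
  let A' : (Fin (n + m + 1) → ℝ) →L[ℝ] (Fin (m + 1) → ℝ) :=
    ContinuousLinearMap.pi fun i => ContinuousLinearMap.proj
      ((Fin.cons 0 fun j => (Fin.natAdd n j).succ : Fin (m + 1) → Fin (n + m + 1)) i)
  have hA : A (Pi.single 0 1) = Pi.single 0 1 := by
    ext i; refine Fin.cases ?_ (fun i => ?_) i <;> simp [A]
  have hA' : A' (Pi.single 0 1) = Pi.single 0 1 := by
    ext i; refine Fin.cases ?_ (fun i => ?_) i <;> simp [A']
  have hgA : ContDiff ℝ ∞ fun y => g (A y) := hg.comp A.contDiff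
  have hgA' : ContDiff ℝ ∞ fun y => g' (A' y) := hg'.comp A'.contDiff
  have key := elemFamily_mem (M := M) (fun y => g (A y) * g' (A' y)) (hgA.mul hgA')
    (Fin.append h h') (b * b')
  have hev : ∀ (t : ℝ) (x : U), A (fun i => (Fin.cons (algebraMap ℝ (M.Smooth U) t)
      (Fin.append h h') : Fin (n + m + 1) → M.Smooth U) i x) = fun i =>
      (Fin.cons (algebraMap ℝ (M.Smooth U) t) h : Fin (n + 1) → M.Smooth U) i x := by
    intro t x
    ext i; refine Fin.cases ?_ (fun i => ?_) i <;> simp [A]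
  have hev' : ∀ (t : ℝ) (x : U), A' (fun i => (Fin.cons (algebraMap ℝ (M.Smooth U) t)
      (Fin.append h h') : Fin (n + m + 1) → M.Smooth U) i x) = fun i =>
      (Fin.cons (algebraMap ℝ (M.Smooth U) t) h' : Fin (m + 1) → M.Smooth U) i x := by
    intro t x
    ext i; refine Fin.cases ?_ (fun i => ?_) i <;> simp [A']
  have hcomm : ∀ (f f' : M.Smooth U), M.ofSmooth U f * b * (M.ofSmooth U f' * b') =
      M.ofSmooth U (f * f') * (b * b') := by
    intro f f'
    rw [map_mul, mul_assoc, ← mul_assoc b, ← ofSmooth_commute f' b]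
    simp only [mul_assoc]
  convert key using 2
  · funext t
    simp only [elemFamily, hcomm]
    congr 2
    ext x
    simp only [ContMDiffMap.coe_mul, Pi.mul_apply, smoothComp_apply, hev, hev']
  · funext t
    simp only [elemFamily, hcomm, ← add_mul, ← map_add]
    congr 2
    ext x
    simp only [ContMDiffMap.coe_add, ContMDiffMap.coe_mul, Pi.add_apply, Pi.mul_apply,
      smoothComp_apply]
    rw [partialDeriv_mul hgA hgA', partialDeriv_comp_clm hg A 0 0 hA,
      partialDeriv_comp_clm hg' A' 0 0 hA', hev, hev']

theorem mul_mem_elemFamilies {U : Opens M.Body} {e e' f f' : ℝ → M.Fn U}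
    (he : (e, e') ∈ elemFamilies M U) (hf : (f, f') ∈ elemFamilies M U) :
    ((fun t => e t * f t), fun t => e' t * f t + e t * f' t) ∈ elemFamilies M U := by
  have h1 : ∀ p ∈ elemFamilies M U, ∀ q ∈ elemFamilies M U,
      ((fun t => p.1 t * q.1 t), fun t => p.2 t * q.1 t + p.1 t * q.2 t) ∈ elemFamilies M U := by
    intro p hp q hq
    induction hp using Submodule.span_induction with
    | mem p hp =>
      induction hq using Submodule.span_induction with
      | mem q hq =>
        obtain ⟨n, g, hg, h, b, rfl⟩ := hp
        obtain ⟨m, g', hg', h', b', rfl⟩ := hq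
        exact elemFamily_mul g hg h b g' hg' h' b'
      | zero =>
        convert Submodule.zero_mem (elemFamilies M U) using 1
        ext t <;> simp
      | add q q' _ _ hq hq' =>
        convert Submodule.add_mem _ hq hq' using 1
        ext t <;> simp [mul_add]; abel
      | smul s q _ hq =>
        convert Submodule.smul_mem _ s hq using 1
        ext t <;> simp
    | zero =>
      convert Submodule.zero_mem (elemFamilies M U) using 1
      ext t <;> simp
    | add p p' _ _ hp hp' =>
      convert Submodule.add_mem _ hp hp' using 1
      ext t <;> simp [add_mul]; abel
    | smul s p _ hp =>
      convert Submodule.smul_mem _ s hp using 1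
      ext t <;> simp
  exact h1 _ he _ hf

theorem const_mem_elemFamilies {U : Opens M.Body} (b : M.Fn U) :
    ((fun _ => b), fun _ => 0) ∈ elemFamilies M U := by
  have h1 : ∀ t, elemFamily (M := M) (U := U) (n := 0) (fun _ => 1) contDiff_const Fin.elim0 b t = b := by
    intro t
    have : smoothComp (M := M) (U := U) (fun _ : Fin (0 + 1) → ℝ => (1 : ℝ)) contDiff_const
        (Fin.cons (algebraMap ℝ (M.Smooth U) t) Fin.elim0) = 1 := by ext; rfl
    rw [elemFamily, this, map_one, one_mul]
  have h0 : ∀ hg t, elemFamily (M := M) (U := U) (n := 0) (partialDeriv (fun _ => 1) 0)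
      hg Fin.elim0 b t = 0 := by
    intro hg t
    have : smoothComp (M := M) (U := U) (partialDeriv (fun _ : Fin (0 + 1) → ℝ => (1 : ℝ)) 0)
        hg (Fin.cons (algebraMap ℝ (M.Smooth U) t) Fin.elim0) = 0 := by
      ext; simp [smoothComp_apply, partialDeriv]
    rw [elemFamily, this, map_zero, zero_mul]
  have := elemFamily_mem (M := M) (U := U) (n := 0) (fun _ => 1) contDiff_const Fin.elim0 b
  convert this using 2
  · funext t; rw [h1]
  · funext t; rw [h0]

namespace IsFamily

variable {U : Opens M.Body}

theorem restrict {c c' : ℝ → M.Fn U} (hc : IsFamily M U c c') {V : Opens M.Body} (h : V ≤ U) :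
    IsFamily M V (fun t => M.res h (c t)) (fun t => M.res h (c' t)) := by
  intro x hx
  obtain ⟨W, hW, e, e', hxW, he, heq⟩ := hc x (h hx)
  refine ⟨V ⊓ W, inf_le_left, _, _, ⟨hx, hxW⟩, res_mem_elemFamilies inf_le_right he, fun t => ?_⟩
  rw [← (heq t).1, ← (heq t).2]
  simp only [M.res_res, true_and]

theorem of_mem {e e' : ℝ → M.Fn U} (he : (e, e') ∈ elemFamilies M U) : IsFamily M U e e' :=
  fun _ hx => ⟨U, le_rfl, e, e', hx, he, fun _ => ⟨M.res_self _, M.res_self _⟩⟩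

theorem const (b : M.Fn U) : IsFamily M U (fun _ => b) (fun _ => 0) :=
  of_mem (const_mem_elemFamilies b)

/-- Two families have simultaneous elementary expressions near every point. -/
theorem exists_pair {c c' k k' : ℝ → M.Fn U} (hc : IsFamily M U c c') (hk : IsFamily M U k k')
    {x : M.Body} (hx : x ∈ U) :
    ∃ (V : Opens M.Body) (hV : V ≤ U), x ∈ V ∧
      ((fun t => M.res hV (c t)), fun t => M.res hV (c' t)) ∈ elemFamilies M V ∧
      ((fun t => M.res hV (k t)), fun t => M.res hV (k' t)) ∈ elemFamilies M V := by
  obtain ⟨V, hV, e, e', hxV, he, heq⟩ := hc x hx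
  obtain ⟨W, hW, f, f', hxW, hf, hfeq⟩ := hk x hx
  obtain rfl : (fun t => M.res hV (c t)) = e := funext fun t => (heq t).1
  obtain rfl : (fun t => M.res hV (c' t)) = e' := funext fun t => (heq t).2
  obtain rfl : (fun t => M.res hW (k t)) = f := funext fun t => (hfeq t).1
  obtain rfl : (fun t => M.res hW (k' t)) = f' := funext fun t => (hfeq t).2
  refine ⟨V ⊓ W, inf_le_left.trans hV, ⟨hxV, hxW⟩, ?_, ?_⟩
  · have := res_mem_elemFamilies (inf_le_left : V ⊓ W ≤ V) he
    simpa only [M.res_res] using this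
  · have := res_mem_elemFamilies (inf_le_right : V ⊓ W ≤ W) hf
    simpa only [M.res_res] using this

theorem add {c c' k k' : ℝ → M.Fn U} (hc : IsFamily M U c c') (hk : IsFamily M U k k') :
    IsFamily M U (fun t => c t + k t) (fun t => c' t + k' t) := by
  intro x hx
  obtain ⟨V, hV, hxV, h1, h2⟩ := hc.exists_pair hk hx
  exact ⟨V, hV, _, _, hxV, Submodule.add_mem _ h1 h2, fun t => by simp⟩

theorem smul {c c' : ℝ → M.Fn U} (hc : IsFamily M U c c') (s : ℝ) :
    IsFamily M U (fun t => s • c t) (fun t => s • c' t) := by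
  intro x hx
  obtain ⟨V, hV, hxV, h1, h2⟩ := hc.exists_pair hc hx
  exact ⟨V, hV, _, _, hxV, Submodule.smul_mem _ s h1, fun t => by simp⟩

theorem sub {c c' k k' : ℝ → M.Fn U} (hc : IsFamily M U c c') (hk : IsFamily M U k k') :
    IsFamily M U (fun t => c t - k t) (fun t => c' t - k' t) := by
  simpa [sub_eq_add_neg] using hc.add (hk.smul (-1))

theorem mul {c c' k k' : ℝ → M.Fn U} (hc : IsFamily M U c c') (hk : IsFamily M U k k') :
    IsFamily M U (fun t => c t * k t) (fun t => c' t * k t + c t * k' t) := by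
  intro x hx
  obtain ⟨V, hV, hxV, h1, h2⟩ := hc.exists_pair hk hx
  exact ⟨V, hV, _, _, hxV, mul_mem_elemFamilies h1 h2, fun t => by simp⟩

theorem pull {P : Opens N.Body} (φ : GHom N P M) {W : Opens N.Body} (hW : W ≤ P)
    (h : Set.MapsTo φ.body W U) {c c' : ℝ → M.Fn U} (hc : IsFamily M U c c') :
    IsFamily N W (fun t => φ.pull U W hW h (c t)) (fun t => φ.pull U W hW h (c' t)) := by
  intro x hx
  obtain ⟨V, hV, e, e', hxV, he, heq⟩ := hc _ (h hx)
  have hcont : ContinuousOn φ.body W := φ.contMDiffOn_body.continuousOn.mono hW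
  let W₁ : Opens N.Body := ⟨W ∩ φ.body ⁻¹' V, hcont.isOpen_inter_preimage W.isOpen V.isOpen⟩
  have hW₁ : W₁ ≤ W := fun y hy => hy.1
  have hmaps : Set.MapsTo φ.body W₁ V := fun y hy => hy.2
  refine ⟨W₁, hW₁, _, _, ⟨hx, hxV⟩, pull_mem_elemFamilies φ (hW₁.trans hW) hmaps he, fun t => ?_⟩
  rw [← (heq t).1, ← (heq t).2]
  exact ⟨(φ.pull_res hV hW₁ hW h hmaps _).symm, (φ.pull_res hV hW₁ hW h hmaps _).symm⟩

/-- Near every point a family is given by an elementary family over all of `U`. -/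
theorem exists_extension {c c' : ℝ → M.Fn U} (hc : IsFamily M U c c') {x : M.Body} (hx : x ∈ U) :
    ∃ (V : Opens M.Body) (hV : V ≤ U) (e e' : ℝ → M.Fn U), x ∈ V ∧
      (e, e') ∈ elemFamilies M U ∧
        ∀ t, M.res hV (c t) = M.res hV (e t) ∧ M.res hV (c' t) = M.res hV (e' t) := by
  obtain ⟨V, hV, e, e', hxV, he, heq⟩ := hc x hx
  obtain ⟨V', hV', hxV', hext⟩ := GradedManifold.exists_extension hV hxV
  suffices H : ∀ p ∈ elemFamilies M V, ∃ q ∈ elemFamilies M U, ∀ t,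
      M.res hV' (p.1 t) = M.res (hV'.trans hV) (q.1 t) ∧
      M.res hV' (p.2 t) = M.res (hV'.trans hV) (q.2 t) by
    obtain ⟨q, hq, hqe⟩ := H _ he
    refine ⟨V', hV'.trans hV, q.1, q.2, hxV', hq, fun t => ?_⟩
    rw [← (hqe t).1, ← (hqe t).2, ← M.res_res hV hV', ← M.res_res hV hV', (heq t).1, (heq t).2]
    exact ⟨rfl, rfl⟩
  intro p hp
  induction hp using Submodule.span_induction with
  | mem p hp =>
    obtain ⟨n, g, hg, h, b, rfl⟩ := hp
    choose h' hh' using fun i => exists_extension_smooth hV hV' hext (h i)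
    obtain ⟨b', hb'⟩ := exists_extension_fn hV hV' hext b
    have key : ∀ (g : (Fin (n + 1) → ℝ) → ℝ) (hg : ContDiff ℝ ∞ g) (t : ℝ),
        M.res hV' (elemFamily g hg h b t) = M.res (hV'.trans hV) (elemFamily g hg h' b' t) := by
      intro g hg t
      rw [elemFamily, elemFamily, map_mul, map_mul, hb', M.res_ofSmooth, M.res_ofSmooth]
      congr 2
      ext y
      change g _ = g _
      congr 1
      funext i
      refine Fin.cases rfl (fun i => ?_) i
      have := hh' i
      rw [M.res_ofSmooth, M.res_ofSmooth] at this
      exact (DFunLike.congr_fun (M.ofSmooth_injective _ this) y).symm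
    exact ⟨_, elemFamily_mem g hg h' b', fun t => ⟨key g hg t, key _ _ t⟩⟩
  | zero => exact ⟨0, Submodule.zero_mem _, by simp⟩
  | add p q _ _ hp hq =>
    obtain ⟨p', hp', h1⟩ := hp
    obtain ⟨q', hq', h2⟩ := hq
    exact ⟨p' + q', Submodule.add_mem _ hp' hq', fun t => by
      simp [(h1 t).1, (h1 t).2, (h2 t).1, (h2 t).2]⟩
  | smul s p _ hp =>
    obtain ⟨p', hp', h1⟩ := hp
    exact ⟨s • p', Submodule.smul_mem _ s hp', fun t => by simp [(h1 t).1, (h1 t).2]⟩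

/-- A derivation along a pull-back sends families to families. -/
theorem map_along {P : Opens N.Body} (φ : GHom N P M) {W : Opens N.Body} (hW : W ≤ P)
    (h : Set.MapsTo φ.body W U) {D : M.Fn U →ₗ[ℝ] N.Fn W}
    (hD : ∀ (f : M.Smooth U) b, D (M.ofSmooth U f * b) =
      D (M.ofSmooth U f) * φ.pull U W hW h b + φ.pull U W hW h (M.ofSmooth U f) * D b)
    {c c' : ℝ → M.Fn U} (hc : IsFamily M U c c') :
    IsFamily N W (fun t => D (c t)) (fun t => D (c' t)) := by
  have helem : ∀ {e e' : ℝ → M.Fn U}, (e, e') ∈ elemFamilies M U →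
      ((fun t => D (e t)), fun t => D (e' t)) ∈ elemFamilies N W := by
    refine fun he => map_elemFamilies D (fun {n} g hg k b => ?_) he
    obtain ⟨k', hk'⟩ := pull_elemFamily φ hW h k
    have hone : D 1 = 0 := by simpa using hD 1 1
    have hconst : ∀ t : ℝ, D (algebraMap ℝ _ t) = 0 := fun t => by
      rw [Algebra.algebraMap_eq_smul_one, map_smul, hone, smul_zero]
    -- The parameter enters as a constant function, which `D` annihilates. The chain rule therefore
    -- has no term for coordinate zero.
    have key : ∀ (g : (Fin (n + 1) → ℝ) → ℝ) (hg : ContDiff ℝ ∞ g) (t : ℝ),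
        D (elemFamily g hg k b t) = ∑ i : Fin n,
          elemFamily (partialDeriv g i.succ) (partialDeriv_contDiff hg _) k'
            (D (M.ofSmooth U (k i)) * φ.pull U W hW h b) t + elemFamily g hg k' (D b) t := by
      intro g hg t
      have hp : ∀ (g : (Fin (n + 1) → ℝ) → ℝ) (hg : ContDiff ℝ ∞ g), φ.pull U W hW h
          (M.ofSmooth U (smoothComp g hg (Fin.cons (algebraMap ℝ (M.Smooth U) t) k))) =
          N.ofSmooth W (smoothComp g hg (Fin.cons (algebraMap ℝ (N.Smooth W) t) k')) := by
        intro g hg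
        have := hk' g hg 1 t
        simpa [elemFamily] using this
      rw [elemFamily, hD, chain_along φ hW h hD, Fin.sum_univ_succ, hp]
      simp only [hp, Fin.cons_zero, Fin.cons_succ, AlgHom.commutes, hconst, mul_zero, zero_add,
        Finset.sum_mul, elemFamily, mul_assoc]
    simp only [key]
    have : ((fun t => ∑ i : Fin n,
          elemFamily (partialDeriv g i.succ) (partialDeriv_contDiff hg _) k'
            (D (M.ofSmooth U (k i)) * φ.pull U W hW h b) t + elemFamily g hg k' (D b) t),
        fun t => ∑ i : Fin n,
          elemFamily (partialDeriv (partialDeriv g 0) i.succ)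
            (partialDeriv_contDiff (partialDeriv_contDiff hg _) _) k'
            (D (M.ofSmooth U (k i)) * φ.pull U W hW h b) t +
              elemFamily (partialDeriv g 0) (partialDeriv_contDiff hg _) k' (D b) t) =
        (∑ i : Fin n, (elemFamily (partialDeriv g i.succ) (partialDeriv_contDiff hg _) k'
            (D (M.ofSmooth U (k i)) * φ.pull U W hW h b),
          elemFamily (partialDeriv (partialDeriv g i.succ) 0)
            (partialDeriv_contDiff (partialDeriv_contDiff hg _) _) k'
            (D (M.ofSmooth U (k i)) * φ.pull U W hW h b))) +
        (elemFamily g hg k' (D b),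
          elemFamily (partialDeriv g 0) (partialDeriv_contDiff hg _) k' (D b)) := by
      -- Equality of mixed partials: differentiating in the parameter commutes with the derivatives
      -- produced by the chain rule.
      simp only [Form.partialDeriv_comm hg 0]
      ext t <;> simp [Prod.fst_sum, Prod.snd_sum]
    rw [this]
    exact Submodule.add_mem _ (Submodule.sum_mem _ fun i _ => elemFamily_mem _ _ _ _)
      (elemFamily_mem _ _ _ _)
  intro x hx
  -- `D` accepts only functions over all of `U`. The family is replaced near the image point by an
  -- elementary family over `U`, and locality of `D` makes the replacement harmless.
  obtain ⟨V, hV, e, e', hxV, he, heq⟩ := hc.exists_extension (h hx)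
  have hcont : ContinuousOn φ.body W := φ.contMDiffOn_body.continuousOn.mono hW
  let W₁ : Opens N.Body := ⟨W ∩ φ.body ⁻¹' V, hcont.isOpen_inter_preimage W.isOpen V.isOpen⟩
  have hW₁ : W₁ ≤ W := fun y hy => hy.1
  have hmaps : Set.MapsTo φ.body W₁ V := fun y hy => hy.2
  exact ⟨W₁, hW₁, _, _, ⟨hx, hxV⟩, res_mem_elemFamilies hW₁ (helem he), fun t =>
    ⟨local_along φ hW h hD hV hW₁ hmaps (heq t).1, local_along φ hW h hD hV hW₁ hmaps (heq t).2⟩⟩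

theorem scale {c c' : ℝ → M.Fn U} (hc : IsFamily M U c c') (s : ℝ) :
    IsFamily M U (fun t => scaleFn U s (c t)) (fun t => scaleFn U s (c' t)) := by
  simpa only [scaling_pull_self] using hc.pull (GHom.scaling M s) le_top (fun _ hx => hx)

/-- Derivations send families to families. -/
theorem map_derivation {D : M.Fn U →ₗ[ℝ] M.Fn U} {k : ℤ} (hD : M.IsDerivation U k D)
    {c c' : ℝ → M.Fn U} (hc : IsFamily M U c c') :
    IsFamily M U (fun t => D (c t)) (fun t => D (c' t)) := by
  refine map_along (GHom.scaling M 1) le_top (fun _ hx => hx) (fun f b => ?_) hc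
  rw [scaling_pull_self, scaling_pull_self, scaleFn_one]
  simpa using hD.leibniz (ofSmooth_mem_deg_zero f) b

end IsFamily

end GradedManifold

/-! ### Calculus in the parameter: uniqueness of derivatives, and primitives -/

namespace GradedManifold

variable {M N : GradedManifold.{u}} {U : Opens M.Body}

theorem hasDerivAt_update_partialDeriv {n : ℕ} {g : (Fin n → ℝ) → ℝ} (hg : ContDiff ℝ ∞ g)
    (i : Fin n) (y : Fin n → ℝ) (t : ℝ) :
    HasDerivAt (fun t => g (Function.update y i t)) (partialDeriv g i (Function.update y i t)) t := by
  have h := (hg.differentiable (by simp) (Function.update y i t)).hasFDerivAt.comp_hasDerivAt t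
    (hasDerivAt_update y i t)
  exact h

theorem hasDerivAt_cons {n : ℕ} {g : (Fin (n + 1) → ℝ) → ℝ} (hg : ContDiff ℝ ∞ g)
    (y : Fin n → ℝ) (t : ℝ) :
    HasDerivAt (fun t => g (Fin.cons t y)) (partialDeriv g 0 (Fin.cons t y)) t := by
  have := hasDerivAt_update_partialDeriv hg 0 (Fin.cons 0 y) t
  simpa only [Fin.update_cons_zero] using this

namespace IsFamily

/-- The coefficients of a family in graded coordinates are differentiable in the parameter. -/
theorem exists_coefficients {c c' : ℝ → M.Fn U} (hc : IsFamily M U c c') {x : M.Body} (hx : x ∈ U) :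
    ∃ (V : Opens M.Body) (hV : V ≤ U)
      (T : M.Fn V ≃ₗ[ℝ] (GradedSpace.Exponent M.genDeg →₀ M.Smooth V)), x ∈ V ∧
      ∀ μ (y : V) t, HasDerivAt (fun t => T (M.res hV (c t)) μ y) (T (M.res hV (c' t)) μ y) t := by
  obtain ⟨V₀, ξ, hxV₀, hξ⟩ := M.exists_generating x
  obtain ⟨V₁, hV₁, e, e', hxV₁, he, heq⟩ := hc.restrict (inf_le_left : U ⊓ V₀ ≤ U) x ⟨hx, hxV₀⟩
  obtain ⟨T, -, hT⟩ := GradedManifold.exists_coefficients hξ (hV₁.trans inf_le_right)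
  refine ⟨V₁, hV₁.trans inf_le_left, T.symm, hxV₁, fun μ y t => ?_⟩
  have hTs : ∀ f a, T.symm (M.ofSmooth V₁ f * a) = f • T.symm a := fun f a => by
    rw [LinearEquiv.symm_apply_eq, hT, LinearEquiv.apply_symm_apply]
  have key : ∀ p ∈ elemFamilies M V₁,
      HasDerivAt (fun t => T.symm (p.1 t) μ y) (T.symm (p.2 t) μ y) t := by
    intro p hp
    induction hp using Submodule.span_induction with
    | mem p hp =>
      obtain ⟨n, g, hg, h, b, rfl⟩ := hp
      -- The coefficients are linear over smooth functions, so those of `g (t, h) b` at `y` are `g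
      -- (t, h y)` times those of `b`.
      have hval : ∀ (g : (Fin (n + 1) → ℝ) → ℝ) (hg : ContDiff ℝ ∞ g) (t : ℝ),
          T.symm (elemFamily g hg h b t) μ y = g (Fin.cons t fun i => h i y) * T.symm b μ y := by
        intro g hg t
        rw [elemFamily, hTs, Finsupp.smul_apply, smul_eq_mul, ContMDiffMap.coe_mul, Pi.mul_apply,
          smoothComp_apply]
        congr 2
        funext i
        exact Fin.cases rfl (fun i => rfl) i
      simp only [hval]
      exact (hasDerivAt_cons hg _ t).mul_const _
    | zero => simpa using hasDerivAt_const t (0 : ℝ)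
    | add p q _ _ hp hq =>
      refine (hp.add hq).congr_deriv ?_ |>.congr_of_eventuallyEq (.of_forall fun t => ?_) <;> simp
    | smul s p _ hp => simpa using hp.const_mul s
  have h1 : ∀ t, M.res (hV₁.trans inf_le_left) (c t) = e t := fun t => by
    rw [← (heq t).1, M.res_res]
  have h2 : ∀ t, M.res (hV₁.trans inf_le_left) (c' t) = e' t := fun t => by
    rw [← (heq t).2, M.res_res]
  simpa only [h1, h2] using key _ he

/-- A family with derivative zero is constant. -/
theorem eq_of_deriv_eq_zero {c : ℝ → M.Fn U} (hc : IsFamily M U c fun _ => 0) (s t : ℝ) :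
    c s = c t := by
  refine eq_of_local fun x hx => ?_
  obtain ⟨V, hV, T, hxV, h⟩ := hc.exists_coefficients hx
  refine ⟨V, hV, hxV, T.injective ?_⟩
  ext μ y
  simp only [map_zero] at h
  exact is_const_of_deriv_eq_zero (fun t => (h μ y t).differentiableAt)
    (fun t => (h μ y t).deriv) s t

/-- The derivative of a family is unique. -/
theorem deriv_unique {c c' c'' : ℝ → M.Fn U} (hc : IsFamily M U c c') (hc' : IsFamily M U c c'') :
    c' = c'' := by
  funext t
  refine eq_of_local fun x hx => ?_
  have h0 := hc.sub hc'
  obtain ⟨V, hV, T, hxV, h⟩ := h0.exists_coefficients hx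
  refine ⟨V, hV, hxV, ?_⟩
  rw [← sub_eq_zero, ← map_sub]
  apply T.injective
  ext μ y
  have h1 := h μ y t
  simp only [sub_self, map_zero] at h1
  have h2 := h1.unique (hasDerivAt_const t _)
  rw [h2, map_zero]
  rfl

end IsFamily

/-- The primitive from `0` to `y 0` is written as `y 0` times an integral over `[0, 1]`. With fixed
limits, smoothness in all variables follows from `contDiff_integral_zero_one`. -/
theorem exists_antiderivative {n : ℕ} {g : (Fin (n + 1) → ℝ) → ℝ} (hg : ContDiff ℝ ∞ g) :
    ∃ G : (Fin (n + 1) → ℝ) → ℝ, ContDiff ℝ ∞ G ∧ partialDeriv G 0 = g ∧ ∀ y, y 0 = 0 → G y = 0 := by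
  have hc : ContDiff ℝ ∞ fun p : (Fin (n + 1) → ℝ) × ℝ =>
      g (Function.update p.1 0 (p.1 0 * p.2)) := by
    refine hg.comp (contDiff_pi.2 fun i => ?_)
    refine Fin.cases ?_ (fun i => ?_) i
    · simp only [Function.update_self]
      fun_prop
    · simp only [Function.update_of_ne (Fin.succ_ne_zero i)]
      fun_prop
  have hG : ContDiff ℝ ∞ fun y : Fin (n + 1) → ℝ =>
      y 0 * ∫ s in (0:ℝ)..1, g (Function.update y 0 (y 0 * s)) :=
    ContDiff.mul (by fun_prop) (contDiff_integral_zero_one hc)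
  refine ⟨_, hG, ?_, fun y hy => by simp [hy]⟩
  funext y
  have h1 := hasDerivAt_update_partialDeriv hG 0 y (y 0)
  rw [Function.update_eq_self] at h1
  have hcont : Continuous fun u => g (Function.update y 0 u) :=
    hg.continuous.comp (by fun_prop)
  have h2 : ∀ t, (fun t => ∫ u in (0:ℝ)..t, g (Function.update y 0 u)) t =
      (Function.update y 0 t) 0 * ∫ s in (0:ℝ)..1,
        g (Function.update (Function.update y 0 t) 0 ((Function.update y 0 t) 0 * s)) := by
    intro t
    simp only [Function.update_self, Function.update_idem]
    have := intervalIntegral.smul_integral_comp_mul_left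
      (f := fun u => g (Function.update y 0 u)) (a := 0) (b := 1) t
    simp only [smul_eq_mul, mul_zero, mul_one] at this
    rw [this]
  have h3 : HasDerivAt (fun t => ∫ u in (0:ℝ)..t, g (Function.update y 0 u))
      (g (Function.update y 0 (y 0))) (y 0) :=
    intervalIntegral.integral_hasDerivAt_right (hcont.intervalIntegrable _ _)
      (hcont.stronglyMeasurableAtFilter _ _) hcont.continuousAt
  rw [Function.update_eq_self] at h3
  rw [funext h2] at h3
  exact h1.unique h3

/-- Only the function `g` is integrated, while the smooth functions `h` and the coefficient `b`
stay. The primitive is thus again elementary, with no completeness of the algebra of functions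
involved. -/
theorem exists_antiderivative_elemFamilies {e e' : ℝ → M.Fn U} (he : (e, e') ∈ elemFamilies M U) :
    ∃ E, (E, e) ∈ elemFamilies M U ∧ E 0 = 0 := by
  suffices H : ∀ p ∈ elemFamilies M U, ∃ E, (E, p.1) ∈ elemFamilies M U ∧ E 0 = 0 from H _ he
  intro p hp
  induction hp using Submodule.span_induction with
  | mem p hp =>
    obtain ⟨n, g, hg, h, b, rfl⟩ := hp
    obtain ⟨G, hG, rfl, hG0⟩ := exists_antiderivative hg
    refine ⟨elemFamily G hG h b, elemFamily_mem G hG h b, ?_⟩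
    have : smoothComp G hG (Fin.cons (algebraMap ℝ (M.Smooth U) 0) h) = 0 := by
      ext y
      exact hG0 _ rfl
    rw [elemFamily, this, map_zero, zero_mul]
  | zero => exact ⟨0, Submodule.zero_mem _, rfl⟩
  | add p q _ _ hp hq =>
    obtain ⟨E, hE, hE0⟩ := hp
    obtain ⟨E', hE', hE0'⟩ := hq
    exact ⟨E + E', Submodule.add_mem _ hE hE', by simp [hE0, hE0']⟩
  | smul s p _ hp =>
    obtain ⟨E, hE, hE0⟩ := hp
    exact ⟨s • E, Submodule.smul_mem _ s hE, by simp [hE0]⟩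

theorem exists_deriv_elemFamilies {e e' : ℝ → M.Fn U} (he : (e, e') ∈ elemFamilies M U) :
    ∃ e'', (e', e'') ∈ elemFamilies M U := by
  suffices H : ∀ p ∈ elemFamilies M U, ∃ E, (p.2, E) ∈ elemFamilies M U from H _ he
  intro p hp
  induction hp using Submodule.span_induction with
  | mem p hp =>
    obtain ⟨n, g, hg, h, b, rfl⟩ := hp
    exact ⟨_, elemFamily_mem _ (partialDeriv_contDiff hg 0) h b⟩
  | zero => exact ⟨0, Submodule.zero_mem _⟩
  | add p q _ _ hp hq =>
    obtain ⟨E, hE⟩ := hp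
    obtain ⟨E', hE'⟩ := hq
    exact ⟨E + E', Submodule.add_mem _ hE hE'⟩
  | smul s p _ hp =>
    obtain ⟨E, hE⟩ := hp
    exact ⟨s • E, Submodule.smul_mem _ s hE⟩

/-- `c` is a smooth family of functions over `U`, whose derivative is not specified. -/
def IsSmoothFamily (M : GradedManifold.{u}) (U : Opens M.Body) (c : ℝ → M.Fn U) : Prop :=
  ∀ x ∈ U, ∃ (V : Opens M.Body) (hV : V ≤ U) (c' : ℝ → M.Fn V), x ∈ V ∧
    ((fun t => M.res hV (c t)), c') ∈ elemFamilies M V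

theorem IsFamily.isSmoothFamily {c c' : ℝ → M.Fn U} (hc : IsFamily M U c c') :
    IsSmoothFamily M U c := by
  intro x hx
  obtain ⟨V, hV, hxV, h1, h2⟩ := hc.exists_pair hc hx
  exact ⟨V, hV, _, hxV, h1⟩

theorem IsFamily.isSmoothFamily_deriv {c c' : ℝ → M.Fn U} (hc : IsFamily M U c c') :
    IsSmoothFamily M U c' := by
  intro x hx
  obtain ⟨V, hV, hxV, h1, h2⟩ := hc.exists_pair hc hx
  obtain ⟨e, he⟩ := exists_deriv_elemFamilies h1
  exact ⟨V, hV, e, hxV, he⟩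

namespace IsSmoothFamily

theorem exists_pair {c k : ℝ → M.Fn U} (hc : IsSmoothFamily M U c)
    (hk : IsSmoothFamily M U k) {x : M.Body} (hx : x ∈ U) :
    ∃ (V : Opens M.Body) (hV : V ≤ U) (c' k' : ℝ → M.Fn V), x ∈ V ∧
      ((fun t => M.res hV (c t)), c') ∈ elemFamilies M V ∧
      ((fun t => M.res hV (k t)), k') ∈ elemFamilies M V := by
  obtain ⟨V, hV, e, hxV, he⟩ := hc x hx
  obtain ⟨W, hW, f, hxW, hf⟩ := hk x hx
  refine ⟨V ⊓ W, inf_le_left.trans hV, fun t => M.res inf_le_left (e t),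
    fun t => M.res inf_le_right (f t), ⟨hxV, hxW⟩, ?_, ?_⟩
  · have := res_mem_elemFamilies (inf_le_left : V ⊓ W ≤ V) he
    simpa only [M.res_res] using this
  · have := res_mem_elemFamilies (inf_le_right : V ⊓ W ≤ W) hf
    simpa only [M.res_res] using this

theorem add {c k : ℝ → M.Fn U} (hc : IsSmoothFamily M U c) (hk : IsSmoothFamily M U k) :
    IsSmoothFamily M U (fun t => c t + k t) := by
  intro x hx
  obtain ⟨V, hV, c', k', hxV, h1, h2⟩ := hc.exists_pair hk hx
  exact ⟨V, hV, c' + k', hxV, by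
    simp only [map_add]; exact Submodule.add_mem _ h1 h2⟩

theorem smul {c : ℝ → M.Fn U} (hc : IsSmoothFamily M U c) (s : ℝ) :
    IsSmoothFamily M U (fun t => s • c t) := by
  intro x hx
  obtain ⟨V, hV, c', hxV, h1⟩ := hc x hx
  exact ⟨V, hV, s • c', hxV, by
    simp only [map_smul]; exact Submodule.smul_mem _ s h1⟩

theorem mul {c k : ℝ → M.Fn U} (hc : IsSmoothFamily M U c) (hk : IsSmoothFamily M U k) :
    IsSmoothFamily M U (fun t => c t * k t) := by
  intro x hx
  obtain ⟨V, hV, c', k', hxV, h1, h2⟩ := hc.exists_pair hk hx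
  exact ⟨V, hV, _, hxV, by simpa only [map_mul] using mul_mem_elemFamilies h1 h2⟩

end IsSmoothFamily

/-! ### Families in graded coordinates -/

/-- Near a given point, smooth functions of a parameter and a point are smooth functions of the
parameter and finitely many coordinates. -/
theorem exists_coordinates {V : Opens M.Body} {x : M.Body} (hx : x ∈ V) :
    ∃ (V' : Opens M.Body) (hV' : V' ≤ V) (h : Fin M.dim → M.Smooth V'), x ∈ V' ∧
      ∀ F : ℝ × V → ℝ, ContMDiff (𝓘(ℝ, ℝ).prod (𝓡 M.dim)) 𝓘(ℝ, ℝ) ∞ F →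
        ∃ g : (Fin (M.dim + 1) → ℝ) → ℝ, ContDiff ℝ ∞ g ∧
          ∀ (t : ℝ) (y : V'), F (t, ⟨y, hV' y.2⟩) = g (Fin.cons t fun i => h i y) := by
  set x₀ : V := ⟨x, hx⟩
  set χ := extChartAt (𝓡 M.dim) x₀ with hχ
  have htar : IsOpen χ.target := isOpen_extChartAt_target x₀
  obtain ⟨R, hR, hRt⟩ := Metric.isOpen_iff.1 htar (χ x₀) (mem_extChartAt_target x₀)
  -- The bump is one on the ball of radius `R / 3`, where the coordinates of `V'` take their values.
  -- It vanishes outside the ball of radius `R / 2`, whose closure lies in the target of the chart,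
  -- so extension by zero is smooth.
  let ρ : ContDiffBump (χ x₀) := ⟨R / 3, R / 2, by positivity, by linarith⟩
  have hsrc : IsOpen (χ.source ∩ χ ⁻¹' Metric.ball (χ x₀) (R / 3)) :=
    (continuousOn_extChartAt x₀).isOpen_inter_preimage (isOpen_extChartAt_source x₀)
      Metric.isOpen_ball
  let V' : Opens M.Body := ⟨Subtype.val '' (χ.source ∩ χ ⁻¹' Metric.ball (χ x₀) (R / 3)),
    V.isOpen.isOpenMap_subtype_val _ hsrc⟩
  have hV' : V' ≤ V := by
    rintro _ ⟨y, -, rfl⟩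
    exact y.2
  have hmem : ∀ y : V', (⟨y, hV' y.2⟩ : V) ∈ χ.source ∧
      χ ⟨y, hV' y.2⟩ ∈ Metric.ball (χ x₀) (R / 3) := by
    rintro ⟨_, y, hy, rfl⟩
    exact hy
  have hincl : ContMDiff (𝓡 M.dim) (𝓡 M.dim) ∞ (fun y : V' => (⟨y, hV' y.2⟩ : V)) :=
    contMDiff_inclusion hV'
  have hsm : ContMDiff (𝓡 M.dim) 𝓘(ℝ, EuclideanSpace ℝ (Fin M.dim)) ∞
      fun y : V' => χ ⟨y, hV' y.2⟩ := by
    intro y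
    exact (contMDiffAt_extChartAt' (by
      have := (hmem y).1
      rwa [hχ, extChartAt_source] at this)).comp y (hincl y)
  have hcoord : ∀ i, ContMDiff (𝓡 M.dim) 𝓘(ℝ, ℝ) ∞ fun y : V' => χ ⟨y, hV' y.2⟩ i := fun i =>
    (EuclideanSpace.proj (𝕜 := ℝ) i).contMDiff.comp hsm
  refine ⟨V', hV', fun i => ⟨_, hcoord i⟩, ⟨x₀, ⟨mem_extChartAt_source x₀,
    Metric.mem_ball_self (by positivity)⟩, rfl⟩, fun F hF => ?_⟩
  let A : (Fin (M.dim + 1) → ℝ) → EuclideanSpace ℝ (Fin M.dim) := fun z =>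
    WithLp.toLp 2 fun i => z i.succ
  have hA : ContDiff ℝ ∞ A := by
    rw [contDiff_euclidean]
    exact fun i => contDiff_apply ℝ ℝ i.succ
  refine ⟨fun z => ρ (A z) * F (z 0, χ.symm (A z)), contDiff_iff_contDiffAt.2 fun z => ?_,
    fun t y => ?_⟩
  · by_cases hz : A z ∈ Metric.closedBall (χ x₀) (R / 2)
    · have hzt : A z ∈ χ.target :=
        hRt (Metric.closedBall_subset_ball (by linarith) hz)
      refine ((ρ.contDiff.comp hA).contDiffAt).mul ?_
      rw [← contMDiffAt_iff_contDiffAt]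
      have h1 : ContMDiffAt 𝓘(ℝ, EuclideanSpace ℝ (Fin M.dim)) (𝓡 M.dim) ∞ χ.symm (A z) :=
        (contMDiffOn_extChartAt_symm x₀).contMDiffAt (htar.mem_nhds hzt)
      have h2 : ContMDiffAt 𝓘(ℝ, Fin (M.dim + 1) → ℝ) (𝓡 M.dim) ∞ (fun z => χ.symm (A z)) z :=
        h1.comp z hA.contMDiff.contMDiffAt
      have h3 : ContMDiffAt 𝓘(ℝ, Fin (M.dim + 1) → ℝ) 𝓘(ℝ, ℝ) ∞
          (fun z : Fin (M.dim + 1) → ℝ => z 0) z :=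
        (contDiff_apply ℝ ℝ (0 : Fin (M.dim + 1))).contMDiff.contMDiffAt
      exact (hF (z 0, χ.symm (A z))).comp z (h3.prodMk h2)
    · have h0 : (fun z => ρ (A z) * F (z 0, χ.symm (A z))) =ᶠ[nhds z] fun _ => 0 := by
        have hopen : IsOpen (A ⁻¹' (Metric.closedBall (χ x₀) (R / 2))ᶜ) :=
          Metric.isClosed_closedBall.isOpen_compl.preimage hA.continuous
        filter_upwards [hopen.mem_nhds hz] with z' hz'
        have : ρ (A z') = 0 := ρ.zero_of_le_dist (by
          have : ¬ dist (A z') (χ x₀) ≤ R / 2 := hz'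
          exact (not_le.1 this).le)
        rw [this, zero_mul]
      exact contDiffAt_const.congr_of_eventuallyEq h0
  · have hy := hmem y
    have e1 : A (Fin.cons t fun i => χ ⟨y, hV' y.2⟩ i) = χ ⟨y, hV' y.2⟩ := by
      ext i
      simp [A]
    have e2 : ρ (χ ⟨y, hV' y.2⟩) = 1 := ρ.one_of_mem_closedBall (Metric.ball_subset_closedBall hy.2)
    change _ = ρ (A (Fin.cons t fun i => χ ⟨y, hV' y.2⟩ i)) *
      F (t, χ.symm (A (Fin.cons t fun i => χ ⟨y, hV' y.2⟩ i)))
    rw [e1, e2, one_mul, χ.left_inv hy.1]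

/-- Composing with a smooth `l` that takes values in `T` removes the boundary of `T`. One-sided
derivatives at the ends of an interval become ordinary derivatives on all of `ℝ` by the chain rule.
-/
theorem _root_.HasFamilyDeriv.isFamily {T : Set ℝ} {c c' : ℝ → M.Fn U}
    (hc : HasFamilyDeriv M U T c c') {l : ℝ → ℝ} (hl : ContDiff ℝ ∞ l) (hT : ∀ t, l t ∈ T) :
    IsFamily M U (fun t => c (l t)) (fun t => deriv l t • c' (l t)) := by
  intro x hx
  obtain ⟨V, hV, ξ, S, f, f', hxV, -, hf, hf', hcf, hcf'⟩ := hc x hx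
  obtain ⟨V', hV', h, hxV', hrep⟩ := exists_coordinates hxV
  have hg : ∀ μ ∈ S, ∃ g : (Fin (M.dim + 1) → ℝ) → ℝ, ContDiff ℝ ∞ g ∧
      ∀ (t : ℝ) (y : V'), f μ (l t) ⟨y, hV' y.2⟩ = g (Fin.cons t fun i => h i y) := by
    intro μ hμ
    refine hrep (fun q => f μ (l q.1) q.2) ?_
    have h1 : ContMDiff (𝓘(ℝ, ℝ).prod (𝓡 M.dim)) (𝓘(ℝ, ℝ).prod (𝓡 M.dim)) ∞
        fun q : ℝ × V => (l q.1, q.2) :=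
      (hl.contMDiff.comp contMDiff_fst).prodMk contMDiff_snd
    exact (hf μ hμ).comp_contMDiff h1 fun q => ⟨hT _, trivial⟩
  choose! g hgs hgf using hg
  refine ⟨V', hV'.trans hV, fun t => M.res (hV'.trans hV) (c (l t)),
    fun t => M.res (hV'.trans hV) (deriv l t • c' (l t)), hxV', ?_, fun t => ⟨rfl, rfl⟩⟩
  have hsum : ((fun t => M.res (hV'.trans hV) (c (l t))),
      fun t => M.res (hV'.trans hV) (deriv l t • c' (l t))) =
      ∑ μ ∈ S.attach, (elemFamily (g μ) (hgs μ μ.2) h (M.res hV' (M.monomial ξ μ.1)),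
        elemFamily (partialDeriv (g μ) 0) (partialDeriv_contDiff (hgs μ μ.2) 0) h
          (M.res hV' (M.monomial ξ μ.1))) := by
    refine Prod.ext (funext fun t => ?_) (funext fun t => ?_)
    · simp only [Prod.fst_sum, Finset.sum_apply]
      rw [← M.res_res hV hV', hcf _ (hT t), map_sum, ← Finset.sum_attach]
      refine Finset.sum_congr rfl fun μ _ => ?_
      rw [elemFamily, map_mul, M.res_ofSmooth]
      congr 2
      ext y
      refine (hgf μ μ.2 t y).trans ?_
      rw [smoothComp_apply]
      congr 1
      funext i
      exact Fin.cases rfl (fun i => rfl) i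
    · simp only [Prod.snd_sum, Finset.sum_apply]
      rw [← M.res_res hV hV', map_smul, map_smul, hcf' _ (hT t), map_sum, ← Finset.sum_attach,
        Finset.smul_sum]
      refine Finset.sum_congr rfl fun μ _ => ?_
      rw [elemFamily, map_mul, M.res_ofSmooth, ← smul_mul_assoc, ← map_smul]
      congr 2
      ext y
      have h1 := hasDerivAt_cons (hgs μ μ.2) (fun i => h i y) t
      simp only [← hgf μ μ.2] at h1
      have h2 := (hf' μ μ.2 (l t) (hT t) ⟨y, hV' y.2⟩).scomp_hasDerivAt t
        (hl.differentiable (by simp) t).hasDerivAt hT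
      have h3 := h2.unique h1
      change deriv l t • f' μ (l t) ⟨y, hV' y.2⟩ = _
      rw [h3, smoothComp_apply]
      congr 1
      funext i
      exact Fin.cases rfl (fun i => rfl) i
  rw [hsum]
  exact Submodule.sum_mem _ fun μ _ => elemFamily_mem _ _ _ _

end GradedManifold

/-! ### Gauge transformations of basic forms -/

/-- Families of matrices of functions. -/
def IsMatrixFamily (N : GradedManifold.{u}) (U : Opens N.Body)
    (c c' : ℝ → Matrix (Fin 2) (Fin 2) (N.Fn U)) : Prop :=
  ∀ i j, IsFamily N U (fun t => c t i j) (fun t => c' t i j)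

theorem IsMatrixFamily.mul {N : GradedManifold.{u}} {U : Opens N.Body}
    {c c' k k' : ℝ → Matrix (Fin 2) (Fin 2) (N.Fn U)}
    (hc : IsMatrixFamily N U c c') (hk : IsMatrixFamily N U k k') :
    IsMatrixFamily N U (fun t => c t * k t) (fun t => c' t * k t + c t * k' t) := by
  intro i j
  convert ((hc i 0).mul (hk 0 j)).add ((hc i 1).mul (hk 1 j)) using 2
  · simp [Matrix.mul_apply]
  · simp only [Matrix.add_apply, Matrix.mul_apply, Fin.sum_univ_two]
    abel

/-! ### The Lie derivative along a gauge vector field, seen through a homomorphism -/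

section GaugeLie

variable {M N F : QManifold.{u}} {G : HolonomyAlgebra F} {U : Opens N.Body} {P : Opens M.Body}
  (p : N.Fn U →ₐ[ℝ] M.Fn P) (T : F.Fn ⊤ →ₐ[ℝ] M.Fn P)
  (TF : Form F.toGradedManifold ⊤ →ₐ[ℝ] Form M.toGradedManifold P)
  {r : ℕ} (i : Fin r → ℕ) (b : Fin r → N.Fn U) {k : Fin r → ℤ} (ε : ∀ j, G.space (k j))
  {B : Type*} [Ring B] [Algebra ℝ B] (L : Form M.toGradedManifold P →ₐ[ℝ] B)

/-- The expression `∑ L (Qb) L (τ^* L_ε w) ± L (b) L (τ^* L_{[Q, ε]} w)` for the value of `L` on the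
Lie derivative of `τ^* w` along `[Q, ∑ b ε]`. -/
noncomputable def gaugeLie (w : Form F.toGradedManifold ⊤) : B :=
  ∑ j, (L (Form.fn (p (N.Q U (b j)))) * L (TF (Form.lie (G.isDerivation (ε j).2) w)) +
    (-1 : ℝ) ^ i j • (L (Form.fn (p (b j))) *
      L (TF (Form.lie ((F.isDerivation_Q ⊤).bracket (G.isDerivation (ε j).2)) w))))

variable {p T TF i b ε}
  (hp : ∀ {n : ℕ} {a : N.Fn U}, a ∈ N.deg U n → p a ∈ M.deg P n)
  (hT : ∀ {n : ℕ} {a : F.Fn ⊤}, a ∈ F.deg ⊤ n → T a ∈ M.deg P n)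
  (hb : ∀ j, b j ∈ N.deg U (i j)) (hik : ∀ j, (i j : ℤ) + k j = -1)
  {X : M.Fn P →ₗ[ℝ] M.Fn P}
  (hX : ∀ h : F.Fn ⊤, X (T h) = ∑ j, (p (N.Q U (b j)) * T ((ε j).1 h) +
    (-1 : ℝ) ^ i j • (p (b j) * T (bracket 1 (k j) (F.Q ⊤) (ε j).1 h))))

include hp hT hb hik hX

/-- Both sides expand the Lie derivative of `τ^* (a w)` along a vector field of degree zero. `Q b`
and `ε` have opposite degrees, and so do `b` and `[Q, ε]`. The sign from moving the coefficient past
`a` therefore cancels the sign in the Leibniz rule of the Lie derivative. -/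
theorem gaugeLie_fn_mul (hTF : ∀ a, TF (Form.fn a) = Form.fn (T a))
    {n : ℕ} {a : F.Fn ⊤} (ha : a ∈ F.deg ⊤ n) (w : Form F.toGradedManifold ⊤) :
    L (Form.fn (X (T a))) * L (TF w) + L (Form.fn (T a)) * gaugeLie p TF i b ε L w =
      gaugeLie p TF i b ε L (Form.fn a * w) := by
  have hpar : ∀ j, (k j + (i j + 1)) = 0 := fun j => by have := hik j; omega
  rw [hX]
  simp only [gaugeLie, map_sum, map_add, map_smul, map_mul, Finset.sum_mul, Finset.mul_sum]
  rw [← Finset.sum_add_distrib]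
  refine Finset.sum_congr rfl fun j _ => ?_
  have hQ : L (Form.fn (T a)) * L (Form.fn (p (N.Q U (b j)))) =
      (-1 : ℝ) ^ (k j * n) • (L (Form.fn (p (N.Q U (b j)))) * L (Form.fn (T a))) := by
    rw [← map_mul, ← map_mul, M.comm (hT ha) (hp (N.Q_mem U (hb j))), map_smul, map_smul, map_mul,
      map_mul, ← zpow_natCast]
    congr 1
    refine Form.neg_one_zpow_congr ⟨n * (k j + (i j + 1)), ?_⟩
    push_cast
    linear_combination (-(n : ℤ)) * hpar j
  have hB : L (Form.fn (T a)) * L (Form.fn (p (b j))) =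
      (-1 : ℝ) ^ ((1 + k j) * n) • (L (Form.fn (p (b j))) * L (Form.fn (T a))) := by
    rw [← map_mul, ← map_mul, M.comm (hT ha) (hp (hb j)), map_smul, map_smul, map_mul, map_mul,
      ← zpow_natCast]
    congr 1
    refine Form.neg_one_zpow_congr ⟨n * (k j + (i j + 1)), ?_⟩
    push_cast
    linear_combination (-(n : ℤ)) * hpar j
  simp only [Form.lie_fn_mul _ ha, map_add, map_smul, map_mul, hTF, mul_add,
    smul_add, smul_mul_assoc, mul_smul_comm, add_mul _ _ (L (TF w))]
  rw [← mul_assoc (L (Form.fn (T a))), hQ, ← mul_assoc (L (Form.fn (T a))), hB]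
  simp only [smul_mul_assoc, mul_assoc]
  abel

/-- Here the coefficients are differentiated too, which produces factors `db` and `d (Q b)`. They
disappear because `L` kills differentials of functions from the base. Without `hL`, invariance under
`L_ε` and `L_{[Q, ε]}` would not suffice. -/
theorem gaugeLie_dfn_mul (hTF : ∀ a, TF (Form.dfn a) = Form.dfn (T a))
    (hL : ∀ b, L (Form.dfn (p b)) = 0)
    {n : ℕ} {a : F.Fn ⊤} (ha : a ∈ F.deg ⊤ n) (w : Form F.toGradedManifold ⊤) :
    L (Form.dfn (X (T a))) * L (TF w) + L (Form.dfn (T a)) * gaugeLie p TF i b ε L w =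
      gaugeLie p TF i b ε L (Form.dfn a * w) := by
  have hpar : ∀ j, (k j + (i j + 1)) = 0 := fun j => by have := hik j; omega
  rw [hX]
  simp only [gaugeLie, map_sum, map_add, map_smul, Finset.sum_mul, Finset.mul_sum]
  rw [← Finset.sum_add_distrib]
  refine Finset.sum_congr rfl fun j _ => ?_
  rw [Form.dfn_mul (hp (N.Q_mem U (hb j))), Form.dfn_mul (hp (hb j))]
  have hQ : L (Form.dfn (T a)) * L (Form.fn (p (N.Q U (b j)))) =
      (-1 : ℝ) ^ (k j * (n + 1)) • (L (Form.fn (p (N.Q U (b j)))) * L (Form.dfn (T a))) := by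
    rw [← map_mul, ← map_mul, Form.fn_mul_dfn (hp (N.Q_mem U (hb j))) (hT ha), map_smul, smul_smul,
      ← zpow_natCast, Form.neg_one_zpow_mul, Even.neg_one_zpow, one_smul]
    refine ⟨0, ?_⟩
    push_cast
    linear_combination ((n : ℤ) + 1) * hpar j
  have hB : L (Form.dfn (T a)) * L (Form.fn (p (b j))) =
      (-1 : ℝ) ^ ((1 + k j) * (n + 1)) • (L (Form.fn (p (b j))) * L (Form.dfn (T a))) := by
    rw [← map_mul, ← map_mul, Form.fn_mul_dfn (hp (hb j)) (hT ha), map_smul, smul_smul,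
      ← zpow_natCast, Form.neg_one_zpow_mul, Even.neg_one_zpow, one_smul]
    refine ⟨0, ?_⟩
    push_cast
    linear_combination ((n : ℤ) + 1) * hpar j
  have e1 : (-1 : ℝ) ^ (i j + 1) = (-1) ^ k j := by
    rw [← zpow_natCast]
    exact Form.neg_one_zpow_congr ⟨0, by push_cast; linear_combination hpar j⟩
  have e2 : (-1 : ℝ) ^ (1 + k j) = (-1) ^ i j := by
    rw [← zpow_natCast]
    exact Form.neg_one_zpow_congr ⟨0, by linear_combination hpar j⟩
  simp only [Form.lie_dfn_mul _ ha, map_add, map_smul, map_mul, hTF, mul_add,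
    smul_add, smul_mul_assoc, mul_smul_comm, hL, zero_mul, zero_add, e1, e2,
    add_mul _ _ (L (TF w))]
  rw [← mul_assoc (L (Form.dfn (T a))), hQ, ← mul_assoc (L (Form.dfn (T a))), hB]
  simp only [smul_mul_assoc, mul_assoc]
  ring_nf
  abel

end GaugeLie

/-! ### Invariance of basic forms under flows of gauge vector fields -/

section Flow

variable {M N F : QManifold.{u}} {π : GHom M.toGradedManifold ⊤ N.toGradedManifold}
  {G : HolonomyAlgebra F} {U : Opens N.Body} {P₀ : Opens M.Body}

/-- Pull-back to `π⁻¹(U)` of functions on `U`. -/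
def GHom.pullBase (π : GHom M.toGradedManifold ⊤ N.toGradedManifold) (U : Opens N.Body) :
    N.Fn U →ₐ[ℝ] M.Fn (π.preimage U) :=
  π.pull U (π.preimage U) le_top fun _ h => h

/-- Pull-back to `P` of functions on the fibre. -/
def GHom.pullFiber (τ : GHom M.toGradedManifold P₀ F.toGradedManifold) {P : Opens M.Body}
    (hP : P ≤ P₀) : F.Fn ⊤ →ₐ[ℝ] M.Fn P :=
  τ.pull ⊤ P hP fun _ _ => trivial

/-- Pull-back to `P` of forms on the fibre. -/
noncomputable def GHom.pullFiberForm (τ : GHom M.toGradedManifold P₀ F.toGradedManifold)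
    {P : Opens M.Body} (hP : P ≤ P₀) :
    Form F.toGradedManifold ⊤ →ₐ[ℝ] Form M.toGradedManifold P :=
  τ.pullForm ⊤ P hP fun _ _ => trivial

theorem GHom.pullFiberForm_fn (τ : GHom M.toGradedManifold P₀ F.toGradedManifold)
    {P : Opens M.Body} (hP : P ≤ P₀) (a : F.Fn ⊤) :
    τ.pullFiberForm hP (Form.fn a) = Form.fn (τ.pullFiber hP a) := τ.pullForm_fn _ _ a

theorem GHom.pullFiberForm_dfn (τ : GHom M.toGradedManifold P₀ F.toGradedManifold)
    {P : Opens M.Body} (hP : P ≤ P₀) (a : F.Fn ⊤) :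
    τ.pullFiberForm hP (Form.dfn a) = Form.dfn (τ.pullFiber hP a) := τ.pullForm_dfn _ _ a

/-- Homomorphisms from forms over `π⁻¹(U)` to matrices of functions over `U` that vanish on the
differentials of functions on the base and preserve smooth families. -/
structure IsTransverse (π : GHom M.toGradedManifold ⊤ N.toGradedManifold) (U : Opens N.Body)
    (L : Form M.toGradedManifold (π.preimage U) →ₐ[ℝ] Matrix (Fin 2) (Fin 2) (N.Fn U)) : Prop where
  base : ∀ b : N.Fn U, L (Form.dfn (π.pullBase U b)) = 0
  family_fn : ∀ {a a' : ℝ → M.Fn (π.preimage U)},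
    IsFamily M.toGradedManifold (π.preimage U) a a' →
    IsMatrixFamily N.toGradedManifold U (fun t => L (Form.fn (a t))) (fun t => L (Form.fn (a' t)))
  family_dfn : ∀ {a a' : ℝ → M.Fn (π.preimage U)},
    IsFamily M.toGradedManifold (π.preimage U) a a' →
    IsMatrixFamily N.toGradedManifold U (fun t => L (Form.dfn (a t)))
      (fun t => L (Form.dfn (a' t)))

theorem IsFlow.isFamily {M : GradedManifold.{u}} {P : Opens M.Body} {X : M.Fn P →ₗ[ℝ] M.Fn P}
    {Φ : ℝ → GHom M P M} (hΦ : IsFlow X Φ) (a : M.Fn P) :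
    IsFamily M P (fun t => (Φ t).pull P P le_rfl (hΦ.mapsTo t) a)
      (fun t => (Φ t).pull P P le_rfl (hΦ.mapsTo t) (X a)) := by
  simpa using (hΦ.deriv a).isFamily contDiff_id (fun _ => trivial)

/-- The pulled-back family has derivative `Φ_t^* (X a) = 0`, so it keeps its value at time zero.
Applied to functions from the base, this preserves transversality under the flow. -/
theorem IsFlow.pull_eq {M : GradedManifold.{u}} {P : Opens M.Body} {X : M.Fn P →ₗ[ℝ] M.Fn P}
    {Φ : ℝ → GHom M P M} (hΦ : IsFlow X Φ) {a : M.Fn P} (ha : X a = 0) (t : ℝ) :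
    (Φ t).pull P P le_rfl (hΦ.mapsTo t) a = a := by
  have h := hΦ.isFamily a
  simp only [ha, map_zero] at h
  have := h.eq_of_deriv_eq_zero t 0
  rwa [hΦ.zero] at this

/-- Gauge vector fields act on the base trivially, and on the fibre by the holonomy algebra. -/
theorem gaugeAlgebra_apply (hπ : QManifold.IsQMorphism π)
    {τ : GHom M.toGradedManifold P₀ F.toGradedManifold} (hτ : QManifold.IsQMorphism τ)
    (hP : π.preimage U ≤ P₀) {X : M.Fn (π.preimage U) →ₗ[ℝ] M.Fn (π.preimage U)}
    (hX : X ∈ gaugeAlgebra π G U τ hP) :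
    (∀ b, X (π.pullBase U b) = 0) ∧ ∃ (r : ℕ) (i : Fin r → ℕ) (b : Fin r → N.Fn U)
      (k : Fin r → ℤ) (ε : ∀ j, G.space (k j)),
      (∀ j, b j ∈ N.deg U (i j)) ∧ (∀ j, (i j : ℤ) + k j = -1) ∧
      ∀ h : F.Fn ⊤, X (τ.pullFiber hP h) = ∑ j, (π.pullBase U (N.Q U (b j)) *
        τ.pullFiber hP ((ε j).1 h) + (-1 : ℝ) ^ i j • (π.pullBase U (b j) *
          τ.pullFiber hP (bracket 1 (k j) (F.Q ⊤) (ε j).1 h))) := by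
  obtain ⟨Y, r, i, b, k, ε, hY, hb, hik, hYπ, hYτ, rfl⟩ := hX
  have hQπ : ∀ b, M.Q _ (π.pullBase U b) = π.pullBase U (N.Q U b) := fun b => hπ _ _ _ _ b
  have hQτ : ∀ b, M.Q _ (τ.pullFiber hP b) = τ.pullFiber hP (F.Q ⊤ b) := fun b => hτ _ _ _ _ b
  replace hYπ : ∀ b, Y (π.pullBase U b) = 0 := hYπ
  replace hYτ : ∀ h, Y (τ.pullFiber hP h) = ∑ j, π.pullBase U (b j) *
    τ.pullFiber hP ((ε j).1 h) := hYτ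
  refine ⟨fun b => ?_, r, i, b, k, ε, hb, hik, fun h => ?_⟩
  · simp [bracket, hYπ, hQπ]
  · have e : (-1 : ℝ) ^ ((1 : ℤ) * -1) = -1 := by norm_num
    simp only [bracket, LinearMap.sub_apply, LinearMap.smul_apply, LinearMap.comp_apply, e, hYτ,
      map_sum, hQτ, neg_smul, one_smul, sub_neg_eq_add]
    rw [← Finset.sum_add_distrib]
    refine Finset.sum_congr rfl fun j _ => ?_
    have hbd : π.pullBase U (b j) ∈ M.deg _ (i j) := π.pull_deg _ _ (hb j)
    -- The degrees of `b` and `ε` add up to `-1`, so `b ε Q h` is exactly the second half of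
    -- `(-1)^|b| b [Q, ε] h`.
    have e2 : (-1 : ℝ) ^ i j * (-1 : ℝ) ^ (k j) = -1 := by
      rw [← zpow_natCast, Form.neg_one_zpow_mul, hik]; norm_num
    rw [M.Q_leibniz _ hbd, hQπ, hQτ]
    simp only [map_sub, map_smul, mul_sub, smul_sub, mul_smul_comm, smul_smul, one_mul, e2]
    module

theorem basic_lie {k : ℤ} (ε : G.space k) {w : Form F.toGradedManifold ⊤} (hw : w ∈ G.basicForms) :
    Form.lie (G.isDerivation ε.2) w = 0 ∧
      Form.lie ((F.isDerivation_Q ⊤).bracket (G.isDerivation ε.2)) w = 0 := by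
  simp only [HolonomyAlgebra.basicForms, Submodule.mem_iInf] at hw
  exact hw k ε

/-- The flow of a gauge vector field does not change the values of transverse homomorphisms on the
trivial extensions of basic forms. -/
theorem IsTransverse.flow (hπ : QManifold.IsQMorphism π)
    {τ : GHom M.toGradedManifold P₀ F.toGradedManifold} (hτ : QManifold.IsQMorphism τ)
    (hP : π.preimage U ≤ P₀) {X : M.Fn (π.preimage U) →ₗ[ℝ] M.Fn (π.preimage U)}
    (hX : X ∈ gaugeAlgebra π G U τ hP)
    {Φ : ℝ → GHom M.toGradedManifold (π.preimage U) M.toGradedManifold} (hΦ : IsFlow X Φ)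
    {L : Form M.toGradedManifold (π.preimage U) →ₐ[ℝ] Matrix (Fin 2) (Fin 2) (N.Fn U)}
    (hL : IsTransverse π U L) (t : ℝ) :
    IsTransverse π U (L.comp ((Φ t).pullForm _ _ le_rfl (hΦ.mapsTo t))) ∧
      ∀ {p : ℕ} {w : Form F.toGradedManifold ⊤}, w ∈ G.basicDeg p →
        L ((Φ t).pullForm _ _ le_rfl (hΦ.mapsTo t) (τ.pullFiberForm hP w)) =
          L (τ.pullFiberForm hP w) := by
  obtain ⟨hXb, r, i, b, k, ε, hb, hik, hXτ⟩ := gaugeAlgebra_apply hπ hτ hP hX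
  have hbase : ∀ t b, (L.comp ((Φ t).pullForm _ _ le_rfl (hΦ.mapsTo t)))
      (Form.dfn (π.pullBase U b)) = 0 := fun t b => by
    rw [AlgHom.comp_apply, GHom.pullForm_dfn, hΦ.pull_eq (hXb b), hL.base]
  refine ⟨⟨hbase t, fun ha => ?_, fun ha => ?_⟩, fun {p w} hw => ?_⟩
  · simp only [AlgHom.comp_apply, GHom.pullForm_fn]
    exact hL.family_fn (ha.pull (Φ t) le_rfl (hΦ.mapsTo t))
  · simp only [AlgHom.comp_apply, GHom.pullForm_dfn]
    exact hL.family_dfn (ha.pull (Φ t) le_rfl (hΦ.mapsTo t))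
  -- The `t`-derivative is `gaugeLie` for the homomorphism `L Φ_t^*`. Both satisfy the same product
  -- rule, and at a factor `da` this needs `L Φ_t^*` to kill differentials of base functions.
  have key : ∀ (p : ℕ) (w), Form.IsMonomial p w → IsMatrixFamily N.toGradedManifold U
      (fun t => L ((Φ t).pullForm _ _ le_rfl (hΦ.mapsTo t) (τ.pullFiberForm hP w)))
      (fun t => gaugeLie (π.pullBase U) (τ.pullFiberForm hP) i b ε
        (L.comp ((Φ t).pullForm _ _ le_rfl (hΦ.mapsTo t))) w) := by
    intro p w hw
    induction hw with
    | one =>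
      intro m n
      simpa [gaugeLie, Form.lie_one] using IsFamily.const _
    | @fn_mul n p a w ha _ ih =>
      have h1 := (hL.family_fn (hΦ.isFamily (τ.pullFiber hP a))).mul ih
      convert h1 using 2 with t t
      · simp only [map_mul, GHom.pullFiberForm_fn, GHom.pullForm_fn]
      · rw [← gaugeLie_fn_mul (p := π.pullBase U) (T := τ.pullFiber hP) _ (fun h => π.pull_deg _ _ h)
          (fun h => τ.pull_deg _ _ h) hb hik hXτ (τ.pullFiberForm_fn hP) ha w]
        simp only [AlgHom.comp_apply, GHom.pullForm_fn]
    | @dfn_mul n p a w ha _ ih =>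
      have h1 := (hL.family_dfn (hΦ.isFamily (τ.pullFiber hP a))).mul ih
      convert h1 using 2 with t t
      · simp only [map_mul, GHom.pullFiberForm_dfn, GHom.pullForm_dfn]
      · rw [← gaugeLie_dfn_mul (p := π.pullBase U) (T := τ.pullFiber hP) _ (fun h => π.pull_deg _ _ h)
          (fun h => τ.pull_deg _ _ h) hb hik hXτ (τ.pullFiberForm_dfn hP) (hbase t) ha w]
        simp only [AlgHom.comp_apply, GHom.pullForm_dfn]
  have key' : IsMatrixFamily N.toGradedManifold U
      (fun t => L ((Φ t).pullForm _ _ le_rfl (hΦ.mapsTo t) (τ.pullFiberForm hP w)))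
      (fun t => gaugeLie (π.pullBase U) (τ.pullFiberForm hP) i b ε
        (L.comp ((Φ t).pullForm _ _ le_rfl (hΦ.mapsTo t))) w) := by
    have hw' : w ∈ Form.deg F.toGradedManifold ⊤ p := hw.1
    clear hw
    induction hw' using Submodule.span_induction with
    | mem x hx => exact key p x hx
    | zero =>
      intro m n
      simpa [gaugeLie] using IsFamily.const (M := N.toGradedManifold) (U := U) 0
    | add x y _ _ hx hy =>
      intro m n
      convert (hx m n).add (hy m n) using 2 with t t
      · simp
      · rw [← Matrix.add_apply]
        refine congrFun (congrFun ?_ m) n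
        simp only [gaugeLie, map_add, mul_add, smul_add, ← Finset.sum_add_distrib]
        refine Finset.sum_congr rfl fun j _ => ?_
        abel
    | smul s x _ hx =>
      intro m n
      convert (hx m n).smul s using 2 with t t
      · simp
      · rw [← Matrix.smul_apply]
        refine congrFun (congrFun ?_ m) n
        simp only [gaugeLie, map_smul, mul_smul_comm, Finset.smul_sum, smul_add]
        refine Finset.sum_congr rfl fun j _ => ?_
        rw [smul_comm s]
  -- Every summand contains `L_ε w` or `L_{[Q, ε]} w`; this is the only use of basicness.
  have hzero : ∀ t, gaugeLie (π.pullBase U) (τ.pullFiberForm hP) i b ε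
        (L.comp ((Φ t).pullForm _ _ le_rfl (hΦ.mapsTo t))) w = 0 := fun t => by
    simp [gaugeLie, basic_lie _ hw.2]
  simp only [hzero] at key'
  have h0 : (Φ 0).pullForm _ _ le_rfl (hΦ.mapsTo 0) = AlgHom.id ℝ _ :=
    Form.lift_unique (fun a => by rw [GHom.pullForm_fn, hΦ.zero]; rfl)
      (fun a => by rw [GHom.pullForm_dfn, hΦ.zero]; rfl)
  ext m n
  have := (key' m n).eq_of_deriv_eq_zero t 0
  simp only [h0] at this
  exact this

/-- Transverse homomorphisms do not distinguish trivializations that differ by a gauge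
transformation. -/
theorem IsTransverse.expGauge_eq (hπ : QManifold.IsQMorphism π)
    {τ : GHom M.toGradedManifold P₀ F.toGradedManifold} (hτ : QManifold.IsQMorphism τ)
    (hP : π.preimage U ≤ P₀) {Ψ : M.Fn (π.preimage U) →ₐ[ℝ] M.Fn (π.preimage U)}
    (hΨ : Ψ ∈ expGauge π G U τ hP) :
    ∃ ΨF : Form M.toGradedManifold (π.preimage U) →ₐ[ℝ] Form M.toGradedManifold (π.preimage U),
      (∀ a, ΨF (Form.fn a) = Form.fn (Ψ a)) ∧ (∀ a, ΨF (Form.dfn a) = Form.dfn (Ψ a)) ∧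
      ∀ {L : Form M.toGradedManifold (π.preimage U) →ₐ[ℝ] Matrix (Fin 2) (Fin 2) (N.Fn U)},
        IsTransverse π U L → IsTransverse π U (L.comp ΨF) ∧
        ∀ {p : ℕ} {w : Form F.toGradedManifold ⊤}, w ∈ G.basicDeg p →
          L (ΨF (τ.pullFiberForm hP w)) = L (τ.pullFiberForm hP w) := by
  induction hΨ using Submonoid.closure_induction with
  | mem Ψ h =>
    obtain ⟨X, hX, Φ, hΦ, rfl⟩ := h
    exact ⟨(Φ 1).pullForm _ _ le_rfl (hΦ.mapsTo 1), GHom.pullForm_fn _ _ _, GHom.pullForm_dfn _ _ _,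
      fun hL => hL.flow hπ hτ hP hX hΦ 1⟩
  | one => exact ⟨AlgHom.id ℝ _, fun _ => rfl, fun _ => rfl, fun hL => ⟨hL, fun _ => rfl⟩⟩
  | mul Ψ₁ Ψ₂ _ _ h₁ h₂ =>
    obtain ⟨F₁, hf₁, hd₁, H₁⟩ := h₁
    obtain ⟨F₂, hf₂, hd₂, H₂⟩ := h₂
    -- The second transformation is seen by `L F₁` instead of `L`, so the induction has to carry
    -- along that transversality is preserved.
    refine ⟨F₁.comp F₂, fun a => ?_, fun a => ?_, fun {L} hL => ⟨?_, fun hw => ?_⟩⟩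
    · simp [hf₁, hf₂]
    · simp [hd₁, hd₂]
    · exact (H₂ (H₁ hL).1).1
    · have := (H₂ (H₁ hL).1).2 hw
      exact this.trans ((H₁ hL).2 hw)

end Flow

/-! ### Characteristic forms -/

section Triangular

variable {A R : Type*} [Ring A] [Algebra ℝ A] [Ring R] [Algebra ℝ R]

/-- Upper triangular matrices with entries depending linearly on a parameter. -/
def upperTriangular (x y z : A →ₗ[ℝ] R) : A →ₗ[ℝ] Matrix (Fin 2) (Fin 2) R where
  toFun a := !![x a, y a; 0, z a]
  map_add' a b := by ext i j; fin_cases i <;> fin_cases j <;> simp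
  map_smul' t a := by ext i j; fin_cases i <;> fin_cases j <;> simp

/-- Diagonal matrices with entries depending multiplicatively on a parameter. -/
def diagonalHom (x z : A →ₐ[ℝ] R) : A →ₐ[ℝ] Matrix (Fin 2) (Fin 2) R :=
  AlgHom.ofLinearMap (upperTriangular x.toLinearMap 0 z.toLinearMap)
    (by ext i j; fin_cases i <;> fin_cases j <;> simp [upperTriangular])
    (fun a b => by
      ext i j
      fin_cases i <;> fin_cases j <;> simp [upperTriangular, Matrix.mul_apply])

theorem diagonalHom_apply (x z : A →ₐ[ℝ] R) (a : A) : diagonalHom x z a = !![x a, 0; 0, z a] := rfl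

theorem upperTriangular_apply (x y z : A →ₗ[ℝ] R) (a : A) :
    upperTriangular x y z a = !![x a, y a; 0, z a] := rfl

end Triangular

theorem GHom.preimage_mono {M N : GradedManifold.{u}} (π : GHom M ⊤ N) {U V : Opens N.Body}
    (h : V ≤ U) : π.preimage V ≤ π.preimage U := fun _ hx => h hx

/-! ### Variations of a gauge field and their triangular homomorphisms -/

namespace QBundle

variable {M N F : QManifold.{u}} {G : HolonomyAlgebra F} {B : QBundle M N F G}

/-- An infinitesimal variation of a gauge field: a vertical vector field along it. -/
structure GaugeField.Variation (φ : B.GaugeField) where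
  δ : ∀ U : Opens N.Body, M.Fn (B.π.preimage U) →ₗ[ℝ] N.Fn U
  map_deg : ∀ {U : Opens N.Body} {i : ℕ} {a}, a ∈ M.deg (B.π.preimage U) i → δ U a ∈ N.deg U i
  leibniz : ∀ (U : Opens N.Body) a b, δ U (a * b) = δ U a * φ.pullOn U b + φ.pullOn U a * δ U b
  res : ∀ {U V : Opens N.Body} (h : V ≤ U) a,
    δ V (M.res (B.π.preimage_mono h) a) = N.res h (δ U a)
  base : ∀ (U : Opens N.Body) b, δ U (B.π.pullBase U b) = 0

namespace GaugeField

variable (φ : B.GaugeField)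

/-- The zero variation. -/
def zeroVariation : φ.Variation where
  δ _ := 0
  map_deg _ := Submodule.zero_mem _
  leibniz _ _ _ := by simp
  res _ _ := by simp
  base _ _ := rfl

/-- The operator `F = Q φ^* - φ^* Q` over `U`. -/
noncomputable def fieldOn (U : Opens N.Body) : M.Fn (B.π.preimage U) →ₗ[ℝ] N.Fn U :=
  QManifold.fieldOp φ.toGHom (B.π.preimage U) U le_top (φ.mapsTo U)

theorem fieldOn_apply (U : Opens N.Body) (a : M.Fn (B.π.preimage U)) :
    φ.fieldOn U a = N.Q U (φ.pullOn U a) - φ.pullOn U (M.Q _ a) := rfl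

variable {φ}

theorem pullOn_mem {U : Opens N.Body} {i : ℕ} {a : M.Fn (B.π.preimage U)}
    (ha : a ∈ M.deg _ i) : φ.pullOn U a ∈ N.deg U i := φ.pull_deg _ _ ha

theorem fieldOn_mem {U : Opens N.Body} {i : ℕ} {a : M.Fn (B.π.preimage U)}
    (ha : a ∈ M.deg _ i) : φ.fieldOn U a ∈ N.deg U (i + 1) := QManifold.fieldOp_mem _ _ _ ha

theorem pullOn_res {U V : Opens N.Body} (h : V ≤ U) (a : M.Fn (B.π.preimage U)) :
    φ.pullOn V (M.res (B.π.preimage_mono h) a) = N.res h (φ.pullOn U a) := φ.pull_res _ _ _ _ _ a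

theorem fieldOn_res {U V : Opens N.Body} (h : V ≤ U) (a : M.Fn (B.π.preimage U)) :
    φ.fieldOn V (M.res (B.π.preimage_mono h) a) = N.res h (φ.fieldOn U a) := by
  simp only [fieldOn_apply, map_sub, ← N.Q_res, ← pullOn_res, M.Q_res]

theorem pullOn_base (U : Opens N.Body) (b : N.Fn U) : φ.pullOn U (B.π.pullBase U b) = b :=
  φ.section_pull U b

/-- `π` respects `Q` and `φ` is a section, so both terms of `F` are `Q b`. The field strength is
vertical, which makes gauge invariance possible. -/
theorem fieldOn_base (U : Opens N.Body) (b : N.Fn U) : φ.fieldOn U (B.π.pullBase U b) = 0 := by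
  have h : M.Q _ (B.π.pullBase U b) = B.π.pullBase U (N.Q U b) := B.isQMorphism _ _ _ _ b
  rw [fieldOn_apply, h, pullOn_base, pullOn_base, sub_self]

theorem fieldOn_leibniz {U : Opens N.Body} {i : ℕ} {a : M.Fn (B.π.preimage U)}
    (ha : a ∈ M.deg _ i) (b : M.Fn (B.π.preimage U)) :
    φ.fieldOn U (a * b) = φ.fieldOn U a * φ.pullOn U b +
      (-1 : ℝ) ^ i • (φ.pullOn U a * φ.fieldOn U b) :=
  (QManifold.fieldLiftData φ.toGHom le_top (φ.mapsTo U)).leibniz ha b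

namespace Variation

variable (δ : φ.Variation)

theorem chain (U : Opens N.Body) {r : ℕ} (g : (Fin r → ℝ) → ℝ) (hg : ContDiff ℝ ∞ g)
    (h : Fin r → M.Smooth (B.π.preimage U)) :
    δ.δ U (M.ofSmooth _ (smoothComp g hg h)) = ∑ i, φ.pullOn U (M.ofSmooth _
      (smoothComp (partialDeriv g i) (partialDeriv_contDiff hg i) h)) *
        δ.δ U (M.ofSmooth _ (h i)) :=
  chain_along φ.toGHom le_top (φ.mapsTo U) (fun _ _ => δ.leibniz U _ _) g hg h

/-- The upper right entry is the derivation `K` along `f^*` with `K a = 0` and `K (da) = δ a`. It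
has degree `-1`, so the Leibniz rule `K (x y) = K x f^* y ± f^* x K y` needs the sign of `x`, which
the twist of the upper left entry by `scaleFn U (-1)` supplies. The relations hold by graded
commutativity on the base and the Leibniz rules of `F` and `δ`. -/
theorem liftData (U : Opens N.Body) :
    Form.LiftData (diagonalHom ((scaleFn U (-1)).comp (φ.pullOn U)) (φ.pullOn U))
      (upperTriangular ((scaleFn U (-1)).toLinearMap.comp (φ.fieldOn U)) (δ.δ U) (φ.fieldOn U)) where
  leibniz {i a} ha b := by
    have e : (-1 : ℝ) ^ i * (-1) ^ i = 1 := by rw [← mul_pow]; simp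
    ext k l
    fin_cases k <;> fin_cases l <;>
      simp [diagonalHom_apply, upperTriangular_apply, fieldOn_leibniz ha,
        δ.leibniz, scaleFn_of_mem _ (pullOn_mem ha), smul_smul, e]
  comm {i j a b} ha hb := by
    have h1 := N.comm (pullOn_mem (φ := φ) ha) (fieldOn_mem (φ := φ) hb)
    have h2 := N.comm (pullOn_mem (φ := φ) ha) (δ.map_deg hb)
    ext k l
    fin_cases k <;> fin_cases l <;>
      simp [diagonalHom_apply, upperTriangular_apply, Matrix.mul_apply]
    · rw [← map_mul, h1]; simp
    · rw [scaleFn_of_mem _ (pullOn_mem ha), smul_mul_assoc, h2, smul_smul, mul_add, pow_add,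
        mul_one, mul_comm]
    · exact h1
  comm' {i j a b} ha hb := by
    have h1 := N.comm (fieldOn_mem (φ := φ) ha) (fieldOn_mem (φ := φ) hb)
    have h2 := N.comm (fieldOn_mem (φ := φ) ha) (δ.map_deg hb)
    have h3 := N.comm (δ.map_deg ha) (fieldOn_mem (φ := φ) hb)
    ext k l
    fin_cases k <;> fin_cases l <;>
      simp [upperTriangular_apply, Matrix.mul_apply]
    · rw [← map_mul, h1]; simp
    · rw [scaleFn_of_mem _ (fieldOn_mem ha), scaleFn_of_mem _ (fieldOn_mem hb), smul_mul_assoc,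
        smul_mul_assoc, h2, h3, smul_smul, smul_smul, ← pow_add, ← pow_add,
        Form.neg_one_pow_congr (m := i + 1 + (i + 1) * j) (n := (i + 1) * (j + 1)) (by ring_nf),
        Form.neg_one_pow_congr (m := i * (j + 1)) (n := (i + 1) * (j + 1) + (j + 1))
          (by simp only [Nat.even_add, Nat.even_mul, Nat.not_even_one]; tauto), add_comm]
    · exact h1
  chain g hg h := by
    have h1 := (QManifold.fieldLiftData φ.toGHom le_top (φ.mapsTo U)).chain g hg h
    change φ.fieldOn U _ = ∑ i, φ.pullOn U _ * φ.fieldOn U _ at h1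
    ext k l
    fin_cases k <;> fin_cases l <;>
      simp [diagonalHom_apply, upperTriangular_apply, Matrix.sum_apply, h1,
        δ.chain]
    refine Finset.sum_congr rfl fun i _ => ?_
    rw [scaleFn_of_mem _ (pullOn_mem (ofSmooth_mem_deg_zero _)), pow_zero, one_smul]

/-- The homomorphism from forms to upper triangular matrices whose diagonal entry is the pull-back
along the field strength, and whose off-diagonal entry is the homotopy operator of the variation. -/
noncomputable def hom (U : Opens N.Body) :
    Form M.toGradedManifold (B.π.preimage U) →ₐ[ℝ] Matrix (Fin 2) (Fin 2) (N.Fn U) :=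
  Form.lift (δ.liftData U)

theorem hom_fn (U : Opens N.Body) (a : M.Fn (B.π.preimage U)) :
    δ.hom U (Form.fn a) = !![scaleFn U (-1) (φ.pullOn U a), 0; 0, φ.pullOn U a] :=
  Form.lift_fn _ _

theorem hom_dfn (U : Opens N.Body) (a : M.Fn (B.π.preimage U)) :
    δ.hom U (Form.dfn a) =
      !![scaleFn U (-1) (φ.fieldOn U a), δ.δ U a; 0, φ.fieldOn U a] :=
  Form.lift_dfn _ _

/-- `F` and `δ` both vanish on functions from the base. Families are preserved because all entries
come from `φ^*` and derivations along it. -/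
theorem isTransverse (U : Opens N.Body) : IsTransverse B.π U (δ.hom U) where
  base b := by
    rw [hom_dfn, fieldOn_base, δ.base]
    ext k l
    fin_cases k <;> fin_cases l <;> simp
  family_fn ha := by
    have h1 := ha.pull φ.toGHom le_top (φ.mapsTo U)
    simp only [hom_fn]
    intro k l
    fin_cases k <;> fin_cases l
    · exact h1.scale (-1)
    · exact IsFamily.const 0
    · exact IsFamily.const 0
    · exact h1
  family_dfn ha := by
    have h1 : IsFamily _ _ (fun t => φ.fieldOn U _) (fun t => φ.fieldOn U _) :=
      ha.map_along φ.toGHom le_top (φ.mapsTo U) (D := φ.fieldOn U) fun f b => by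
        have := fieldOn_leibniz (φ := φ) (ofSmooth_mem_deg_zero f) b
        rw [pow_zero, one_smul] at this
        exact this
    have h2 : IsFamily _ _ (fun t => δ.δ U _) (fun t => δ.δ U _) :=
      ha.map_along φ.toGHom le_top (φ.mapsTo U) (D := δ.δ U) fun f b => δ.leibniz U _ _
    simp only [hom_dfn]
    intro k l
    fin_cases k <;> fin_cases l
    · exact h1.scale (-1)
    · exact h2
    · exact IsFamily.const 0
    · exact h1

/-- The homotopy operator lowers the degree by one. Degrees are natural numbers, so `p = 0` is a
case of its own, where the operator is zero. -/
theorem hom_entries (U : Opens N.Body) {p : ℕ} {w : Form M.toGradedManifold (B.π.preimage U)}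
    (hw : w ∈ Form.deg M.toGradedManifold _ p) :
    δ.hom U w 1 1 ∈ N.deg U p ∧ δ.hom U w 1 0 = 0 ∧
      δ.hom U w 0 0 = (-1 : ℝ) ^ p • δ.hom U w 1 1 ∧
      (p = 0 → δ.hom U w 0 1 = 0) ∧ ∀ q, p = q + 1 → δ.hom U w 0 1 ∈ N.deg U q := by
  induction hw using Submodule.span_induction with
  | zero => simp
  | add x y _ _ hx hy =>
    obtain ⟨a1, a2, a3, a4, a5⟩ := hx
    obtain ⟨b1, b2, b3, b4, b5⟩ := hy
    simp only [map_add, Matrix.add_apply]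
    exact ⟨Submodule.add_mem _ a1 b1, by rw [a2, b2, add_zero], by rw [a3, b3, smul_add],
      fun h => by rw [a4 h, b4 h, add_zero], fun q h => Submodule.add_mem _ (a5 q h) (b5 q h)⟩
  | smul s x _ hx =>
    obtain ⟨a1, a2, a3, a4, a5⟩ := hx
    simp only [map_smul, Matrix.smul_apply]
    exact ⟨Submodule.smul_mem _ _ a1, by rw [a2, smul_zero], by rw [a3, smul_comm],
      fun h => by rw [a4 h, smul_zero], fun q h => Submodule.smul_mem _ _ (a5 q h)⟩
  | mem w hw =>
    induction hw with
    | one => simp [SetLike.GradedOne.one_mem]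
    | @fn_mul i p a w ha _ ih =>
      obtain ⟨a1, a2, a3, a4, a5⟩ := ih
      have hp := pullOn_mem (φ := φ) ha
      simp only [map_mul, hom_fn, Matrix.mul_apply, Fin.sum_univ_two, Matrix.of_apply,
        Matrix.cons_val_zero, Matrix.cons_val_one, Matrix.cons_val', zero_mul, add_zero, zero_add,
        scaleFn_of_mem _ hp]
      refine ⟨SetLike.GradedMul.mul_mem hp a1, by rw [a2, mul_zero], ?_, fun h => ?_, fun q h => ?_⟩
      · rw [a3, smul_mul_assoc, mul_smul_comm, smul_smul, pow_add]
      · rw [a4 (by omega), mul_zero]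
      · rw [smul_mul_assoc]
        refine Submodule.smul_mem _ _ ?_
        rcases Nat.eq_zero_or_pos p with h0 | h0
        · rw [a4 h0, mul_zero]; exact Submodule.zero_mem _
        · have := SetLike.GradedMul.mul_mem hp (a5 (p - 1) (by omega))
          rwa [show i + (p - 1) = q by omega] at this
    | @dfn_mul i p a w ha _ ih =>
      obtain ⟨a1, a2, a3, a4, a5⟩ := ih
      have hp := fieldOn_mem (φ := φ) ha
      simp only [map_mul, hom_dfn, Matrix.mul_apply, Fin.sum_univ_two, Matrix.of_apply,
        Matrix.cons_val_zero, Matrix.cons_val_one, Matrix.cons_val', zero_mul, zero_add,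
        scaleFn_of_mem _ hp]
      refine ⟨SetLike.GradedMul.mul_mem hp a1, by rw [a2, mul_zero], ?_, fun h => by omega,
        fun q h => ?_⟩
      · rw [a3, a2, mul_zero, add_zero, smul_mul_assoc, mul_smul_comm, smul_smul, pow_add _ (i + 1)]
      · rw [smul_mul_assoc]
        refine Submodule.add_mem _ (Submodule.smul_mem _ _ ?_) ?_
        · rcases Nat.eq_zero_or_pos p with h0 | h0
          · rw [a4 h0, mul_zero]; exact Submodule.zero_mem _
          · have := SetLike.GradedMul.mul_mem hp (a5 (p - 1) (by omega))
            rwa [show i + 1 + (p - 1) = q by omega] at this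
        · have := SetLike.GradedMul.mul_mem (δ.map_deg ha) a1
          rwa [show i + p = q by omega] at this

/-- The value of `hom` on the trivial extension of a form on the fibre. -/
noncomputable def fiberHom (i : B.Index) (U : Opens N.Body) (hU : U ≤ B.U i) :
    Form F.toGradedManifold ⊤ →ₐ[ℝ] Matrix (Fin 2) (Fin 2) (N.Fn U) :=
  (δ.hom U).comp ((B.τ i).pullFiberForm (B.π.preimage_mono hU))

theorem fiberHom_res (i : B.Index) {U V : Opens N.Body} (hU : U ≤ B.U i) (h : V ≤ U)
    (w : Form F.toGradedManifold ⊤) (k l : Fin 2) :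
    N.res h (δ.fiberHom i U hU w k l) = δ.fiberHom i V (h.trans hU) w k l := by
  have hτ : ∀ a, (B.τ i).pullFiber (B.π.preimage_mono (h.trans hU)) a =
      M.res (B.π.preimage_mono h) ((B.τ i).pullFiber (B.π.preimage_mono hU) a) := fun a => by
    have := (B.τ i).pull_res (le_refl ⊤) (B.π.preimage_mono h) (B.π.preimage_mono hU)
      (fun _ _ => trivial) (fun _ _ => trivial) a
    rwa [F.res_self] at this
  have hs : ∀ a : N.Fn U, scaleFn V (-1) (N.res h a) = N.res h (scaleFn U (-1) a) := fun a => by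
    induction a using DirectSum.Decomposition.inductionOn (N.deg U) with
    | zero => simp
    | homogeneous a => rw [scaleFn_of_mem _ a.2, scaleFn_of_mem _ (N.res_deg h a.2), map_smul]
    | add a b ha hb => simp only [map_add, ha, hb]
  have key : (N.res h).mapMatrix.comp (δ.fiberHom i U hU) = δ.fiberHom i V (h.trans hU) := by
    have h1 : ∀ a, φ.pullOn V ((B.τ i).pullFiber (B.π.preimage_mono (h.trans hU)) a) =
        N.res h (φ.pullOn U ((B.τ i).pullFiber (B.π.preimage_mono hU) a)) := fun a => by
      rw [hτ]; exact pullOn_res h _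
    have h2 : ∀ a, φ.fieldOn V ((B.τ i).pullFiber (B.π.preimage_mono (h.trans hU)) a) =
        N.res h (φ.fieldOn U ((B.τ i).pullFiber (B.π.preimage_mono hU) a)) := fun a => by
      rw [hτ]; exact fieldOn_res h _
    have h3 : ∀ a, δ.δ V ((B.τ i).pullFiber (B.π.preimage_mono (h.trans hU)) a) =
        N.res h (δ.δ U ((B.τ i).pullFiber (B.π.preimage_mono hU) a)) := fun a => by
      rw [hτ]; exact δ.res h _
    refine Form.lift_unique (fun a => ?_) (fun a => ?_)
    · simp only [fiberHom, AlgHom.comp_apply, GHom.pullFiberForm_fn, hom_fn, h1, hs]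
      ext k l
      fin_cases k <;> fin_cases l <;> simp
    · simp only [fiberHom, AlgHom.comp_apply, GHom.pullFiberForm_dfn, hom_dfn, h2, h3, hs]
      ext k l
      fin_cases k <;> fin_cases l <;> simp
  rw [← key]
  rfl

/-- The trivializations differ by a gauge transformation, to which a transverse homomorphism is
insensitive on basic forms. Since whole matrices agree, the characteristic form and the homotopy
operator glue for the same reason. -/
theorem fiberHom_overlap (i j : B.Index) {p : ℕ} {w : Form F.toGradedManifold ⊤}
    (hw : w ∈ G.basicDeg p) :
    δ.fiberHom j (B.U i ⊓ B.U j) inf_le_right w = δ.fiberHom i (B.U i ⊓ B.U j) inf_le_left w := by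
  obtain ⟨Ψ, hΨ, hij⟩ := B.transition i j
  obtain ⟨ΨF, hf, hd, H⟩ := IsTransverse.expGauge_eq B.isQMorphism
    (B.isTrivialization i).isQMorphism (B.π.preimage_mono inf_le_left) hΨ
  rw [fiberHom, fiberHom, AlgHom.comp_apply, AlgHom.comp_apply,
    ← (H (δ.isTransverse (B.U i ⊓ B.U j))).2 hw]
  refine congrArg _ ?_
  rw [← AlgHom.comp_apply]
  refine DFunLike.congr_fun (Form.lift_unique (fun a => ?_) (fun a => ?_)) w
  · rw [AlgHom.comp_apply, GHom.pullFiberForm_fn, GHom.pullFiberForm_fn, hf]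
    exact congrArg _ (hij a)
  · rw [AlgHom.comp_apply, GHom.pullFiberForm_dfn, GHom.pullFiberForm_dfn, hd]
    exact congrArg _ (hij a)

theorem fiberHom_compat (i j : B.Index) {p : ℕ} {w : Form F.toGradedManifold ⊤}
    (hw : w ∈ G.basicDeg p) (k l : Fin 2) :
    N.res (inf_le_left : B.U i ⊓ B.U j ≤ B.U i) (δ.fiberHom i (B.U i) le_rfl w k l) =
      N.res inf_le_right (δ.fiberHom j (B.U j) le_rfl w k l) := by
  rw [fiberHom_res, fiberHom_res, fiberHom_overlap δ i j hw]

theorem hom_one_one (U : Opens N.Body) {p : ℕ} {w : Form M.toGradedManifold (B.π.preimage U)}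
    (hw : w ∈ Form.deg M.toGradedManifold _ p) :
    δ.hom U w 1 1 = QManifold.fieldStrength φ.toGHom (B.π.preimage U) U le_top (φ.mapsTo U) w := by
  induction hw using Submodule.span_induction with
  | zero => simp
  | add x y _ _ hx hy => simp [hx, hy]
  | smul s x _ hx => simp [hx]
  | mem w hw =>
    induction hw with
    | one => simp
    | fn_mul ha _ ih =>
      rw [map_mul, map_mul, QManifold.fieldStrength, Form.lift_fn, ← QManifold.fieldStrength, ← ih,
        hom_fn]
      simp [Matrix.mul_apply]
      rfl
    | dfn_mul ha _ ih =>
      rw [map_mul, map_mul, QManifold.fieldStrength, Form.lift_dfn, ← QManifold.fieldStrength, ← ih,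
        hom_dfn]
      simp [Matrix.mul_apply]
      rfl

theorem pullFiberForm_mem (i : B.Index) {P : Opens M.Body} (hP : P ≤ B.π.preimage (B.U i)) {p : ℕ}
    {w : Form F.toGradedManifold ⊤} (hw : w ∈ Form.deg F.toGradedManifold ⊤ p) :
    (B.τ i).pullFiberForm hP w ∈ Form.deg M.toGradedManifold P p := by
  induction hw using Submodule.span_induction with
  | zero => rw [map_zero]; exact Submodule.zero_mem _
  | add x y _ _ hx hy => rw [map_add]; exact Submodule.add_mem _ hx hy
  | smul s x _ hx => rw [map_smul]; exact Submodule.smul_mem _ _ hx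
  | mem w hw => exact Submodule.subset_span ((B.τ i).pullForm_monomial _ _ hw)

theorem fiberHom_one_one (i : B.Index) {p : ℕ} {w : Form F.toGradedManifold ⊤}
    (hw : w ∈ Form.deg F.toGradedManifold ⊤ p) :
    δ.fiberHom i (B.U i) le_rfl w 1 1 = φ.localChar i w :=
  δ.hom_one_one _ (pullFiberForm_mem i _ hw)

end Variation

theorem localChar_mem (i : B.Index) {p : ℕ} {w : Form F.toGradedManifold ⊤}
    (hw : w ∈ Form.deg F.toGradedManifold ⊤ p) : φ.localChar i w ∈ N.deg (B.U i) p := by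
  rw [← φ.zeroVariation.fiberHom_one_one i hw]
  exact (φ.zeroVariation.hom_entries _ (Variation.pullFiberForm_mem i _ hw)).1

/-- The characteristic form of a basic form. -/
theorem exists_characteristicForm (φ : B.GaugeField) {p : ℕ} {w : Form F.toGradedManifold ⊤}
    (hw : w ∈ G.basicDeg p) : ∃ c ∈ N.deg ⊤ p, φ.IsCharacteristicForm w c := by
  refine exists_glue B.U (fun _ => le_top) (fun x _ => B.cover x) p (fun i => φ.localChar i w)
    (fun i => localChar_mem i hw.1) fun i j => ?_
  have := φ.zeroVariation.fiberHom_compat i j hw 1 1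
  rwa [φ.zeroVariation.fiberHom_one_one i hw.1, φ.zeroVariation.fiberHom_one_one j hw.1] at this

theorem IsCharacteristicForm.unique {w : Form F.toGradedManifold ⊤} {c c' : N.Fn ⊤}
    (hc : φ.IsCharacteristicForm w c) (hc' : φ.IsCharacteristicForm w c') : c = c' :=
  eq_of_local fun x _ => by
    obtain ⟨i, hi⟩ := B.cover x
    exact ⟨B.U i, le_top, hi, (hc i).trans (hc' i).symm⟩

end GaugeField

/-- The total differential is natural with respect to Q-morphisms. -/
theorem _root_.QManifold.totalQ_pullForm {M N : QManifold.{u}} {P : Opens M.Body}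
    {φ : GHom M.toGradedManifold P N.toGradedManifold} (hφ : QManifold.IsQMorphism φ)
    {U : Opens M.Body} {V : Opens N.Body} (hU : U ≤ P) (h : Set.MapsTo φ.body U V) {p : ℕ}
    {w : Form N.toGradedManifold V} (hw : w ∈ Form.deg N.toGradedManifold V p) :
    M.totalQ U (φ.pullForm V U hU h w) = φ.pullForm V U hU h (N.totalQ V w) := by
  induction hw using Submodule.span_induction with
  | zero => simp
  | add x y _ _ hx hy => simp [hx, hy]
  | smul s x _ hx => simp [hx]
  | mem w hw =>
    induction hw with
    | one => simp [QManifold.totalQ_one]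
    | fn_mul ha _ ih =>
      rw [map_mul, φ.pullForm_fn, M.totalQ_fn_mul U (φ.pull_deg hU h ha), ih, hφ,
        N.totalQ_fn_mul V ha]
      simp only [map_add, map_mul, map_smul, φ.pullForm_fn, φ.pullForm_dfn]
    | dfn_mul ha _ ih =>
      rw [map_mul, φ.pullForm_dfn, M.totalQ_dfn_mul U (φ.pull_deg hU h ha), ih, hφ,
        N.totalQ_dfn_mul V ha]
      simp only [map_add, map_neg, map_mul, map_smul, φ.pullForm_dfn]

theorem _root_.QManifold.totalQ_mem (M : QManifold.{u}) {U : Opens M.Body} {p : ℕ}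
    {w : Form M.toGradedManifold U} (hw : w ∈ Form.deg M.toGradedManifold U p) :
    M.totalQ U w ∈ Form.deg M.toGradedManifold U (p + 1) := by
  have hf : ∀ {i p : ℕ} {a : M.Fn U} {w}, a ∈ M.deg U i → w ∈ Form.deg M.toGradedManifold U p →
      Form.fn a * w ∈ Form.deg M.toGradedManifold U (i + p) := fun ha hw => by
    induction hw using Submodule.span_induction with
    | zero => rw [mul_zero]; exact Submodule.zero_mem _
    | add x y _ _ hx hy => rw [mul_add]; exact Submodule.add_mem _ hx hy
    | smul s x _ hx => rw [mul_smul_comm]; exact Submodule.smul_mem _ _ hx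
    | mem w hw => exact Submodule.subset_span (.fn_mul ha hw)
  have hd : ∀ {i p : ℕ} {a : M.Fn U} {w}, a ∈ M.deg U i → w ∈ Form.deg M.toGradedManifold U p →
      Form.dfn a * w ∈ Form.deg M.toGradedManifold U (i + 1 + p) := fun ha hw => by
    induction hw using Submodule.span_induction with
    | zero => rw [mul_zero]; exact Submodule.zero_mem _
    | add x y _ _ hx hy => rw [mul_add]; exact Submodule.add_mem _ hx hy
    | smul s x _ hx => rw [mul_smul_comm]; exact Submodule.smul_mem _ _ hx
    | mem w hw => exact Submodule.subset_span (.dfn_mul ha hw)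
  induction hw using Submodule.span_induction with
  | zero => simp
  | add x y _ _ hx hy => rw [map_add]; exact Submodule.add_mem _ hx hy
  | smul s x _ hx => rw [map_smul]; exact Submodule.smul_mem _ _ hx
  | mem w hw =>
    induction hw with
    | one => simp [QManifold.totalQ_one]
    | @fn_mul i p a w ha hw ih =>
      have hw' : w ∈ Form.deg M.toGradedManifold U p := Submodule.subset_span hw
      rw [M.totalQ_fn_mul U ha]
      refine Submodule.add_mem _ (Submodule.add_mem _ ?_ ?_) (Submodule.smul_mem _ _ ?_)
      · simpa only [add_right_comm] using hd ha hw'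
      · simpa only [add_right_comm] using hf (M.Q_mem U ha) hw'
      · simpa only [add_assoc] using hf ha ih
    | @dfn_mul i p a w ha hw ih =>
      have hw' : w ∈ Form.deg M.toGradedManifold U p := Submodule.subset_span hw
      rw [M.totalQ_dfn_mul U ha]
      refine Submodule.add_mem _ (Submodule.neg_mem _ ?_) (Submodule.smul_mem _ _ ?_)
      · rw [add_right_comm]; exact hd (M.Q_mem U ha) hw'
      · rw [add_assoc]; exact hd ha ih

/-! ### The field strength as a chain map, and the map in cohomology -/

namespace GaugeField

variable {φ : B.GaugeField}

/-- The pull-back along the field strength intertwines the differentials. -/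
theorem Variation.hom_totalQ (δ : φ.Variation) (U : Opens N.Body) {p : ℕ}
    {w : Form M.toGradedManifold (B.π.preimage U)} (hw : w ∈ Form.deg M.toGradedManifold _ p) :
    N.Q U (δ.hom U w 1 1) = δ.hom U (M.totalQ _ w) 1 1 := by
  rw [Variation.hom_one_one _ _ hw, Variation.hom_one_one _ _ (M.totalQ_mem hw)]
  set f := QManifold.fieldStrength φ.toGHom (B.π.preimage U) U le_top (φ.mapsTo U) with hf
  have hfn : ∀ a, f (Form.fn a) = φ.pullOn U a := Form.lift_fn _
  have hfd : ∀ a, f (Form.dfn a) = φ.fieldOn U a := Form.lift_dfn _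
  induction hw using Submodule.span_induction with
  | zero => simp
  | add x y _ _ hx hy => simp [hx, hy]
  | smul s x _ hx => simp [hx]
  | mem w hw =>
    induction hw with
    | one => simpa [QManifold.totalQ_one] using N.Q_leibniz U SetLike.GradedOne.one_mem 1
    | fn_mul ha _ ih =>
      rw [M.totalQ_fn_mul _ ha]
      simp only [map_add, map_mul, map_smul, hfn, hfd, N.Q_leibniz U (pullOn_mem ha), ← ih,
        fieldOn_apply, sub_mul, sub_add_cancel]
    | dfn_mul ha _ ih =>
      rw [M.totalQ_dfn_mul _ ha]
      simp only [map_add, map_neg, map_mul, map_smul, hfd, N.Q_leibniz U (fieldOn_mem ha), ← ih]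
      -- Both `Q F a` and `-F (Q a)` equal `-Q φ^* Q a`, because `Q² = 0` on the base and on the
      -- total space.
      simp [fieldOn_apply, N.Q_sq, M.Q_sq]

/-- A trivialization is a Q-morphism, so trivial extension commutes with the total differentials,
and `f^*` is a chain map. -/
theorem localChar_totalQ (φ : B.GaugeField) (i : B.Index) {p : ℕ} {w : Form F.toGradedManifold ⊤}
    (hw : w ∈ Form.deg F.toGradedManifold ⊤ p) :
    N.Q _ (φ.localChar i w) = φ.localChar i (F.totalQ ⊤ w) := by
  rw [← φ.zeroVariation.fiberHom_one_one i hw,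
    ← φ.zeroVariation.fiberHom_one_one i (F.totalQ_mem hw)]
  refine (φ.zeroVariation.hom_totalQ _ (Variation.pullFiberForm_mem i _ hw)).trans ?_
  have := QManifold.totalQ_pullForm (B.isTrivialization i).isQMorphism
    (V := ⊤) (le_refl (B.π.preimage (B.U i))) (fun _ _ => trivial) hw
  exact congrArg (fun w => φ.zeroVariation.hom (B.U i) w 1 1) this

theorem IsCharacteristicForm.totalQ {p : ℕ} {w : Form F.toGradedManifold ⊤} {c : N.Fn ⊤}
    (hw : w ∈ Form.deg F.toGradedManifold ⊤ p) (hc : φ.IsCharacteristicForm w c) :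
    φ.IsCharacteristicForm (F.totalQ ⊤ w) (N.Q ⊤ c) := fun i => by
  rw [← N.Q_res, hc i, localChar_totalQ φ i hw]

/-- The characteristic form, as a linear map on basic forms. -/
theorem exists_charHom (φ : B.GaugeField) (p : ℕ) :
    ∃ C : G.basicDeg p →ₗ[ℝ] N.Fn ⊤, ∀ w : G.basicDeg p, C w ∈ N.deg ⊤ p ∧
      φ.IsCharacteristicForm w (C w) := by
  choose C hC hC' using fun w : G.basicDeg p => φ.exists_characteristicForm w.2
  refine ⟨⟨⟨C, fun v w => ?_⟩, fun s w => ?_⟩, fun w => ⟨hC w, hC' w⟩⟩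
  · refine IsCharacteristicForm.unique (hC' (v + w)) fun i => ?_
    rw [map_add, hC' v i, hC' w i]
    simp [localChar]
  · refine IsCharacteristicForm.unique (hC' (s • w)) fun i => ?_
    rw [RingHom.id_apply, map_smul, hC' w i]
    simp [localChar]

/-- Characteristic forms are unique, so the condition prescribes `χ` on every cocycle. For
existence, cocycles go to cocycles, and `Q_TF v` with `v` basic goes to `Q` of the characteristic
form of `v`. It matters here that coboundaries are taken within the basic forms. -/
theorem existsUnique_characteristicMap (φ : B.GaugeField) (p : ℕ) :
    ∃! χ : FiberCohomology G p →ₗ[ℝ] BaseCohomology N p, φ.IsCharacteristicMap p χ := by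
  obtain ⟨C, hC⟩ := φ.exists_charHom p
  have hzero : ∀ {c : N.Fn ⊤}, φ.IsCharacteristicForm 0 c → c = 0 := fun hc =>
    hc.unique fun i => by simp [localChar]
  have hmem : ∀ w : GradedComplex.cocycles G.basicDeg (F.totalQ ⊤) p,
      C ⟨w, w.2.1⟩ ∈ GradedComplex.cocycles (N.deg ⊤) (N.Q ⊤) p := fun w => by
    refine ⟨(hC _).1, hzero ?_⟩
    have h := IsCharacteristicForm.totalQ w.2.1.1 (hC ⟨w, w.2.1⟩).2
    rwa [show F.totalQ ⊤ w.1 = 0 from w.2.2] at h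
  let C' : GradedComplex.cocycles G.basicDeg (F.totalQ ⊤) p →ₗ[ℝ]
      GradedComplex.cocycles (N.deg ⊤) (N.Q ⊤) p :=
    (C.comp (Submodule.inclusion (inf_le_left : GradedComplex.cocycles G.basicDeg _ p ≤ _))).codRestrict
      _ hmem
  have hC' : ∀ w, φ.IsCharacteristicForm w.1 (C' w).1 := fun w => (hC ⟨w, w.2.1⟩).2
  have hker : (GradedComplex.coboundaries G.basicDeg (F.totalQ ⊤) p).submoduleOf
      (GradedComplex.cocycles G.basicDeg (F.totalQ ⊤) p) ≤
      ((GradedComplex.coboundaries (N.deg ⊤) (N.Q ⊤) p).submoduleOf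
      (GradedComplex.cocycles (N.deg ⊤) (N.Q ⊤) p)).comap C' := by
    intro w hw
    rw [Submodule.mem_comap, Submodule.submoduleOf, Submodule.mem_comap, Submodule.subtype_apply]
    rw [Submodule.submoduleOf, Submodule.mem_comap, Submodule.subtype_apply] at hw
    have h := hC' w
    cases p with
    | zero =>
      rw [show w.1 = 0 from hw] at h
      exact hzero h
    | succ p =>
      obtain ⟨v, hv, hvw⟩ := hw
      obtain ⟨c, hc, hcv⟩ := φ.exists_characteristicForm hv
      refine ⟨c, hc, ?_⟩
      rw [← hvw] at h
      exact (hcv.totalQ hv.1).unique h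
  refine ⟨Submodule.mapQ _ _ C' hker, fun w => ⟨C' w, hC' w, rfl⟩, fun χ hχ => ?_⟩
  refine LinearMap.ext fun x => ?_
  obtain ⟨w, rfl⟩ := Submodule.mkQ_surjective _ x
  obtain ⟨c, hc, hcw⟩ := hχ w
  have : c = C' w := Subtype.ext (hc.unique (hC' w))
  subst this
  exact hcw

end GaugeField

end QBundle

/-! ### Homotopy invariance -/

namespace GradedManifold

variable {M : GradedManifold.{u}} {U : Opens M.Body}

/-- The component of degree `j` is multiplied by `2 ^ j`, and distinct powers of two differ.
Homogeneity becomes an identity, which can then be differentiated or integrated in a parameter. -/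
theorem mem_deg_of_scaleFn {a : M.Fn U} {i : ℕ} (h : scaleFn U 2 a = (2 : ℝ) ^ i • a) :
    a ∈ M.deg U i := by
  have key : ∀ (b : M.Fn U) (j : ℕ), (DirectSum.decompose (M.deg U) (scaleFn U 2 b) j : M.Fn U) =
      (2 : ℝ) ^ j • (DirectSum.decompose (M.deg U) b j : M.Fn U) := by
    intro b j
    induction b using DirectSum.Decomposition.inductionOn (M.deg U) with
    | zero => simp
    | @homogeneous k b =>
      rw [scaleFn_of_mem _ b.2, DirectSum.decompose_smul, DirectSum.smul_apply,
        Submodule.coe_smul]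
      by_cases hk : k = j
      · subst hk; rfl
      · rw [DirectSum.decompose_of_mem_ne _ b.2 hk, smul_zero, smul_zero]
    | add b c hb hc => simp only [map_add, DirectSum.decompose_add, DirectSum.add_apply,
        Submodule.coe_add, hb, hc, smul_add]
  classical
  rw [← DirectSum.sum_support_decompose (M.deg U) a]
  refine Submodule.sum_mem _ fun j _ => ?_
  by_cases hj : j = i
  · subst hj; exact SetLike.coe_mem _
  · have h1 := key a j
    rw [h, DirectSum.decompose_smul, DirectSum.smul_apply, Submodule.coe_smul, ← sub_eq_zero,
      ← sub_smul] at h1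
    rw [(smul_eq_zero.1 h1).resolve_left fun h2 => hj
      (Nat.pow_right_injective le_rfl (by exact_mod_cast (sub_eq_zero.1 h2).symm))]
    exact Submodule.zero_mem _

/-- Scaling commutes with the `t`-derivative, so uniqueness of derivatives transfers the eigenvalue
equation from `c` to `c'`. -/
theorem IsFamily.deriv_mem_deg {c c' : ℝ → M.Fn U} (hc : IsFamily M U c c') {i : ℕ}
    (h : ∀ t, c t ∈ M.deg U i) (t : ℝ) : c' t ∈ M.deg U i := by
  have h1 := hc.scale 2
  simp only [scaleFn_of_mem _ (h _)] at h1
  exact mem_deg_of_scaleFn (congrFun (h1.deriv_unique (hc.smul _)) t)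

/-- The defect in the eigenvalue equation has derivative zero and vanishes at `t = 0`. -/
theorem IsFamily.mem_deg {c c' : ℝ → M.Fn U} (hc : IsFamily M U c c') {i : ℕ}
    (h : ∀ t, c' t ∈ M.deg U i) (h0 : c 0 = 0) (t : ℝ) : c t ∈ M.deg U i := by
  have h1 := (hc.scale 2).sub (hc.smul (2 ^ i))
  simp only [scaleFn_of_mem _ (h _), sub_self] at h1
  have := h1.eq_of_deriv_eq_zero t 0
  rw [h0] at this
  exact mem_deg_of_scaleFn (by simpa [sub_eq_zero] using this)

end GradedManifold

namespace QBundle.GaugeField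

variable {M N F : QManifold.{u}} {G : HolonomyAlgebra F} {B : QBundle M N F G}

/-- The derivative of a smooth family of gauge fields is a family of variations. -/
theorem exists_variation {ψ : ℝ → B.GaugeField}
    (hψ : ∀ (U : Opens N.Body) (a : M.Fn (B.π.preimage U)),
      ∃ c', IsFamily N.toGradedManifold U (fun t => (ψ t).pullOn U a) c') :
    ∃ δ : ∀ t, (ψ t).Variation, ∀ (U : Opens N.Body) (a : M.Fn (B.π.preimage U)),
      IsFamily N.toGradedManifold U (fun t => (ψ t).pullOn U a) (fun t => (δ t).δ U a) := by
  -- By uniqueness of derivatives, each property of `δ_t` is the `t`-derivative of one of `ψ_t^*`.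
  -- The Leibniz rule comes from multiplicativity, and verticality from `ψ_t^* π^* = id` being
  -- constant.
  choose D hD using hψ
  refine ⟨fun t => ⟨fun U => ⟨⟨fun a => D U a t, fun a b => ?_⟩, fun s a => ?_⟩, fun {U i a} ha => ?_,
    fun U a b => ?_, fun {U V} h a => ?_, fun U b => ?_⟩, hD⟩
  · have h := (hD U a).add (hD U b)
    simp only [← map_add] at h
    exact congrFun ((hD U (a + b)).deriv_unique h) t
  · have h := (hD U a).smul s
    simp only [← map_smul] at h
    exact congrFun ((hD U (s • a)).deriv_unique h) t
  · exact (hD U a).deriv_mem_deg (fun t => pullOn_mem ha) t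
  · have h := (hD U a).mul (hD U b)
    simp only [← map_mul] at h
    exact congrFun ((hD U (a * b)).deriv_unique h) t
  · have h1 := (hD U a).restrict h
    simp only [← pullOn_res h] at h1
    exact congrFun ((hD V _).deriv_unique h1) t
  · have h1 := hD U (B.π.pullBase U b)
    simp only [pullOn_base] at h1
    exact congrFun (h1.deriv_unique (IsFamily.const b)) t

section

variable {ψ : ℝ → B.GaugeField} {δ : ∀ t, (ψ t).Variation}
  (hδ : ∀ (U : Opens N.Body) (a : M.Fn (B.π.preimage U)),
    IsFamily N.toGradedManifold U (fun t => (ψ t).pullOn U a) (fun t => (δ t).δ U a))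

include hδ

theorem isFamily_fieldOn (U : Opens N.Body) (a : M.Fn (B.π.preimage U)) :
    IsFamily N.toGradedManifold U (fun t => (ψ t).fieldOn U a)
      (fun t => N.Q U ((δ t).δ U a) - (δ t).δ U (M.Q _ a)) := by
  simp only [fieldOn_apply]
  exact ((hδ U a).map_derivation (N.isDerivation_Q U)).sub (hδ U _)

/-- The off-diagonal entry is a homotopy operator for the derivative of the pull-back along the
field strength. -/
theorem isFamily_hom (U : Opens N.Body) {p : ℕ} {w : Form M.toGradedManifold (B.π.preimage U)}
    (hw : w ∈ Form.deg M.toGradedManifold _ p) :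
    IsFamily N.toGradedManifold U (fun t => (δ t).hom U w 1 1)
      (fun t => N.Q U ((δ t).hom U w 0 1) + (δ t).hom U (M.totalQ _ w) 0 1) := by
  induction hw using Submodule.span_induction with
  | zero => simpa using IsFamily.const (M := N.toGradedManifold) (U := U) 0
  | add x y _ _ hx hy =>
    convert hx.add hy using 2
    · simp
    · simp; abel
  | smul s x _ hx =>
    convert hx.smul s using 2
    · simp
    · simp
  | mem w hw =>
    induction hw with
    | one => simpa [QManifold.totalQ_one] using IsFamily.const (M := N.toGradedManifold) (U := U) 1
    | @fn_mul i p a w ha hw ih =>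
      convert (hδ U a).mul ih using 2 with t t
      · simp [Variation.hom_fn, Matrix.mul_apply]
      · have hp := pullOn_mem (φ := ψ t) ha
        simp only [M.totalQ_fn_mul _ ha, map_add, map_smul, map_mul, Matrix.add_apply,
          Matrix.smul_apply, Variation.hom_fn, Variation.hom_dfn, Matrix.mul_apply,
          Fin.sum_univ_two, Matrix.of_apply, Matrix.cons_val_zero, Matrix.cons_val_one,
          Matrix.cons_val', zero_mul, add_zero, scaleFn_of_mem _ hp,
          scaleFn_of_mem _ (fieldOn_mem (φ := ψ t) ha),
          scaleFn_of_mem _ (pullOn_mem (φ := ψ t) (M.Q_mem _ ha)), smul_mul_assoc,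
          N.Q_leibniz U hp, smul_add, smul_smul, pow_succ, mul_add]
        -- The terms in `K w` have total coefficient `± (Q φ^* a - F a - φ^* Q a) = 0`. The term `δ
        -- a f^* w` comes from the summand `da` of `Q_TM a`.
        rw [fieldOn_apply, sub_mul]
        rcases neg_one_pow_eq_or ℝ i with h | h <;> rw [h] <;> module
    | @dfn_mul i p a w ha hw ih =>
      have hw' : w ∈ Form.deg M.toGradedManifold _ p := Submodule.subset_span hw
      convert (isFamily_fieldOn hδ U a).mul ih using 2 with t t
      · simp [Variation.hom_dfn, Matrix.mul_apply]
      · have hp := fieldOn_mem (φ := ψ t) ha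
        -- This cancels the terms in `K w`. The terms with factor `δ a` cancel because `Q f^* w =
        -- f^* Q_TM w`.
        have hQ : N.Q U ((ψ t).fieldOn U a) = - (ψ t).fieldOn U (M.Q _ a) := by
          simp [fieldOn_apply, N.Q_sq, M.Q_sq]
        simp only [M.totalQ_dfn_mul _ ha, map_add, map_neg, map_smul, map_mul, Matrix.add_apply,
          Matrix.neg_apply, Matrix.smul_apply, Variation.hom_dfn, Matrix.mul_apply,
          Fin.sum_univ_two, Matrix.of_apply, Matrix.cons_val_zero, Matrix.cons_val_one,
          Matrix.cons_val', scaleFn_of_mem _ hp,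
          scaleFn_of_mem _ (fieldOn_mem (φ := ψ t) (M.Q_mem _ ha)), smul_mul_assoc,
          N.Q_leibniz U hp, N.Q_leibniz U ((δ t).map_deg ha), ← (δ t).hom_totalQ U hw', hQ,
          smul_add, smul_smul, pow_succ, sub_mul, mul_add, neg_mul]
        rcases neg_one_pow_eq_or ℝ i with h | h <;> rw [h] <;> module

/-- `K_t` is built from `φ_t^*`, `F_t` and `δ_t`, which are smooth in `t`. Its derivative is
irrelevant; smoothness is needed only to integrate it. -/
theorem isSmoothFamily_hom (U : Opens N.Body) {p : ℕ}
    {w : Form M.toGradedManifold (B.π.preimage U)} (hw : w ∈ Form.deg M.toGradedManifold _ p) :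
    IsSmoothFamily N.toGradedManifold U (fun t => (δ t).hom U w 0 1) := by
  have h0 : IsSmoothFamily N.toGradedManifold U (fun _ => 0) := (IsFamily.const 0).isSmoothFamily
  induction hw using Submodule.span_induction with
  | zero => simpa using h0
  | add x y _ _ hx hy => simpa using hx.add hy
  | smul s x _ hx => simpa using hx.smul s
  | mem w hw =>
    induction hw with
    | one => simpa using h0
    | @fn_mul i p a w ha hw ih =>
      convert ((hδ U a).isSmoothFamily.mul ih).smul ((-1) ^ i) using 2 with t
      simp [Variation.hom_fn, Matrix.mul_apply, scaleFn_of_mem _ (pullOn_mem (φ := ψ t) ha)]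
    | @dfn_mul i p a w ha hw ih =>
      convert (((isFamily_fieldOn hδ U a).isSmoothFamily.mul ih).smul ((-1) ^ (i + 1))).add
        ((hδ U a).isSmoothFamily_deriv.mul
          (isFamily_hom hδ U (Submodule.subset_span hw)).isSmoothFamily) using 2 with t
      simp [Variation.hom_dfn, Matrix.mul_apply, scaleFn_of_mem _ (fieldOn_mem (φ := ψ t) ha)]

/-- For closed `w` the summand `K_t Q_TM` of the homotopy formula drops out, so the derivative of
the local characteristic form is exact. -/
theorem isFamily_fiberHom (i : B.Index) {p : ℕ} {w : Form F.toGradedManifold ⊤}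
    (hw : w ∈ Form.deg F.toGradedManifold ⊤ p) (hQ : F.totalQ ⊤ w = 0) :
    IsFamily N.toGradedManifold (B.U i) (fun t => (ψ t).localChar i w)
      (fun t => N.Q _ ((δ t).fiberHom i (B.U i) le_rfl w 0 1)) := by
  have h := isFamily_hom hδ (B.U i) (Variation.pullFiberForm_mem i le_rfl hw)
  have h0 : M.totalQ _ ((B.τ i).pullFiberForm (le_refl (B.π.preimage (B.U i))) w) = 0 := by
    have := QManifold.totalQ_pullForm (B.isTrivialization i).isQMorphism
      (V := ⊤) (le_refl (B.π.preimage (B.U i))) (fun _ _ => trivial) hw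
    rw [hQ, map_zero] at this
    exact this
  simp only [h0, map_zero, Matrix.zero_apply, add_zero] at h
  simp only [← Variation.fiberHom_one_one (δ _) i hw]
  exact h

/-- The characteristic forms of the ends of a smooth family of gauge fields are cohomologous. -/
theorem sub_mem_coboundaries {p : ℕ} {w : Form F.toGradedManifold ⊤} (hw : w ∈ G.basicDeg p)
    (hQ : F.totalQ ⊤ w = 0) {c₀ c₁ : N.Fn ⊤} (h₀ : (ψ 0).IsCharacteristicForm w c₀)
    (h₁ : (ψ 1).IsCharacteristicForm w c₁) :
    c₁ - c₀ ∈ GradedComplex.coboundaries (N.deg ⊤) (N.Q ⊤) p := by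
  have hf := fun i => isFamily_fiberHom hδ i hw.1 hQ
  have hK := fun t i => (δ t).hom_entries (B.U i) (Variation.pullFiberForm_mem i le_rfl hw.1)
  cases p with
  | zero =>
    -- In degree zero the coboundaries are zero and `K_t w = 0`, so the characteristic form does not
    -- depend on `t`.
    refine sub_eq_zero.2 (h₁.unique fun i => ?_)
    have h : ∀ t, (δ t).fiberHom i (B.U i) le_rfl w 0 1 = 0 := fun t => (hK t i).2.2.2.1 rfl
    have := hf i
    simp only [h, map_zero] at this
    rw [h₀ i]
    exact this.eq_of_deriv_eq_zero 0 1
  | succ q =>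
    -- `E` is the primitive of `K_t w` near `x` that vanishes at `t = 0`. It is constructed where
    -- the family has an elementary expression, hence only locally.
    have hloc : ∀ x : N.Body, ∃ (i : B.Index) (V : Opens N.Body) (hV : V ≤ B.U i)
        (E : ℝ → N.Fn V), x ∈ V ∧ IsFamily N.toGradedManifold V E
          (fun t => N.res hV ((δ t).fiberHom i (B.U i) le_rfl w 0 1)) ∧ E 0 = 0 := fun x => by
      obtain ⟨i, hi⟩ := B.cover x
      obtain ⟨V, hV, c', hx, hc⟩ :=
        isSmoothFamily_hom hδ (B.U i) (Variation.pullFiberForm_mem i le_rfl hw.1) x hi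
      obtain ⟨E, hE, hE0⟩ := exists_antiderivative_elemFamilies hc
      exact ⟨i, V, hV, E, hx, IsFamily.of_mem hE, hE0⟩
    choose i V hV E hx hE hE0 using hloc
    obtain ⟨H, hH, hHV⟩ := exists_glue V (fun _ => le_top) (fun x _ => ⟨x, hx x⟩) q
      (fun x => E x 1)
      (fun x => (hE x).mem_deg (fun t => N.res_deg _ ((hK t (i x)).2.2.2.2 q rfl)) (hE0 x) 1)
      -- On overlaps the integrands agree, because the off-diagonal entries glue on basic forms.
      -- Both primitives start at zero, so they agree at `t = 1`.
      (fun x y => by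
        have h := ((hE x).restrict (inf_le_left : V x ⊓ V y ≤ V x)).sub
          ((hE y).restrict (inf_le_right : V x ⊓ V y ≤ V y))
        have hz : ∀ t, N.res (inf_le_left : V x ⊓ V y ≤ V x)
              (N.res (hV x) ((δ t).fiberHom (i x) (B.U (i x)) le_rfl w 0 1)) -
            N.res (inf_le_right : V x ⊓ V y ≤ V y)
              (N.res (hV y) ((δ t).fiberHom (i y) (B.U (i y)) le_rfl w 0 1)) = 0 := fun t => by
          have := congrArg (N.res (inf_le_inf (hV x) (hV y)))
            ((δ t).fiberHom_compat (i x) (i y) hw 0 1)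
          rw [N.res_res, N.res_res] at this
          rw [N.res_res, N.res_res, sub_eq_zero]
          exact this
        simp only [hz] at h
        have := h.eq_of_deriv_eq_zero 1 0
        rwa [hE0, hE0, map_zero, map_zero, sub_zero, sub_eq_zero] at this)
    refine ⟨H, hH, eq_of_local fun x _ => ⟨V x, le_top, hx x, ?_⟩⟩
    -- The local characteristic form minus `Q E` has derivative zero. Comparing `t = 1` with `t = 0`
    -- gives `c₁ - c₀ = Q H`.
    have h := ((hf (i x)).restrict (hV x)).sub ((hE x).map_derivation (N.isDerivation_Q _))
    simp only [N.Q_res, sub_self] at h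
    have h2 := h.eq_of_deriv_eq_zero 1 0
    rw [hE0, map_zero, sub_zero, ← h₁ (i x), ← h₀ (i x), N.res_res, N.res_res] at h2
    rw [← N.Q_res, hHV, map_sub, ← h2]
    abel

end

theorem Homotopic.characteristicMap_eq {φ₀ φ₁ : B.GaugeField} (h : φ₀.Homotopic φ₁) {p : ℕ}
    {χ₀ χ₁ : FiberCohomology G p →ₗ[ℝ] BaseCohomology N p} (h₀ : φ₀.IsCharacteristicMap p χ₀)
    (h₁ : φ₁.IsCharacteristicMap p χ₁) : χ₀ = χ₁ := by
  obtain ⟨Φ, rfl, rfl, -, hΦ⟩ := h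
  -- A smooth step with values in `[0, 1]` makes the family defined for all real parameters, with
  -- the same ends at `0` and `1`.
  obtain ⟨δ, hδ⟩ := exists_variation (ψ := fun t => Φ (Real.smoothTransition t)) fun U a => by
    obtain ⟨c', hc'⟩ := hΦ U a
    exact ⟨_, hc'.isFamily Real.smoothTransition.contDiff
      fun t => ⟨Real.smoothTransition.nonneg t, Real.smoothTransition.le_one t⟩⟩
  refine LinearMap.ext fun x => ?_
  obtain ⟨w, rfl⟩ := Submodule.mkQ_surjective _ x
  obtain ⟨c₀, hc₀, e₀⟩ := h₀ w
  obtain ⟨c₁, hc₁, e₁⟩ := h₁ w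
  refine e₀.trans (Eq.trans ?_ e₁.symm)
  refine ((Submodule.Quotient.eq _).2 ?_).symm
  exact sub_mem_coboundaries hδ w.2.1 w.2.2 (by simpa using hc₀) (by simpa using hc₁)

end QBundle.GaugeField

/-! ### Functions on a shifted Lie algebra -/

/-! ### Separating degrees by eigenvalues -/

section Eigenspaces

variable {V : Type*} [AddCommGroup V] [Module ℝ V] {f : Module.End ℝ V} {Y : ℕ → Submodule ℝ V}
  {μ : ℕ → ℝ}

/-- Eigenspaces for different eigenvalues are independent, so the components with other eigenvalues
vanish. With `f` the scaling by two, this turns a spanning statement into a description of each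
degree. -/
theorem Module.End.mem_of_mem_iSup_of_mem_eigenspace (hY : ∀ q, Y q ≤ f.eigenspace (μ q))
    (hμ : Function.Injective μ) {w : V} (hw : w ∈ ⨆ q, Y q) {q : ℕ}
    (hwq : w ∈ f.eigenspace (μ q)) : w ∈ Y q := by
  have hle : ⨆ q, Y q ≤ Y q ⊔ ⨆ ν, ⨆ (_ : ν ≠ μ q), f.eigenspace ν := by
    refine iSup_le fun q' => ?_
    by_cases h : q' = q
    · exact h ▸ le_sup_left
    · exact le_sup_of_le_right (le_iSup₂_of_le (μ q') (fun h' => h (hμ h')) (hY q'))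
  obtain ⟨y, hy, z, hz, rfl⟩ := Submodule.mem_sup.1 (hle hw)
  have hz' : z ∈ f.eigenspace (μ q) := by
    have := Submodule.sub_mem _ hwq (hY q hy)
    rwa [add_sub_cancel_left] at this
  have : z = 0 := (Submodule.disjoint_def.1 (f.eigenspaces_iSupIndep (μ q))) z hz' hz
  rwa [this, add_zero]

theorem Module.End.eq_zero_of_mem_iSup_of_mem_eigenspace (hY : ∀ q, Y q ≤ f.eigenspace (μ q))
    {w : V} (hw : w ∈ ⨆ q, Y q) {ν : ℝ} (hν : ∀ q, μ q ≠ ν) (hwν : w ∈ f.eigenspace ν) :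
    w = 0 :=
  Submodule.disjoint_def.1 (f.eigenspaces_iSupIndep ν) w hwν
    ((iSup_le fun q => le_iSup₂_of_le (μ q) (hν q) (hY q) :
      ⨆ q, Y q ≤ ⨆ ν', ⨆ (_ : ν' ≠ ν), f.eigenspace ν') hw)

end Eigenspaces

namespace IsShiftedLieAlgebra

variable {F : QManifold.{u}} {𝔤 : Type*} [AddCommGroup 𝔤] [Module ℝ 𝔤] [Bracket 𝔤 𝔤] {r : ℕ}
  {e : Module.Basis (Fin r) ℝ 𝔤} {ξ : Module.Dual ℝ 𝔤 →ₗ[ℝ] F.Fn ⊤}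

omit [Bracket 𝔤 𝔤] in
theorem linear_eq (e : Module.Basis (Fin r) ℝ 𝔤) (ξ : Module.Dual ℝ 𝔤 →ₗ[ℝ] F.Fn ⊤)
    (α : Module.Dual ℝ 𝔤) : ξ α = ∑ a, α (e a) • ξ (e.coord a) := by
  conv_lhs => rw [← e.sum_dual_apply_smul_coord α]
  simp only [map_sum, map_smul]

variable (h : IsShiftedLieAlgebra F e ξ)

include h

theorem linear_mem (α : Module.Dual ℝ 𝔤) : ξ α ∈ F.deg ⊤ 1 := by
  rw [linear_eq e ξ]
  exact Submodule.sum_mem _ fun a _ => Submodule.smul_mem _ _ (h.generating.mem a)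

theorem smooth_const (f : F.Smooth ⊤) : ∃ t : ℝ, f = algebraMap ℝ (F.Smooth ⊤) t := by
  obtain ⟨x, hx, hu⟩ := h.point
  refine ⟨f ⟨x, hx⟩, ?_⟩
  ext ⟨y, hy⟩
  obtain rfl := hu y hy
  rfl

theorem linear_sq (α : Module.Dual ℝ 𝔤) : ξ α * ξ α = 0 := by
  have h1 := F.comm (h.linear_mem α) (h.linear_mem α)
  have h2 : (2 : ℝ) • (ξ α * ξ α) = 0 := by
    rw [two_smul]
    nth_rewrite 1 [h1]
    simp
  exact (smul_eq_zero.1 h2).resolve_left (by norm_num)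

/-- The functions are a quotient of the exterior algebra. -/
noncomputable def ofExterior : ExteriorAlgebra ℝ (Module.Dual ℝ 𝔤) →ₐ[ℝ] F.Fn ⊤ :=
  ExteriorAlgebra.lift ℝ ⟨ξ, h.linear_sq⟩

theorem ofExterior_ι (α : Module.Dual ℝ 𝔤) : h.ofExterior (ExteriorAlgebra.ι ℝ α) = ξ α :=
  ExteriorAlgebra.lift_ι_apply _ _ _ _

theorem ofExterior_surjective : Function.Surjective h.ofExterior := by
  intro a
  obtain ⟨c, hc, -⟩ := h.generating.existsUnique ⊤ le_rfl a
  change a ∈ h.ofExterior.range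
  rw [hc]
  refine Subalgebra.sum_mem _ fun μ _ => Subalgebra.mul_mem _ ?_ ?_
  · obtain ⟨t, ht⟩ := h.smooth_const (c μ)
    rw [ht, AlgHom.commutes]
    exact Subalgebra.algebraMap_mem _ t
  · rw [F.res_self]
    refine Subalgebra.list_prod_mem _ fun x hx => ?_
    obtain ⟨j, rfl⟩ := List.mem_ofFn.1 hx
    exact Subalgebra.pow_mem _ ((AlgHom.mem_range _).2 ⟨_, h.ofExterior_ι _⟩) _

/-- The functions have a basis of monomials. -/
theorem finrank_eq : Module.Finite ℝ (F.Fn ⊤) ∧ Module.finrank ℝ (F.Fn ⊤) = 2 ^ r := by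
  obtain ⟨T, -, -⟩ := exists_coefficients h.generating le_rfl
  obtain ⟨x, hx, hu⟩ := h.point
  let S : ℝ ≃ₗ[ℝ] F.Smooth ⊤ := LinearEquiv.ofBijective (Algebra.linearMap ℝ (F.Smooth ⊤))
    ⟨fun s t hst => congrArg (fun f : F.Smooth ⊤ => f ⟨x, hx⟩) hst, fun f => by
      obtain ⟨t, ht⟩ := h.smooth_const f
      exact ⟨t, ht.symm⟩⟩
  -- All generators are odd, so their exponents are zero or one, and there are `2 ^ r` monomials.
  let E : GradedSpace.Exponent (fun _ : Fin r => 1) ≃ (Fin r → Fin 2) :=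
    { toFun := fun μ j => ⟨μ.1 j, Nat.lt_succ_of_le (μ.2 j odd_one)⟩
      invFun := fun ν => ⟨fun j => ν j, fun j _ => Nat.le_of_lt_succ (ν j).2⟩
      left_inv := fun μ => rfl
      right_inv := fun ν => rfl }
  let T' : ((Fin r → Fin 2) →₀ ℝ) ≃ₗ[ℝ] F.Fn ⊤ :=
    (Finsupp.lcongr E.symm S).trans T
  refine ⟨Module.Finite.equiv T', ?_⟩
  rw [← T'.finrank_eq, Module.finrank_finsupp_self]
  simp

/-- A surjection between spaces of the same finite dimension `2 ^ r`. The contractions of the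
exterior algebra become available on functions. -/
theorem ofExterior_bijective : Function.Bijective h.ofExterior := by
  refine ⟨?_, h.ofExterior_surjective⟩
  have := h.finrank_eq.1
  have b := e.dualBasis.ExteriorAlgebra
  have : Module.Finite ℝ (ExteriorAlgebra ℝ (Module.Dual ℝ 𝔤)) := Module.Finite.of_basis b
  refine (LinearMap.injective_iff_surjective_of_finrank_eq_finrank
    (f := h.ofExterior.toLinearMap) ?_).2 h.ofExterior_surjective
  rw [h.finrank_eq.2, Module.finrank_eq_card_basis b]
  simp

/-- The functions are the exterior algebra of the dual of the Lie algebra. -/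
noncomputable def exteriorEquiv : ExteriorAlgebra ℝ (Module.Dual ℝ 𝔤) ≃ₐ[ℝ] F.Fn ⊤ :=
  AlgEquiv.ofBijective h.ofExterior h.ofExterior_bijective

theorem exteriorEquiv_ι_mul (α : Module.Dual ℝ 𝔤) (x : ExteriorAlgebra ℝ (Module.Dual ℝ 𝔤)) :
    h.exteriorEquiv (ExteriorAlgebra.ι ℝ α * x) = ξ α * h.exteriorEquiv x := by
  rw [map_mul]
  exact congrArg (· * _) (h.ofExterior_ι α)

@[elab_as_elim]
theorem fn_induction {p : F.Fn ⊤ → Prop} (algebraMap : ∀ t : ℝ, p (algebraMap ℝ _ t))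
    (add : ∀ a b, p a → p b → p (a + b)) (linear_mul : ∀ α a, p a → p (ξ α * a)) (a : F.Fn ⊤) :
    p a := by
  obtain ⟨x, rfl⟩ := h.exteriorEquiv.surjective a
  induction x using CliffordAlgebra.left_induction with
  | algebraMap t => simpa using algebraMap t
  | add x y hx hy => simpa using add _ _ hx hy
  | ι_mul x α hx =>
    have := linear_mul α _ hx
    rwa [← h.exteriorEquiv_ι_mul] at this

theorem pow_le_deg (i : ℕ) : LinearMap.range ξ ^ i ≤ F.deg ⊤ i := by
  induction i with
  | zero =>
    rw [pow_zero, Submodule.one_le]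
    exact SetLike.GradedOne.one_mem
  | succ i ih =>
    rw [pow_succ]
    refine Submodule.mul_le.2 fun a ha b hb => ?_
    obtain ⟨α, rfl⟩ := hb
    exact SetLike.GradedMul.mul_mem (ih ha) (h.linear_mem α)

/-- The powers of the space of linear functions together span all functions and lie in the expected
degrees; scaling by two then separates them. -/
theorem deg_eq_pow (i : ℕ) : F.deg ⊤ i = LinearMap.range ξ ^ i := by
  refine le_antisymm (fun a ha => ?_) (h.pow_le_deg i)
  refine Module.End.mem_of_mem_iSup_of_mem_eigenspace (f := (scaleFn ⊤ 2).toLinearMap)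
    (μ := fun q => 2 ^ q) (fun q b hb => ?_) (pow_right_injective₀ two_pos (by norm_num)) ?_ ?_
  · exact Module.End.mem_eigenspace_iff.2 (scaleFn_of_mem 2 (h.pow_le_deg q hb))
  · clear ha
    induction a using h.fn_induction with
    | algebraMap t =>
      refine Submodule.mem_iSup_of_mem 0 ?_
      rw [pow_zero]
      exact Submodule.algebraMap_mem t
    | add a b ha hb => exact Submodule.add_mem _ ha hb
    | linear_mul α a ha =>
      have : ⨆ q, LinearMap.range ξ ^ q ≤
          (⨆ q, LinearMap.range ξ ^ q).comap (LinearMap.mulLeft ℝ (ξ α)) := by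
        refine iSup_le fun q b hb => Submodule.mem_iSup_of_mem (q + 1) ?_
        rw [pow_succ']
        exact Submodule.mul_mem_mul ⟨α, rfl⟩ hb
      exact this ha
  · exact Module.End.mem_eigenspace_iff.2 (scaleFn_of_mem 2 ha)

/-- Induction over homogeneous functions. -/
@[elab_as_elim]
theorem deg_induction {p : ∀ (i : ℕ) (a : F.Fn ⊤), a ∈ F.deg ⊤ i → Prop}
    (one : p 0 1 SetLike.GradedOne.one_mem)
    (add : ∀ i a b ha hb, p i a ha → p i b hb → p i (a + b) (Submodule.add_mem _ ha hb))
    (smul : ∀ i (t : ℝ) a ha, p i a ha → p i (t • a) (Submodule.smul_mem _ t ha))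
    (linear_mul : ∀ i α a (ha : a ∈ F.deg ⊤ i), p i a ha → p (i + 1) (ξ α * a)
      (by rw [add_comm]; exact SetLike.GradedMul.mul_mem (h.linear_mem α) ha))
    {i : ℕ} {a : F.Fn ⊤} (ha : a ∈ F.deg ⊤ i) : p i a ha := by
  induction i generalizing a with
  | zero =>
    obtain ⟨f, hf⟩ := F.mem_deg_zero.1 ha
    obtain ⟨t, rfl⟩ := h.smooth_const f
    rw [AlgHom.commutes, Algebra.algebraMap_eq_smul_one] at hf
    subst hf
    exact smul _ _ _ _ one
  | succ i ih =>
    have ha' := ha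
    rw [h.deg_eq_pow, pow_succ'] at ha'
    suffices ∃ hb, p (i + 1) a hb from this.choose_spec
    clear ha
    induction ha' using Submodule.mul_induction_on' with
    | mem_mul_mem x hx y hy =>
      obtain ⟨α, rfl⟩ := hx
      rw [← h.deg_eq_pow] at hy
      exact ⟨_, linear_mul _ _ _ hy (ih hy)⟩
    | add x _ y _ hx hy =>
      obtain ⟨_, hx⟩ := hx
      obtain ⟨_, hy⟩ := hy
      exact ⟨_, add _ _ _ _ _ hx hy⟩

/-- The contraction with an element of the Lie algebra. -/
noncomputable def contraction (ε : 𝔤) : F.Fn ⊤ →ₗ[ℝ] F.Fn ⊤ :=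
  h.exteriorEquiv.toLinearMap ∘ₗ
    (CliffordAlgebra.contractLeft (Q := (0 : QuadraticForm ℝ (Module.Dual ℝ 𝔤)))
      (Module.Dual.eval ℝ 𝔤 ε)) ∘ₗ h.exteriorEquiv.symm.toLinearMap

theorem contraction_linear_mul (ε : 𝔤) (α : Module.Dual ℝ 𝔤) (a : F.Fn ⊤) :
    h.contraction ε (ξ α * a) = α ε • a - ξ α * h.contraction ε a := by
  obtain ⟨x, rfl⟩ := h.exteriorEquiv.surjective a
  rw [← h.exteriorEquiv_ι_mul]
  simp only [contraction, LinearMap.comp_apply, AlgEquiv.toLinearMap_apply,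
    AlgEquiv.symm_apply_apply]
  rw [← h.exteriorEquiv_ι_mul]
  have := CliffordAlgebra.contractLeft_ι_mul (Q := (0 : QuadraticForm ℝ (Module.Dual ℝ 𝔤)))
    (Module.Dual.eval ℝ 𝔤 ε) α x
  refine (congrArg h.exteriorEquiv this).trans ?_
  rw [map_sub, map_smul]
  rfl

theorem contraction_one (ε : 𝔤) : h.contraction ε 1 = 0 := by
  simp only [contraction, LinearMap.comp_apply, AlgEquiv.toLinearMap_apply, map_one]
  exact (congrArg h.exteriorEquiv (CliffordAlgebra.contractLeft_one _ _)).trans (map_zero _)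

theorem contraction_linear (ε : 𝔤) (α : Module.Dual ℝ 𝔤) :
    h.contraction ε (ξ α) = algebraMap ℝ _ (α ε) := by
  have := h.contraction_linear_mul ε α 1
  rwa [mul_one, h.contraction_one, mul_zero, sub_zero, ← Algebra.algebraMap_eq_smul_one] at this

theorem isDerivation_contraction (ε : 𝔤) : F.IsDerivation ⊤ (-1) (h.contraction ε) where
  map_deg {i j} hij a ha := by
    have key : ∀ k, i = k + 1 → h.contraction ε a ∈ F.deg ⊤ k := by
      clear hij
      induction ha using h.deg_induction with
      | one => intro k hk; omega
      | add i a b _ _ ha hb => intro k hk; rw [map_add]; exact Submodule.add_mem _ (ha k hk) (hb k hk)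
      | smul i t a _ ha => intro k hk; rw [map_smul]; exact Submodule.smul_mem _ _ (ha k hk)
      | linear_mul i α a ha ih =>
        intro k hk
        obtain rfl : i = k := by omega
        rw [h.contraction_linear_mul]
        refine Submodule.sub_mem _ (Submodule.smul_mem _ _ ha) ?_
        -- A constant has contraction zero, and the predecessor degree required by `ih` does not
        -- exist, so this case is separate.
        cases i with
        | zero =>
          obtain ⟨f, rfl⟩ := F.mem_deg_zero.1 ha
          obtain ⟨t, rfl⟩ := h.smooth_const f
          rw [AlgHom.commutes, Algebra.algebraMap_eq_smul_one, map_smul, h.contraction_one,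
            smul_zero, mul_zero]
          exact Submodule.zero_mem _
        | succ k =>
          have := SetLike.GradedMul.mul_mem (h.linear_mem α) (ih k rfl)
          rwa [add_comm] at this
    exact key j (by omega)
  map_neg {i} hi a ha := by
    obtain rfl : i = 0 := by omega
    obtain ⟨f, rfl⟩ := F.mem_deg_zero.1 ha
    obtain ⟨t, rfl⟩ := h.smooth_const f
    rw [AlgHom.commutes, Algebra.algebraMap_eq_smul_one, map_smul, h.contraction_one, smul_zero]
  leibniz {i a} ha b := by
    have e : (-1 : ℝ) ^ (-1 * (i : ℤ)) = (-1) ^ i := by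
      rw [← zpow_natCast]
      exact Form.neg_one_zpow_congr ⟨0, by ring⟩
    rw [e]
    clear e
    induction ha using h.deg_induction with
    | one => simp [h.contraction_one]
    | add i a a' _ _ ha ha' => simp only [add_mul, map_add, ha, ha', smul_add]; abel
    | smul i t a _ ha => simp only [smul_mul_assoc, map_smul, ha, smul_add, smul_comm t]
    | linear_mul i α a ha ih =>
      rw [mul_assoc, h.contraction_linear_mul, ih, h.contraction_linear_mul]
      simp only [mul_add, sub_mul, smul_mul_assoc, mul_smul_comm, pow_succ, mul_assoc]
      module

/-- Evaluation at the origin. -/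
noncomputable def augmentation : F.Fn ⊤ →ₐ[ℝ] ℝ :=
  ExteriorAlgebra.algebraMapInv.comp h.exteriorEquiv.symm.toAlgHom

theorem augmentation_linear (α : Module.Dual ℝ 𝔤) : h.augmentation (ξ α) = 0 := by
  have : h.exteriorEquiv.symm (ξ α) = ExteriorAlgebra.ι ℝ α := by
    rw [AlgEquiv.symm_apply_eq]
    exact (h.ofExterior_ι α).symm
  rw [augmentation, AlgHom.comp_apply]
  refine (congrArg ExteriorAlgebra.algebraMapInv this).trans ?_
  simp [ExteriorAlgebra.algebraMapInv]

theorem augmentation_eq_zero {i : ℕ} (hi : i ≠ 0) {a : F.Fn ⊤} (ha : a ∈ F.deg ⊤ i) :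
    h.augmentation a = 0 := by
  induction ha using h.deg_induction with
  | one => exact absurd rfl hi
  | add i a b _ _ ha hb => rw [map_add, ha hi, hb hi, add_zero]
  | smul i t a _ ha => rw [map_smul, ha hi, smul_zero]
  | linear_mul i α a _ _ => rw [map_mul, h.augmentation_linear, zero_mul]

/-- The linear part of a function, as a polynomial. -/
noncomputable def linearPart : F.Fn ⊤ →ₗ[ℝ] MvPolynomial (Fin r) ℝ :=
  ∑ k, (LinearMap.toSpanSingleton ℝ (MvPolynomial (Fin r) ℝ) (MvPolynomial.X k)) ∘ₗ
    h.augmentation.toLinearMap ∘ₗ h.contraction (e k)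

theorem linearPart_apply (a : F.Fn ⊤) :
    h.linearPart a = ∑ k, h.augmentation (h.contraction (e k) a) • MvPolynomial.X k := by
  simp [linearPart]

theorem linearPart_eq_zero {i : ℕ} (hi : i ≠ 1) {a : F.Fn ⊤} (ha : a ∈ F.deg ⊤ i) :
    h.linearPart a = 0 := by
  rw [linearPart_apply]
  refine Finset.sum_eq_zero fun k _ => ?_
  cases i with
  | zero => rw [(h.isDerivation_contraction (e k)).map_neg (by simp) ha, map_zero, zero_smul]
  | succ i =>
    rw [h.augmentation_eq_zero (by omega : i ≠ 0)
      ((h.isDerivation_contraction (e k)).map_deg (by push_cast; ring) ha), zero_smul]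

/-- These data set `ξ = 0` and send `dξ^a` to a variable. The augmentation lives in degree zero and
the linear part in degree one. The commutation relations are thus nontrivial only where the signs
are `+1`, and a commutative target is consistent. -/
theorem polynomialLiftData :
    Form.LiftData ((Algebra.ofId ℝ (MvPolynomial (Fin r) ℝ)).comp h.augmentation) h.linearPart where
  leibniz {i a} ha b := by
    have hi : (-1 : ℝ) ^ (-1 * (i : ℤ)) = (-1) ^ i := by
      rw [← zpow_natCast]
      exact Form.neg_one_zpow_congr ⟨0, by ring⟩
    simp only [linearPart_apply, (h.isDerivation_contraction _).leibniz ha, hi, map_add, map_smul,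
      map_mul, add_smul, Finset.sum_add_distrib, AlgHom.comp_apply, Algebra.ofId_apply,
      Finset.sum_mul, Finset.mul_sum, Finset.smul_sum]
    congr 1
    · refine Finset.sum_congr rfl fun k _ => ?_
      rw [mul_comm _ (algebraMap _ _ _), ← Algebra.smul_def, smul_smul, mul_comm]
    · refine Finset.sum_congr rfl fun k _ => ?_
      rw [← Algebra.smul_def, smul_smul, smul_smul, smul_eq_mul]
      ring_nf
  comm {i j a b} ha hb := by
    by_cases hi : i = 0
    · subst hi; simp [mul_comm]
    · simp [h.augmentation_eq_zero hi ha]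
  comm' {i j a b} ha hb := by
    by_cases hi : i = 1
    · by_cases hj : j = 1
      · subst hi hj; norm_num [mul_comm]
      · simp [h.linearPart_eq_zero hj hb]
    · simp [h.linearPart_eq_zero hi ha]
  chain g hg f := by
    simp [h.linearPart_eq_zero zero_ne_one (ofSmooth_mem_deg_zero _)]

/-- The part of a form that is constant along the odd directions, as a polynomial. -/
noncomputable def toPolynomial : Form F.toGradedManifold ⊤ →ₐ[ℝ] MvPolynomial (Fin r) ℝ :=
  Form.lift h.polynomialLiftData

theorem toPolynomial_dfn (a : Fin r) :
    h.toPolynomial (Form.dfn (ξ (e.coord a))) = MvPolynomial.X a := by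
  rw [toPolynomial, Form.lift_dfn, linearPart_apply]
  simp [h.contraction_linear, Finsupp.single_apply, ite_smul]

end IsShiftedLieAlgebra

/-! ### Invariant polynomials -/

section Polynomials

variable {𝔤 : Type*} [AddCommGroup 𝔤] [Module ℝ 𝔤] {r q : ℕ} (e : Module.Basis (Fin r) ℝ 𝔤)
  {R : Type*} [Ring R] [Algebra ℝ R]

theorem evalPolynomial_map {R' : Type*} [Ring R'] [Algebra ℝ R'] (f : R →ₐ[ℝ] R')
    (w : MultilinearMap ℝ (fun _ : Fin q => 𝔤) ℝ) (z : Fin r → R) :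
    f (evalPolynomial e w z) = evalPolynomial e w fun a => f (z a) := by
  simp only [evalPolynomial, map_smul, map_sum, map_list_prod, List.map_ofFn]
  rfl

/-- A symmetric multilinear form is determined by its polynomial. -/
theorem eq_of_evalPolynomial_X {w w' : MultilinearMap ℝ (fun _ : Fin q => 𝔤) ℝ}
    (hw : ∀ (σ : Equiv.Perm (Fin q)) (v : Fin q → 𝔤), w (fun k => v (σ k)) = w v)
    (hw' : ∀ (σ : Equiv.Perm (Fin q)) (v : Fin q → 𝔤), w' (fun k => v (σ k)) = w' v)
    (h : evalPolynomial e w (MvPolynomial.X (R := ℝ)) = evalPolynomial e w' MvPolynomial.X) :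
    w = w' := by
  classical
  refine Module.Basis.ext_multilinear (fun _ => e) fun a₀ => ?_
  let m : (Fin q → Fin r) → (Fin r →₀ ℕ) := fun a => ∑ k, Finsupp.single (a k) 1
  have hX : ∀ a : Fin q → Fin r, (List.ofFn fun k => (MvPolynomial.X (a k) :
      MvPolynomial (Fin r) ℝ)).prod = MvPolynomial.monomial (m a) 1 := fun a => by
    rw [List.prod_ofFn, MvPolynomial.monomial_sum_one]
    rfl
  -- Equal exponents mean fibres of equal size over every index; bijections between the fibres
  -- assemble to a permutation.
  have hm : ∀ a, m a = m a₀ → ∃ σ : Equiv.Perm (Fin q), ∀ k, a k = a₀ (σ k) := fun a ha => by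
    have hc : ∀ c, Fintype.card {k // a k = c} = Fintype.card {k // a₀ k = c} := fun c => by
      have := DFunLike.congr_fun ha c
      simpa [m, Finsupp.single_apply, Finset.sum_boole, Fintype.card_subtype] using this
    let E := fun c => Fintype.equivOfCardEq (hc c)
    exact ⟨Equiv.ofFiberEquiv E, fun k => (Equiv.ofFiberEquiv_map E k).symm⟩
  -- By symmetry all sequences with the same monomial contribute the same value, so the coefficient
  -- is a nonzero multiple of `w` at `a₀`, with a factor independent of `w`.
  have hcoeff : ∀ {w : MultilinearMap ℝ (fun _ : Fin q => 𝔤) ℝ},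
      (∀ (σ : Equiv.Perm (Fin q)) (v : Fin q → 𝔤), w (fun k => v (σ k)) = w v) →
      (evalPolynomial e w (MvPolynomial.X (R := ℝ))).coeff (m a₀) = (1 / (q.factorial : ℝ)) *
        ((Finset.univ.filter fun a => m a = m a₀).card * w fun k => e (a₀ k)) := fun {w} hw => by
    rw [evalPolynomial, MvPolynomial.coeff_smul, MvPolynomial.coeff_sum, smul_eq_mul]
    congr 1
    simp only [MvPolynomial.coeff_smul, hX, MvPolynomial.coeff_monomial, smul_eq_mul, mul_ite,
      mul_one, mul_zero]
    rw [← Finset.sum_filter, Finset.sum_congr rfl fun a ha => ?_, Finset.sum_const, nsmul_eq_mul]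
    obtain ⟨σ, hσ⟩ := hm a (Finset.mem_filter.1 ha).2
    simp only [hσ]
    exact hw σ fun k => e (a₀ k)
  have h1 := congrArg (MvPolynomial.coeff (m a₀)) h
  rw [hcoeff hw, hcoeff hw'] at h1
  have hq : (1 / (q.factorial : ℝ)) ≠ 0 := by positivity
  have hcard : ((Finset.univ.filter fun a => m a = m a₀).card : ℝ) ≠ 0 :=
    Nat.cast_ne_zero.2 (Finset.card_ne_zero_of_mem (Finset.mem_filter.2 ⟨Finset.mem_univ a₀, rfl⟩))
  exact mul_left_cancel₀ hcard (mul_left_cancel₀ hq h1)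

/-- Combinations of products of commuting elements are values of symmetric multilinear forms. -/
theorem exists_evalPolynomial (z : Fin r → R) (hz : ∀ a b, Commute (z a) (z b))
    (c : (Fin q → Fin r) → ℝ) : ∃ w : MultilinearMap ℝ (fun _ : Fin q => 𝔤) ℝ,
      (∀ (σ : Equiv.Perm (Fin q)) (v : Fin q → 𝔤), w (fun k => v (σ k)) = w v) ∧
      ∑ a, c a • (List.ofFn fun k => z (a k)).prod = evalPolynomial e w z := by
  classical
  -- Symmetrised coefficients. The products do not change under permutations, so the sum is
  -- multiplied by `q!`, which the factor in `evalPolynomial` undoes.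
  let C : (Fin q → Fin r) → ℝ := fun a => ∑ σ : Equiv.Perm (Fin q), c (a ∘ σ)
  let w : MultilinearMap ℝ (fun _ : Fin q => 𝔤) ℝ :=
    ∑ a, C a • (MultilinearMap.mkPiAlgebra ℝ (Fin q) ℝ).compLinearMap fun k => e.coord (a k)
  have hw : ∀ v, w v = ∑ a, C a * ∏ k, e.coord (a k) (v k) := fun v => by
    simp [w]
  have hC : ∀ a (σ : Equiv.Perm (Fin q)), C (a ∘ σ) = C a := fun a σ =>
    Fintype.sum_equiv (Equiv.mulLeft σ) _ _ fun τ => rfl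
  have hprod : ∀ (a : Fin q → Fin r) (σ : Equiv.Perm (Fin q)),
      (List.ofFn fun k => z (a (σ k))).prod = (List.ofFn fun k => z (a k)).prod := fun a σ => by
    refine List.Perm.prod_eq' (Equiv.Perm.ofFn_comp_perm σ fun k => z (a k)) ?_
    rw [List.pairwise_iff_forall_sublist]
    intro x y hxy
    have hx := hxy.subset (List.mem_cons_self)
    have hy := hxy.subset (List.mem_cons_of_mem _ (List.mem_singleton.2 rfl))
    obtain ⟨i, rfl⟩ := List.mem_ofFn.1 hx
    obtain ⟨j, rfl⟩ := List.mem_ofFn.1 hy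
    exact hz _ _
  refine ⟨w, fun σ v => ?_, ?_⟩
  · rw [hw, hw]
    refine Fintype.sum_equiv (Equiv.arrowCongr σ (Equiv.refl _)) _ _ fun a => ?_
    have h1 : (Equiv.arrowCongr σ (Equiv.refl (Fin r))) a = a ∘ σ.symm := rfl
    rw [h1, hC]
    congr 1
    refine Fintype.prod_equiv σ _ _ fun k => ?_
    simp
  · have hwe : ∀ a : Fin q → Fin r, w (fun k => e (a k)) = C a := fun a => by
      rw [hw, Finset.sum_eq_single a]
      · simp
      · intro b _ hb
        obtain ⟨k, hk⟩ := Function.ne_iff.1 hb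
        rw [Finset.prod_eq_zero (Finset.mem_univ k), mul_zero]
        simp [Ne.symm hk]
      · simp
    have hσ : ∀ σ : Equiv.Perm (Fin q), ∑ a : Fin q → Fin r, c (a ∘ σ) •
        (List.ofFn fun k => z (a k)).prod = ∑ a, c a • (List.ofFn fun k => z (a k)).prod := fun σ => by
      refine Fintype.sum_equiv (Equiv.arrowCongr σ.symm (Equiv.refl _)) _ _ fun a => ?_
      have h1 : (Equiv.arrowCongr σ.symm (Equiv.refl (Fin r))) a = a ∘ σ := rfl
      rw [h1]
      congr 1
      exact (hprod a σ).symm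
    rw [evalPolynomial]
    simp only [hwe, C, Finset.sum_smul]
    rw [Finset.sum_comm]
    simp only [hσ, Finset.sum_const, Finset.card_univ, Fintype.card_perm, Fintype.card_fin]
    rw [← Nat.cast_smul_eq_nsmul ℝ, smul_smul, one_div, inv_mul_cancel₀ (by positivity), one_smul]

/-- The infinitesimal action of an endomorphism on multilinear forms. -/
noncomputable def infinitesimalAction (B : 𝔤 →ₗ[ℝ] 𝔤)
    (w : MultilinearMap ℝ (fun _ : Fin q => 𝔤) ℝ) : MultilinearMap ℝ (fun _ : Fin q => 𝔤) ℝ :=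
  ∑ k, w.compLinearMap (Function.update (fun _ => LinearMap.id) k B)

theorem infinitesimalAction_apply (B : 𝔤 →ₗ[ℝ] 𝔤) (w : MultilinearMap ℝ (fun _ : Fin q => 𝔤) ℝ)
    (v : Fin q → 𝔤) :
    infinitesimalAction B w v = ∑ k, w (Function.update v k (B (v k))) := by
  rw [infinitesimalAction, sum_apply]
  refine Finset.sum_congr rfl fun k _ => ?_
  rw [MultilinearMap.compLinearMap_apply]
  congr 1
  ext j
  by_cases hj : j = k
  · subst hj; simp
  · simp [hj]

theorem infinitesimalAction_symm (B : 𝔤 →ₗ[ℝ] 𝔤) {w : MultilinearMap ℝ (fun _ : Fin q => 𝔤) ℝ}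
    (hw : ∀ (σ : Equiv.Perm (Fin q)) (v : Fin q → 𝔤), w (fun k => v (σ k)) = w v)
    (σ : Equiv.Perm (Fin q)) (v : Fin q → 𝔤) :
    infinitesimalAction B w (fun k => v (σ k)) = infinitesimalAction B w v := by
  rw [infinitesimalAction_apply, infinitesimalAction_apply]
  refine Fintype.sum_equiv σ _ _ fun k => ?_
  refine Eq.trans ?_ (hw σ _)
  congr 1
  ext j
  by_cases hj : j = k
  · subst hj; simp
  · simp [hj]

/-- The transposed endomorphism acts on the arguments of the dual variables. -/
theorem sum_smul_update (B : 𝔤 →ₗ[ℝ] 𝔤) (w : MultilinearMap ℝ (fun _ : Fin q => 𝔤) ℝ)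
    (P : MultilinearMap ℝ (fun _ : Fin q => Module.Dual ℝ 𝔤) R) (k : Fin q) :
    ∑ a : Fin q → Fin r, w (fun j => e (a j)) •
        P (Function.update (fun j => e.coord (a j)) k ((e.coord (a k)).comp B)) =
      ∑ a : Fin q → Fin r, w (Function.update (fun j => e (a j)) k (B (e (a k)))) •
        P (fun j => e.coord (a j)) := by
  have h1 : ∀ c, (e.coord c).comp B = ∑ b, e.coord c (B (e b)) • e.coord b := fun c =>
    (e.sum_dual_apply_smul_coord ((e.coord c).comp B)).symm
  have h2 : ∀ c, B (e c) = ∑ b, e.coord b (B (e c)) • e b := fun c => (e.sum_repr (B (e c))).symm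
  have h3 : ∀ (a : Fin q → Fin r) b, Function.update (fun j => e.coord (a j)) k (e.coord b) =
      fun j => e.coord (Function.update a k b j) := fun a b => by
    ext j : 1
    by_cases hj : j = k
    · subst hj; simp
    · simp [hj]
  have h4 : ∀ (a : Fin q → Fin r) b, Function.update (fun j => e (a j)) k (e b) =
      fun j => e (Function.update a k b j) := fun a b => by
    ext j : 1
    by_cases hj : j = k
    · subst hj; simp
    · simp [hj]
  conv_lhs => simp only [h1, MultilinearMap.map_update_sum, MultilinearMap.map_update_smul, h3,
    Finset.smul_sum]
  have h5 : ∀ a : Fin q → Fin r, w (Function.update (fun j => e (a j)) k (B (e (a k)))) =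
      ∑ b, e.coord b (B (e (a k))) • w fun j => e (Function.update a k b j) := fun a => by
    conv_lhs => rw [h2 (a k)]
    simp only [MultilinearMap.map_update_sum, MultilinearMap.map_update_smul, h4]
  simp only [h5, Finset.sum_smul]
  rw [← Fintype.sum_prod_type', ← Fintype.sum_prod_type']
  -- Both sides carry the same matrix entries of `B`; exchanging `a k` with the extra summation
  -- index matches them.
  let E : (Fin q → Fin r) × Fin r ≃ (Fin q → Fin r) × Fin r :=
    Function.Involutive.toPerm (fun p => (Function.update p.1 k p.2, p.1 k)) fun p => by simp
  refine Fintype.sum_equiv E _ _ fun p => ?_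
  simp [E, Function.Involutive.toPerm, smul_smul, mul_comm]

/-- The effect of a derivation on products. -/
theorem derivation_list_prod {V : Type*} [AddCommGroup V] [Module ℝ V] (Y : V →ₗ[ℝ] R)
    (A : V →ₗ[ℝ] V) (D : R →ₗ[ℝ] R) (hD : D 1 = 0)
    (hY : ∀ α w, D (Y α * w) = Y (A α) * w + Y α * D w) (α : Fin q → V) :
    D (List.ofFn fun k => Y (α k)).prod =
      ∑ k, (List.ofFn fun j => Y (Function.update α k (A (α k)) j)).prod := by
  induction q with
  | zero => simpa using hD
  | succ q ih =>
    rw [List.ofFn_succ, List.prod_cons, hY, ih, Fin.sum_univ_succ, Finset.mul_sum]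
    congr 1
    · simp [List.ofFn_succ]
    · refine Finset.sum_congr rfl fun k _ => ?_
      rw [List.ofFn_succ, List.prod_cons, Function.update_of_ne (Fin.succ_ne_zero k).symm]
      congr 3
      ext j
      rcases eq_or_ne j k with rfl | hj
      · simp
      · rw [Function.update_of_ne hj, Function.update_of_ne (fun h => hj (Fin.succ_injective _ h))]

/-- The effect of a derivation on polynomials. -/
theorem derivation_evalPolynomial (Y : Module.Dual ℝ 𝔤 →ₗ[ℝ] R) (B : 𝔤 →ₗ[ℝ] 𝔤) (D : R →ₗ[ℝ] R)
    (hD : D 1 = 0) (hY : ∀ α w, D (Y α * w) = -(Y (α.comp B) * w) + Y α * D w)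
    (w : MultilinearMap ℝ (fun _ : Fin q => 𝔤) ℝ) :
    D (evalPolynomial e w fun a => Y (e.coord a)) =
      -evalPolynomial e (infinitesimalAction B w) fun a => Y (e.coord a) := by
  let P : MultilinearMap ℝ (fun _ : Fin q => Module.Dual ℝ 𝔤) R :=
    (MultilinearMap.mkPiAlgebraFin ℝ q R).compLinearMap fun _ => Y
  have hP : ∀ α, P α = (List.ofFn fun k => Y (α k)).prod := fun α => by simp [P]
  have hDP : ∀ α, D (P α) = -∑ k, P (Function.update α k ((α k).comp B)) := fun α => by
    rw [hP, derivation_list_prod Y (-(LinearMap.lcomp ℝ ℝ B)) D hD (fun α w => ?_),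
      ← Finset.sum_neg_distrib]
    · refine Finset.sum_congr rfl fun k _ => ?_
      rw [← hP, LinearMap.neg_apply, MultilinearMap.map_update_neg]
      rfl
    · rw [hY, LinearMap.neg_apply, map_neg, neg_mul]
      rfl
  have key : ∑ a : Fin q → Fin r, w (fun j => e (a j)) •
      ∑ k, P (Function.update (fun j => e.coord (a j)) k ((e.coord (a k)).comp B)) =
      ∑ a : Fin q → Fin r, infinitesimalAction B w (fun j => e (a j)) •
        P (fun j => e.coord (a j)) := by
    simp only [infinitesimalAction_apply, Finset.smul_sum, Finset.sum_smul]
    exact Finset.sum_comm.trans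
      ((Finset.sum_congr rfl fun k _ => sum_smul_update e B w P k).trans Finset.sum_comm)
  have hev : ∀ w : MultilinearMap ℝ (fun _ : Fin q => 𝔤) ℝ,
      (evalPolynomial e w fun a => Y (e.coord a)) = (1 / (q.factorial : ℝ)) •
        ∑ a : Fin q → Fin r, w (fun j => e (a j)) • P (fun j => e.coord (a j)) := fun w => by
    simp only [hP]
    rfl
  rw [hev, hev, ← key]
  simp only [map_smul, map_sum, hDP, smul_neg, Finset.sum_neg_distrib]

end Polynomials

/-! ### Basic forms on a shifted Lie algebra -/

namespace GradedManifold.Form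

variable {M : GradedManifold.{u}} {U : Opens M.Body}

theorem dfn_algebraMap (t : ℝ) : dfn (algebraMap ℝ (M.Fn U) t) = 0 := by
  have h : dfn (1 : M.Fn U) = 0 := by
    simpa using dfn_mul (M := M) (U := U) (SetLike.GradedOne.one_mem (A := M.deg U)) 1
  rw [Algebra.algebraMap_eq_smul_one, map_smul, h, smul_zero]

/-- Every term on generators contains `X`. This settles the degrees other than `-1`, in which the
holonomy algebra of contractions is zero. -/
theorem lie_eq_zero {k : ℤ} {X : M.Fn U →ₗ[ℝ] M.Fn U} (hX : M.IsDerivation U k X)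
    (h0 : X = 0) {p : ℕ} {w : Form M U} (hw : w ∈ deg M U p) : lie hX w = 0 := by
  induction hw using Submodule.span_induction with
  | zero => simp
  | add x y _ _ hx hy => rw [map_add, hx, hy, add_zero]
  | smul t x _ hx => rw [map_smul, hx, smul_zero]
  | mem w hw =>
    induction hw with
    | one => exact lie_one hX
    | fn_mul ha _ ih => rw [lie_fn_mul hX ha, ih, h0]; simp
    | dfn_mul ha _ ih => rw [lie_dfn_mul hX ha, ih, h0]; simp

end GradedManifold.Form

namespace IsShiftedLieAlgebra

variable {F : QManifold.{u}} {𝔤 : Type*} [AddCommGroup 𝔤] [Module ℝ 𝔤] [Bracket 𝔤 𝔤] {r : ℕ}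
  {e : Module.Basis (Fin r) ℝ 𝔤} {ξ : Module.Dual ℝ 𝔤 →ₗ[ℝ] F.Fn ⊤}

/-- Products of the differentials of the coordinates, and of the coordinates with indices in `S`. -/
inductive IsProduct (e : Module.Basis (Fin r) ℝ 𝔤) (ξ : Module.Dual ℝ 𝔤 →ₗ[ℝ] F.Fn ⊤)
    (S : Finset (Fin r)) : Form F.toGradedManifold ⊤ → Prop
  | one : IsProduct e ξ S 1
  | fn_mul {a w} : a ∈ S → IsProduct e ξ S w → IsProduct e ξ S (Form.fn (ξ (e.coord a)) * w)
  | dfn_mul {a w} : IsProduct e ξ S w → IsProduct e ξ S (Form.dfn (ξ (e.coord a)) * w)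

/-- The forms generated by the differentials of the coordinates, and by the coordinates with indices
in `S`. -/
noncomputable def productSpan (e : Module.Basis (Fin r) ℝ 𝔤) (ξ : Module.Dual ℝ 𝔤 →ₗ[ℝ] F.Fn ⊤)
    (S : Finset (Fin r)) : Submodule ℝ (Form F.toGradedManifold ⊤) :=
  Submodule.span ℝ {w | IsProduct e ξ S w}

section

omit [Bracket 𝔤 𝔤]

theorem fn_mul_mem_productSpan {S : Finset (Fin r)} {a : Fin r} (ha : a ∈ S)
    {w : Form F.toGradedManifold ⊤} (hw : w ∈ productSpan e ξ S) :
    Form.fn (ξ (e.coord a)) * w ∈ productSpan e ξ S := by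
  induction hw using Submodule.span_induction with
  | mem x hx => exact Submodule.subset_span (.fn_mul ha hx)
  | zero => simp
  | add x y _ _ hx hy => rw [mul_add]; exact Submodule.add_mem _ hx hy
  | smul t x _ hx => rw [mul_smul_comm]; exact Submodule.smul_mem _ _ hx

theorem dfn_mul_mem_productSpan {S : Finset (Fin r)} {a : Fin r}
    {w : Form F.toGradedManifold ⊤} (hw : w ∈ productSpan e ξ S) :
    Form.dfn (ξ (e.coord a)) * w ∈ productSpan e ξ S := by
  induction hw using Submodule.span_induction with
  | mem x hx => exact Submodule.subset_span (.dfn_mul hx)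
  | zero => simp
  | add x y _ _ hx hy => rw [mul_add]; exact Submodule.add_mem _ hx hy
  | smul t x _ hx => rw [mul_smul_comm]; exact Submodule.smul_mem _ _ hx

/-- Forms without coordinates are combinations of products of differentials. -/
theorem productSpan_empty_le : productSpan e ξ ∅ ≤ ⨆ q : ℕ, Submodule.span ℝ
    (Set.range fun a : Fin q → Fin r => (List.ofFn fun k => Form.dfn (ξ (e.coord (a k)))).prod) := by
  refine Submodule.span_le.2 fun w hw => ?_
  suffices ∃ (q : ℕ) (a : Fin q → Fin r),
      (List.ofFn fun k => Form.dfn (ξ (e.coord (a k)))).prod = w by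
    obtain ⟨q, a, rfl⟩ := this
    exact Submodule.mem_iSup_of_mem q (Submodule.subset_span ⟨a, rfl⟩)
  induction hw with
  | one => exact ⟨0, Fin.elim0, by simp⟩
  | fn_mul ha => simp at ha
  | @dfn_mul b w _ ih =>
    obtain ⟨q, a, rfl⟩ := ih
    exact ⟨q + 1, Fin.cons b a, by simp [List.ofFn_succ]⟩

end

variable (h : IsShiftedLieAlgebra F e ξ)

include h

theorem fn_mul_fn (α β : Module.Dual ℝ 𝔤) :
    Form.fn (ξ α) * Form.fn (ξ β) = -(Form.fn (ξ β) * Form.fn (ξ α)) := by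
  rw [← map_mul, F.comm (h.linear_mem α) (h.linear_mem β)]
  simp

theorem dfn_mul_fn (α β : Module.Dual ℝ 𝔤) :
    Form.dfn (ξ α) * Form.fn (ξ β) = Form.fn (ξ β) * Form.dfn (ξ α) := by
  have := Form.fn_mul_dfn (h.linear_mem β) (h.linear_mem α)
  norm_num at this
  exact this.symm

theorem dfn_mul_dfn (α β : Module.Dual ℝ 𝔤) : Commute (Form.dfn (ξ α)) (Form.dfn (ξ β)) := by
  have := Form.dfn_mul_dfn (h.linear_mem α) (h.linear_mem β)
  norm_num at this
  exact this

/-- All forms are generated by the coordinates and their differentials. -/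
theorem mem_productSpan {p : ℕ} {w : Form F.toGradedManifold ⊤}
    (hw : w ∈ Form.deg F.toGradedManifold ⊤ p) : w ∈ productSpan e ξ Finset.univ := by
  have hf : ∀ (α : Module.Dual ℝ 𝔤) {w}, w ∈ productSpan e ξ Finset.univ →
      Form.fn (ξ α) * w ∈ productSpan e ξ Finset.univ := fun α {w} hw => by
    rw [linear_eq e ξ]
    simp only [map_sum, map_smul, Finset.sum_mul, smul_mul_assoc]
    exact Submodule.sum_mem _ fun a _ =>
      Submodule.smul_mem _ _ (fn_mul_mem_productSpan (Finset.mem_univ a) hw)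
  have hd : ∀ (α : Module.Dual ℝ 𝔤) {w}, w ∈ productSpan e ξ Finset.univ →
      Form.dfn (ξ α) * w ∈ productSpan e ξ Finset.univ := fun α {w} hw => by
    rw [linear_eq e ξ]
    simp only [map_sum, map_smul, Finset.sum_mul, smul_mul_assoc]
    exact Submodule.sum_mem _ fun a _ => Submodule.smul_mem _ _ (dfn_mul_mem_productSpan hw)
  have key : ∀ (a : F.Fn ⊤) {w}, w ∈ productSpan e ξ Finset.univ →
      Form.fn a * w ∈ productSpan e ξ Finset.univ ∧
      Form.dfn a * w ∈ productSpan e ξ Finset.univ := by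
    intro a
    induction a using h.fn_induction with
    | algebraMap t =>
      intro w hw
      rw [AlgHom.commutes, ← Algebra.smul_def, Form.dfn_algebraMap, zero_mul]
      exact ⟨Submodule.smul_mem _ _ hw, Submodule.zero_mem _⟩
    | add a b ha hb =>
      intro w hw
      simp only [map_add, add_mul]
      exact ⟨Submodule.add_mem _ (ha hw).1 (hb hw).1, Submodule.add_mem _ (ha hw).2 (hb hw).2⟩
    | linear_mul α a ha =>
      intro w hw
      rw [map_mul, Form.dfn_mul (h.linear_mem α), add_mul, smul_mul_assoc, mul_assoc, mul_assoc,
        mul_assoc]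
      exact ⟨hf α (ha hw).1, Submodule.add_mem _ (hd α (ha hw).1)
        (Submodule.smul_mem _ _ (hf α (ha hw).2))⟩
  induction hw using Submodule.span_induction with
  | zero => exact Submodule.zero_mem _
  | add x y _ _ hx hy => exact Submodule.add_mem _ hx hy
  | smul t x _ hx => exact Submodule.smul_mem _ _ hx
  | mem w hw =>
    induction hw with
    | one => exact Submodule.subset_span .one
    | fn_mul _ _ ih => exact (key _ ih).1
    | dfn_mul _ _ ih => exact (key _ ih).2

/-- The coordinate `ξ^a` squares to zero and passes the other generators up to sign, so it can be
moved to the front, where it occurs at most once. -/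
theorem exists_of_mem_productSpan_insert {S : Finset (Fin r)} {a : Fin r}
    {w : Form F.toGradedManifold ⊤} (hw : w ∈ productSpan e ξ (insert a S)) :
    ∃ u ∈ productSpan e ξ S, ∃ v ∈ productSpan e ξ S, w = u + Form.fn (ξ (e.coord a)) * v := by
  have hsq : Form.fn (ξ (e.coord a)) * Form.fn (ξ (e.coord a)) =
      (0 : Form F.toGradedManifold ⊤) := by
    rw [← map_mul, h.linear_sq, map_zero]
  induction hw using Submodule.span_induction with
  | zero => exact ⟨0, Submodule.zero_mem _, 0, Submodule.zero_mem _, by simp⟩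
  | add x y _ _ hx hy =>
    obtain ⟨u, hu, v, hv, rfl⟩ := hx
    obtain ⟨u', hu', v', hv', rfl⟩ := hy
    exact ⟨u + u', Submodule.add_mem _ hu hu', v + v', Submodule.add_mem _ hv hv', by
      rw [mul_add]; abel⟩
  | smul t x _ hx =>
    obtain ⟨u, hu, v, hv, rfl⟩ := hx
    exact ⟨t • u, Submodule.smul_mem _ _ hu, t • v, Submodule.smul_mem _ _ hv, by
      rw [mul_smul_comm, smul_add]⟩
  | mem w hw =>
    induction hw with
    | one => exact ⟨1, Submodule.subset_span .one, 0, Submodule.zero_mem _, by simp⟩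
    | @fn_mul b w hb _ ih =>
      obtain ⟨u, hu, v, hv, rfl⟩ := ih
      by_cases hab : b = a
      · subst hab
        exact ⟨0, Submodule.zero_mem _, u, hu, by
          rw [mul_add, ← mul_assoc, hsq, zero_mul, add_zero, zero_add]⟩
      · have hbS := (Finset.mem_insert.1 hb).resolve_left hab
        exact ⟨_, fn_mul_mem_productSpan hbS hu, _, Submodule.neg_mem _
          (fn_mul_mem_productSpan hbS hv), by
            rw [mul_add, ← mul_assoc, h.fn_mul_fn, neg_mul, mul_neg, mul_assoc]⟩
    | @dfn_mul b w _ ih =>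
      obtain ⟨u, hu, v, hv, rfl⟩ := ih
      exact ⟨_, dfn_mul_mem_productSpan hu, _, dfn_mul_mem_productSpan hv, by
        rw [mul_add, ← mul_assoc, h.dfn_mul_fn, mul_assoc]⟩

section Contraction

variable {ε : 𝔤} {X : F.Fn ⊤ →ₗ[ℝ] F.Fn ⊤} (hX : F.IsDerivation ⊤ (-1) X)
  (hXε : ∀ α, X (ξ α) = algebraMap ℝ (F.Fn ⊤) (α ε))

include hXε

/-- With `lie_dlinear_mul` this says that `L_ε` is the odd partial derivative in direction `ε`: it
differentiates the coordinates and treats their differentials as constants, since `d` of the number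
`α ε` is zero. -/
theorem lie_linear_mul (α : Module.Dual ℝ 𝔤) (w : Form F.toGradedManifold ⊤) :
    Form.lie hX (Form.fn (ξ α) * w) = α ε • w - Form.fn (ξ α) * Form.lie hX w := by
  rw [Form.lie_fn_mul hX (h.linear_mem α), hXε, AlgHom.commutes, ← Algebra.smul_def]
  norm_num [sub_eq_add_neg]

theorem lie_dlinear_mul (α : Module.Dual ℝ 𝔤) (w : Form F.toGradedManifold ⊤) :
    Form.lie hX (Form.dfn (ξ α) * w) = Form.dfn (ξ α) * Form.lie hX w := by
  rw [Form.lie_dfn_mul hX (h.linear_mem α), hXε, Form.dfn_algebraMap]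
  norm_num

theorem lie_eq_zero_of_mem_productSpan {S : Finset (Fin r)} (hS : ∀ a ∈ S, e.coord a ε = 0)
    {w : Form F.toGradedManifold ⊤} (hw : w ∈ productSpan e ξ S) : Form.lie hX w = 0 := by
  induction hw using Submodule.span_induction with
  | zero => simp
  | add x y _ _ hx hy => rw [map_add, hx, hy, add_zero]
  | smul t x _ hx => rw [map_smul, hx, smul_zero]
  | mem w hw =>
    induction hw with
    | one => exact Form.lie_one hX
    | fn_mul ha _ ih => rw [h.lie_linear_mul hX hXε, ih, hS _ ha, zero_smul, mul_zero, sub_zero]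
    | dfn_mul _ ih => rw [h.lie_dlinear_mul hX hXε, ih, mul_zero]

end Contraction

/-- Forms annihilated by all contractions do not depend on the coordinates. -/
theorem mem_productSpan_empty {w : Form F.toGradedManifold ⊤}
    (hw : ∀ a, Form.lie (h.isDerivation_contraction (e a)) w = 0) {S : Finset (Fin r)}
    (hS : w ∈ productSpan e ξ S) : w ∈ productSpan e ξ ∅ := by
  induction S using Finset.induction_on with
  | empty => exact hS
  | insert a S ha ih =>
    refine ih ?_
    -- Neither `u` nor `v` involves `ξ^a`, so the Lie derivative along `e a` of `u + ξ^a v` is `v`,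
    -- which must vanish.
    obtain ⟨u, hu, v, hv, rfl⟩ := h.exists_of_mem_productSpan_insert hS
    have hz : ∀ b ∈ S, e.coord b (e a) = 0 := fun b hb => by
      have : a ≠ b := fun hab => ha (hab ▸ hb)
      simp [this]
    have h1 := hw a
    rw [map_add, h.lie_linear_mul _ (h.contraction_linear (e a)),
      h.lie_eq_zero_of_mem_productSpan _ (h.contraction_linear (e a)) hz hu,
      h.lie_eq_zero_of_mem_productSpan _ (h.contraction_linear (e a)) hz hv] at h1
    simp only [Module.Basis.coord_apply, Module.Basis.repr_self, Finsupp.single_eq_same, one_smul,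
      mul_zero, sub_zero, zero_add] at h1
    rw [h1, mul_zero, add_zero]
    exact hu

theorem prod_isMonomial {q : ℕ} (α : Fin q → Module.Dual ℝ 𝔤) :
    Form.IsMonomial (2 * q) (List.ofFn fun k => Form.dfn (ξ (α k))).prod := by
  induction q with
  | zero => simpa using Form.IsMonomial.one
  | succ q ih =>
    rw [List.ofFn_succ, List.prod_cons, show 2 * (q + 1) = 1 + 1 + 2 * q by ring]
    exact .dfn_mul (h.linear_mem _) (ih _)

theorem evalPolynomial_mem {q : ℕ} (w : MultilinearMap ℝ (fun _ : Fin q => 𝔤) ℝ) :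
    evalPolynomial e w (fun a => Form.dfn (ξ (e.coord a))) ∈
      Form.deg F.toGradedManifold ⊤ (2 * q) :=
  Submodule.smul_mem _ _ (Submodule.sum_mem _ fun _ _ =>
    Submodule.smul_mem _ _ (Submodule.subset_span (h.prod_isMonomial _)))

omit [Bracket 𝔤 𝔤] h in
theorem evalPolynomial_mem_productSpan {q : ℕ} (w : MultilinearMap ℝ (fun _ : Fin q => 𝔤) ℝ) :
    evalPolynomial e w (fun a => Form.dfn (ξ (e.coord a))) ∈ productSpan e ξ ∅ := by
  have : ∀ {q : ℕ} (a : Fin q → Fin r),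
      (List.ofFn fun k => Form.dfn (ξ (e.coord (a k)))).prod ∈ productSpan e ξ ∅ := by
    intro q a
    induction q with
    | zero => exact Submodule.subset_span (by simpa using .one)
    | succ q ih =>
      rw [List.ofFn_succ, List.prod_cons]
      exact dfn_mul_mem_productSpan (ih _)
  exact Submodule.smul_mem _ _ (Submodule.sum_mem _ fun _ _ => Submodule.smul_mem _ _ (this _))

/-- Each `dξ` has total degree two, so scaling by two multiplies a product of `q` of them by `4 ^
q`. -/
theorem span_prod_le (q : ℕ) : Submodule.span ℝ (Set.range fun a : Fin q → Fin r =>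
    (List.ofFn fun k => Form.dfn (ξ (e.coord (a k)))).prod) ≤
      Module.End.eigenspace (Form.scale (M := F.toGradedManifold) (U := ⊤) 2).toLinearMap
        (4 ^ q : ℝ) := by
  refine Submodule.span_le.2 ?_
  rintro _ ⟨a, rfl⟩
  refine Module.End.mem_eigenspace_iff.2 ?_
  refine (Form.scale_monomial 2 (h.prod_isMonomial _)).trans ?_
  rw [pow_mul]
  norm_num

section Basic

variable {G : HolonomyAlgebra F} (hG : G.IsContractions ξ)

include hG

theorem basic_mem_iSup {p : ℕ} {w : Form F.toGradedManifold ⊤} (hw : w ∈ G.basicDeg p) :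
    w ∈ ⨆ q : ℕ, Submodule.span ℝ (Set.range fun a : Fin q → Fin r =>
      (List.ofFn fun k => Form.dfn (ξ (e.coord (a k)))).prod) := by
  refine productSpan_empty_le (h.mem_productSpan_empty (fun a => ?_) (h.mem_productSpan hw.1))
  have hX : h.contraction (e a) ∈ G.space (-1) :=
    (hG.2 _).2 ⟨h.isDerivation_contraction _, e a, h.contraction_linear _⟩
  exact (basic_lie ⟨_, hX⟩ hw.2).1

/-- There are no basic forms of odd degree. -/
theorem basicDeg_odd (q : ℕ) : G.basicDeg (2 * q + 1) = ⊥ := by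
  refine (Submodule.eq_bot_iff _).2 fun w hw => ?_
  -- Products of differentials scale by even powers of two, and `w` by an odd one.
  refine Module.End.eq_zero_of_mem_iSup_of_mem_eigenspace h.span_prod_le (h.basic_mem_iSup hG hw)
    (ν := 2 ^ (2 * q + 1)) (fun q' hq' => ?_)
    (Module.End.mem_eigenspace_iff.2 (Form.scale_of_mem_deg 2 hw.1))
  have h4 : (4 : ℝ) = 2 ^ 2 := by norm_num
  rw [h4, ← pow_mul] at hq'
  have := pow_right_injective₀ (two_pos : (0 : ℝ) < 2) (by norm_num) hq'
  omega

/-- Basic forms are polynomials in the differentials of the coordinates. -/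
theorem exists_polynomial {q : ℕ} {x : Form F.toGradedManifold ⊤} (hx : x ∈ G.basicDeg (2 * q)) :
    ∃ w : MultilinearMap ℝ (fun _ : Fin q => 𝔤) ℝ,
      (∀ (σ : Equiv.Perm (Fin q)) (v : Fin q → 𝔤), w (fun k => v (σ k)) = w v) ∧
      x = evalPolynomial e w fun a => Form.dfn (ξ (e.coord a)) := by
  have h1 := Module.End.mem_of_mem_iSup_of_mem_eigenspace (q := q) (μ := fun q => (4 : ℝ) ^ q)
    h.span_prod_le (pow_right_injective₀ (by norm_num) (by norm_num)) (h.basic_mem_iSup hG hx)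
    (Module.End.mem_eigenspace_iff.2 (by
      refine (Form.scale_of_mem_deg 2 hx.1).trans ?_
      rw [pow_mul]
      norm_num))
  obtain ⟨c, hc⟩ := (Submodule.mem_span_range_iff_exists_fun ℝ).1 h1
  obtain ⟨w, hw, hw'⟩ := exists_evalPolynomial e (fun a => Form.dfn (ξ (e.coord a)))
    (fun a b => h.dfn_mul_dfn _ _) c
  exact ⟨w, hw, by rw [← hw', hc]⟩

end Basic

/-- `toPolynomial` sends `dξ^a` to the variable `X_a`, and in the polynomial ring the coefficients
determine a symmetric form. -/
theorem polynomial_unique {q : ℕ} {w w' : MultilinearMap ℝ (fun _ : Fin q => 𝔤) ℝ}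
    (hw : ∀ (σ : Equiv.Perm (Fin q)) (v : Fin q → 𝔤), w (fun k => v (σ k)) = w v)
    (hw' : ∀ (σ : Equiv.Perm (Fin q)) (v : Fin q → 𝔤), w' (fun k => v (σ k)) = w' v)
    (hww' : evalPolynomial e w (fun a => Form.dfn (ξ (e.coord a))) =
      evalPolynomial e w' fun a => Form.dfn (ξ (e.coord a))) : w = w' := by
  have h1 := congrArg h.toPolynomial hww'
  rw [evalPolynomial_map, evalPolynomial_map] at h1
  simp only [h.toPolynomial_dfn] at h1
  exact eq_of_evalPolynomial_X e hw hw' h1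

end IsShiftedLieAlgebra

/-! ### Invariance of basic forms -/

namespace IsShiftedLieAlgebra

variable {F : QManifold.{u}} {𝔤 : Type*} [AddCommGroup 𝔤] [Module ℝ 𝔤] [Bracket 𝔤 𝔤] {r : ℕ}
  {e : Module.Basis (Fin r) ℝ 𝔤} {ξ : Module.Dual ℝ 𝔤 →ₗ[ℝ] F.Fn ⊤}
  (h : IsShiftedLieAlgebra F e ξ) {ad : 𝔤 →ₗ[ℝ] 𝔤 →ₗ[ℝ] 𝔤} (had : ∀ x y, ad x y = ⁅x, y⁆)
  (hskew : ∀ x y : 𝔤, ⁅x, y⁆ = -⁅y, x⁆)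

include h had hskew

/-- `X ξ` is constant, so only `X Q ξ` contributes. By skewness the two factors of the quadratic `Q
ξ` contribute equally and cancel the `½`, leaving the coadjoint action. Of the bracket, only
bilinearity and skewness are used. -/
theorem bracket_Q_linear {ε : 𝔤} {X : F.Fn ⊤ →ₗ[ℝ] F.Fn ⊤} (hX : F.IsDerivation ⊤ (-1) X)
    (hXε : ∀ α, X (ξ α) = algebraMap ℝ (F.Fn ⊤) (α ε)) (α : Module.Dual ℝ 𝔤) :
    bracket 1 (-1) (F.Q ⊤) X (ξ α) = -ξ (α.comp (ad ε)) := by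
  have hQ1 : F.Q ⊤ 1 = 0 := by
    simpa using F.Q_leibniz ⊤ (SetLike.GradedOne.one_mem (A := F.deg ⊤)) 1
  have hXm : ∀ a b, X (ξ (e.coord a) * ξ (e.coord b)) =
      e.coord a ε • ξ (e.coord b) - e.coord b ε • ξ (e.coord a) := fun a b => by
    rw [hX.leibniz (h.linear_mem _), hXε, hXε, ← Algebra.smul_def, ← Algebra.commutes,
      ← Algebra.smul_def]
    norm_num [sub_eq_add_neg]
  have hε : ∑ a, e.coord a ε • e a = ε := e.sum_repr ε
  have h1 : ∑ a, ∑ b, (α ⁅e a, e b⁆ * e.coord a ε) • ξ (e.coord b) = ξ (α.comp (ad ε)) := by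
    rw [Finset.sum_comm, linear_eq e ξ (α.comp (ad ε))]
    refine Finset.sum_congr rfl fun b _ => ?_
    rw [← Finset.sum_smul]
    have h0 : α (ad (∑ a, e.coord a ε • e a) (e b)) = ∑ a, α ⁅e a, e b⁆ * e.coord a ε := by
      simp only [map_sum, map_smul, LinearMap.sum_apply, LinearMap.smul_apply, smul_eq_mul, had,
        mul_comm]
    rw [LinearMap.comp_apply, ← h0, hε]
  have h2 : ∑ a, ∑ b, (α ⁅e a, e b⁆ * e.coord b ε) • ξ (e.coord a) = -ξ (α.comp (ad ε)) := by
    rw [← h1, Finset.sum_comm, ← Finset.sum_neg_distrib]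
    refine Finset.sum_congr rfl fun a _ => ?_
    rw [← Finset.sum_neg_distrib]
    refine Finset.sum_congr rfl fun b _ => ?_
    rw [hskew (e b) (e a), map_neg, neg_mul, neg_smul]
  have h3 : X (F.Q ⊤ (ξ α)) = -ξ (α.comp (ad ε)) := by
    rw [h.Q_apply, map_smul, map_sum]
    simp only [map_sum, map_smul, hXm, smul_sub, smul_smul, Finset.sum_sub_distrib, h1, h2]
    module
  simp only [bracket, LinearMap.sub_apply, LinearMap.smul_apply, LinearMap.comp_apply, hXε, h3]
  rw [Algebra.algebraMap_eq_smul_one, map_smul, hQ1]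
  norm_num

theorem lie_bracket_mul {ε : 𝔤} {X : F.Fn ⊤ →ₗ[ℝ] F.Fn ⊤} (hX : F.IsDerivation ⊤ (-1) X)
    (hXε : ∀ α, X (ξ α) = algebraMap ℝ (F.Fn ⊤) (α ε)) (α : Module.Dual ℝ 𝔤)
    (w : Form F.toGradedManifold ⊤) :
    Form.lie ((F.isDerivation_Q ⊤).bracket hX) (Form.dfn (ξ α) * w) =
      -(Form.dfn (ξ (α.comp (ad ε))) * w) +
        Form.dfn (ξ α) * Form.lie ((F.isDerivation_Q ⊤).bracket hX) w := by
  rw [Form.lie_dfn_mul _ (h.linear_mem α), h.bracket_Q_linear had hskew hX hXε, map_neg]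
  norm_num

/-- The derivation acts on each `dξ` by the transpose of `ad ε`; moving the transpose to the
coefficients gives the adjoint action on `w`. Basicness of the form thus becomes invariance of `w`.
-/
theorem lie_bracket_evalPolynomial {ε : 𝔤} {X : F.Fn ⊤ →ₗ[ℝ] F.Fn ⊤}
    (hX : F.IsDerivation ⊤ (-1) X) (hXε : ∀ α, X (ξ α) = algebraMap ℝ (F.Fn ⊤) (α ε)) {q : ℕ}
    (w : MultilinearMap ℝ (fun _ : Fin q => 𝔤) ℝ) :
    Form.lie ((F.isDerivation_Q ⊤).bracket hX)
        (evalPolynomial e w fun a => Form.dfn (ξ (e.coord a))) =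
      -evalPolynomial e (infinitesimalAction (ad ε) w) fun a => Form.dfn (ξ (e.coord a)) :=
  derivation_evalPolynomial e (Form.dfn.comp ξ) (ad ε)
    (Form.lie ((F.isDerivation_Q ⊤).bracket hX)) (Form.lie_one _)
    (h.lie_bracket_mul had hskew hX hXε) w

/-- Differentiating the quadratic `Q ξ` gives two sums, equal by skewness, which absorb the factor
`½`. -/
theorem totalQ_dlinear (α : Module.Dual ℝ 𝔤) :
    -Form.dfn (F.Q ⊤ (ξ α)) = -∑ a, Form.fn (ξ (e.coord a)) * Form.dfn (ξ (α.comp (ad (e a)))) := by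
  have h1 : ∀ a b, Form.dfn (ξ (e.coord a) * ξ (e.coord b)) =
      Form.fn (ξ (e.coord b)) * Form.dfn (ξ (e.coord a)) -
        Form.fn (ξ (e.coord a)) * Form.dfn (ξ (e.coord b)) := fun a b => by
    rw [Form.dfn_mul (h.linear_mem _), h.dfn_mul_fn]
    norm_num [sub_eq_add_neg]
  have h2 : ∑ a, ∑ b, α ⁅e a, e b⁆ • (Form.fn (ξ (e.coord a)) * Form.dfn (ξ (e.coord b))) =
      ∑ a, Form.fn (ξ (e.coord a)) * Form.dfn (ξ (α.comp (ad (e a)))) := by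
    refine Finset.sum_congr rfl fun a _ => ?_
    rw [linear_eq e ξ (α.comp (ad (e a)))]
    simp [Finset.mul_sum, had]
  have h3 : ∑ a, ∑ b, α ⁅e a, e b⁆ • (Form.fn (ξ (e.coord b)) * Form.dfn (ξ (e.coord a))) =
      -∑ a, Form.fn (ξ (e.coord a)) * Form.dfn (ξ (α.comp (ad (e a)))) := by
    rw [← h2, Finset.sum_comm, ← Finset.sum_neg_distrib]
    refine Finset.sum_congr rfl fun a _ => ?_
    rw [← Finset.sum_neg_distrib]
    refine Finset.sum_congr rfl fun b _ => ?_
    rw [hskew (e b) (e a), map_neg, neg_smul]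
  rw [h.Q_apply]
  simp only [map_smul, map_sum, h1, smul_sub, Finset.sum_sub_distrib, h2, h3]
  module

/-- On polynomials in the differentials of the coordinates, the total differential is given by the
Lie derivatives along the adjoint action. -/
theorem totalQ_eq_sum_lie {w : Form F.toGradedManifold ⊤} (hw : w ∈ productSpan e ξ ∅) :
    F.totalQ ⊤ w = ∑ a, Form.fn (ξ (e.coord a)) *
      Form.lie ((F.isDerivation_Q ⊤).bracket (h.isDerivation_contraction (e a))) w := by
  induction hw using Submodule.span_induction with
  | zero => simp
  | add x y _ _ hx hy => simp only [map_add, hx, hy, mul_add, Finset.sum_add_distrib]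
  | smul t x _ hx => simp only [map_smul, hx, mul_smul_comm, Finset.smul_sum]
  | mem w hw =>
    induction hw with
    | one => simp [QManifold.totalQ_one, Form.lie_one]
    | fn_mul ha => simp at ha
    | @dfn_mul b w _ ih =>
      -- `-d (Q ξ)` is what the operators `ξ^a L_{[Q, ι_a]}` produce on the new factor. For the
      -- rest, `dξ` has even total degree, so it passes `ξ^a` without sign.
      rw [F.totalQ_dfn_mul ⊤ (h.linear_mem _), ih, ← neg_mul, h.totalQ_dlinear had hskew]
      simp only [h.lie_bracket_mul had hskew (h.isDerivation_contraction _)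
        (h.contraction_linear _), mul_add, Finset.sum_add_distrib, Finset.mul_sum, neg_mul, mul_neg,
        Finset.sum_mul, ← mul_assoc, Finset.sum_neg_distrib, h.dfn_mul_fn]
      norm_num

section Basic

variable {G : HolonomyAlgebra F} (hG : G.IsContractions ξ) {q : ℕ}

include hG

theorem evalPolynomial_mem_basicDeg {w : MultilinearMap ℝ (fun _ : Fin q => 𝔤) ℝ}
    (hw : IsInvariantPolynomial w) :
    evalPolynomial e w (fun a => Form.dfn (ξ (e.coord a))) ∈ G.basicDeg (2 * q) := by
  refine ⟨h.evalPolynomial_mem w, ?_⟩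
  rw [SetLike.mem_coe]
  simp only [HolonomyAlgebra.basicForms, Submodule.mem_iInf]
  rintro k ⟨X, hX⟩
  by_cases hk : k = -1
  · subst hk
    obtain ⟨hd, ε, hε⟩ := (hG.2 X).1 hX
    refine ⟨h.lie_eq_zero_of_mem_productSpan hd hε (by simp) (evalPolynomial_mem_productSpan w), ?_⟩
    refine (h.lie_bracket_evalPolynomial had hskew hd hε w).trans ?_
    have : infinitesimalAction (ad ε) w = 0 := by
      ext v
      rw [infinitesimalAction_apply]
      simp only [had]
      exact hw.invariant ε v
    rw [this]
    simp [evalPolynomial]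
  · have hX0 : X = 0 := by rwa [hG.1 k hk] at hX
    exact ⟨Form.lie_eq_zero _ hX0 (h.evalPolynomial_mem w),
      Form.lie_eq_zero _ (by simp [bracket, hX0]) (h.evalPolynomial_mem w)⟩

/-- Basic forms of even degree are invariant polynomials in a unique way. -/
theorem existsUnique_invariantPolynomial {x : Form F.toGradedManifold ⊤}
    (hx : x ∈ G.basicDeg (2 * q)) : ∃! w : MultilinearMap ℝ (fun _ : Fin q => 𝔤) ℝ,
      IsInvariantPolynomial w ∧ x = evalPolynomial e w fun a => Form.dfn (ξ (e.coord a)) := by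
  obtain ⟨w, hw, rfl⟩ := h.exists_polynomial hG hx
  refine ⟨w, ⟨⟨hw, fun η v => ?_⟩, rfl⟩, fun w' hw' => ?_⟩
  · have hX : h.contraction η ∈ G.space (-1) :=
      (hG.2 _).2 ⟨h.isDerivation_contraction _, η, h.contraction_linear _⟩
    have h1 := (basic_lie ⟨_, hX⟩ hx.2).2
    rw [h.lie_bracket_evalPolynomial had hskew (h.isDerivation_contraction η)
      (h.contraction_linear η), neg_eq_zero] at h1
    -- The action preserves symmetry, so uniqueness applies to `infinitesimalAction (ad η) w` and
    -- zero.
    have h2 : infinitesimalAction (ad η) w = 0 :=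
      h.polynomial_unique (infinitesimalAction_symm _ hw) (fun _ _ => rfl)
        (h1.trans (by simp [evalPolynomial]))
    have h3 : infinitesimalAction (ad η) w v = 0 := by rw [h2]; rfl
    simpa only [infinitesimalAction_apply, had] using h3
  · exact (h.polynomial_unique hw hw'.1.symm hw'.2).symm

/-- By `totalQ_eq_sum_lie` the total differential is a combination of Lie derivatives along `[Q,
ι_a]`, which vanish on basic forms. -/
theorem evalPolynomial_mem_cocycles {w : MultilinearMap ℝ (fun _ : Fin q => 𝔤) ℝ}
    (hw : IsInvariantPolynomial w) :
    evalPolynomial e w (fun a => Form.dfn (ξ (e.coord a))) ∈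
      GradedComplex.cocycles G.basicDeg (F.totalQ ⊤) (2 * q) := by
  have hb := h.evalPolynomial_mem_basicDeg had hskew hG hw
  refine ⟨hb, ?_⟩
  change F.totalQ ⊤ _ = 0
  rw [h.totalQ_eq_sum_lie had hskew (evalPolynomial_mem_productSpan w)]
  refine Finset.sum_eq_zero fun a _ => ?_
  have hX : h.contraction (e a) ∈ G.space (-1) :=
    (hG.2 _).2 ⟨h.isDerivation_contraction _, e a, h.contraction_linear _⟩
  rw [(basic_lie ⟨_, hX⟩ hb.2).2, mul_zero]

end Basic

end IsShiftedLieAlgebra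

/-! ### Chern–Weil forms -/

/-- Over a coordinate neighbourhood of `T[1]X`, every function is a polynomial in the `Q y_i` with
smooth coefficients. An equality of homomorphisms need only be checked on `f` and `Q f`. -/
theorem QManifold.mem_of_isGenerating_Q {N : QManifold.{u}} {U : Opens N.Body} {m : ℕ}
    {d : Fin m → ℕ} {y : Fin m → N.Smooth U}
    (hy : N.IsGenerating U d fun i => N.Q U (N.ofSmooth U (y i))) {V : Opens N.Body} (hV : V ≤ U)
    (S : Subalgebra ℝ (N.Fn V)) (h₀ : ∀ f, N.ofSmooth V f ∈ S)
    (h₁ : ∀ f, N.Q V (N.ofSmooth V f) ∈ S) (a : N.Fn V) : a ∈ S := by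
  obtain ⟨c, hc, -⟩ := hy.existsUnique V hV a
  rw [hc]
  refine Subalgebra.sum_mem _ fun μ _ => S.mul_mem (h₀ _) ?_
  rw [GradedSpace.monomial, map_list_prod]
  refine Subalgebra.list_prod_mem _ fun z hz => ?_
  rw [List.map_ofFn, List.mem_ofFn] at hz
  obtain ⟨j, rfl⟩ := hz
  rw [Function.comp_apply, map_pow, ← N.Q_res, N.res_ofSmooth]
  exact S.pow_mem (h₁ _) _

/-- A Q-morphism from an odd tangent bundle is determined by its body: if `ψ ∘ φ` is the identity on
the body, then it is the identity on functions. -/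
theorem QManifold.IsOddTangent.pull_pull {N P : QManifold.{u}} (hN : N.IsOddTangent)
    {U : Opens N.Body} {φ : GHom N.toGradedManifold U P.toGradedManifold}
    {ψ : GHom P.toGradedManifold ⊤ N.toGradedManifold} (hφ : QManifold.IsQMorphism φ)
    (hψ : QManifold.IsQMorphism ψ) (hb : ∀ x ∈ U, ψ.body (φ.body x) = x) {V W : Opens N.Body}
    {O : Opens P.Body} (hW : W ≤ U) (hWO : Set.MapsTo φ.body W O) (hOV : Set.MapsTo ψ.body O V)
    (hWV : W ≤ V) (a : N.Fn V) :
    φ.pull O W hW hWO (ψ.pull V O le_top hOV a) = N.res hWV a := by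
  refine eq_of_local fun x hx => ?_
  obtain ⟨V', y, hxV', hy⟩ := hN x
  -- Over this coordinate neighbourhood the composite fixes smooth functions, by the hypothesis on
  -- bodies. It commutes with `Q`, so it also fixes `Q f`, and hence everything.
  let W' := W ⊓ V'
  have hW'W : W' ≤ W := inf_le_left
  let O' := O ⊓ ψ.preimage W'
  have hWO' : Set.MapsTo φ.body W' O' := fun z hz =>
    ⟨hWO (hW'W hz), show ψ.body (φ.body z) ∈ W' by rwa [hb z (hW (hW'W hz))]⟩
  have hOW' : Set.MapsTo ψ.body O' W' := fun z hz => hz.2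
  let g : N.Fn W' →ₐ[ℝ] N.Fn W' :=
    (φ.pull O' W' (hW'W.trans hW) hWO').comp (ψ.pull W' O' le_top hOW')
  have hg₀ : ∀ f, g (N.ofSmooth W' f) = N.ofSmooth W' f := fun f => by
    obtain ⟨f₁, hf₁, e₁⟩ := ψ.pull_ofSmooth le_top hOW' f
    obtain ⟨f₂, hf₂, e₂⟩ := φ.pull_ofSmooth (hW'W.trans hW) hWO' f₁
    have : f₂ = f := by
      ext z
      rw [hf₂, hf₁]
      exact congrArg f (Subtype.ext (hb z (hW (hW'W z.2))))
    rw [AlgHom.comp_apply, e₁, e₂, this]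
  have hgQ : ∀ b, g (N.Q W' b) = N.Q W' (g b) := fun b => by
    simp only [g, AlgHom.comp_apply]
    rw [hφ, hψ]
  have hg : ∀ b, g b = b := fun b =>
    QManifold.mem_of_isGenerating_Q hy inf_le_right (AlgHom.equalizer g (AlgHom.id ℝ _)) hg₀
      (fun f => (hgQ _).trans (congrArg _ (hg₀ f))) b
  refine ⟨W', hW'W, ⟨hx, hxV'⟩, ?_⟩
  rw [N.res_res, ← hg (N.res (hW'W.trans hWV) a), AlgHom.comp_apply,
    ψ.pull_res (hW'W.trans hWV) (inf_le_left : O' ≤ O) le_top hOV,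
    φ.pull_res (inf_le_left : O' ≤ O) hW'W hW hWO]

namespace AtiyahData

variable {r : ℕ} {K : Type*} [TopologicalSpace K] [ChartedSpace (EuclideanSpace ℝ (Fin r)) K]
  [Group K] {M N F : QManifold.{u}} {G : HolonomyAlgebra F} {B : QBundle M N F G}
  {T : TangentPrincipalBundle r K N} {e : Module.Basis (Fin r) ℝ (GroupLieAlgebra (𝓡 r) K)}
  (A : AtiyahData B T e)

theorem sec_pull_projT (i : B.Index) {V : Opens N.Body} {O : Opens T.TP.Body}
    (hO : Set.MapsTo (A.sec i).body (B.U i) O) (hOV : Set.MapsTo T.projT.body O V)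
    (hV : B.U i ≤ V) (a : N.Fn V) :
    (A.sec i).pull O (B.U i) le_rfl hO (T.projT.pull V O le_top hOV a) = N.res hV a :=
  T.base.pull_pull (A.sec_Q i) T.projT_Q
    (fun x hx => by rw [T.projT_body]; exact A.sec_body i x hx) le_rfl hO hOV hV a

/-- `s_i^* 𝗉^*` is restriction to `U i`, so a form on the base is recovered locally from its
pull-back to `P`. -/
theorem eq_of_projT_eq {c c' : N.Fn ⊤} {z : T.TP.Fn ⊤}
    (hc : ∀ i, N.res le_top c = A.secPull i z)
    (hc' : T.projT.pull ⊤ ⊤ le_top (fun _ _ => trivial) c' = z) : c' = c :=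
  eq_of_local fun x _ => by
    obtain ⟨i, hi⟩ := B.cover x
    refine ⟨B.U i, le_top, hi, ?_⟩
    rw [hc i, ← hc']
    exact (A.sec_pull_projT (V := ⊤) (O := ⊤) i (fun _ _ => trivial) (fun _ _ => trivial) le_top
      c').symm

variable {A} {φ : B.GaugeField} {θ : Module.Dual ℝ (GroupLieAlgebra (𝓡 r) K) →ₗ[ℝ] T.TP.Fn ⊤}

/-- In a local trivialization, the horizontal lift is the local connection form. -/
theorem IsHorizontalLift.pullOn_linear (h : A.IsHorizontalLift φ θ) (i : B.Index)
    (α : Module.Dual ℝ (GroupLieAlgebra (𝓡 r) K)) :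
    φ.pullOn (B.U i) (B.trivPull i (A.ξ α)) = A.secPull i (θ α) := by
  have h1 := congrArg ((A.sec i).pull (T.above (B.U i)) (B.U i) le_rfl (A.sec_mapsTo i))
    (h (B.U i) (B.trivPull i (A.ξ α)) ((B.τ i).pull_deg _ _ (A.fiber.linear_mem α)))
  have h2 : ∀ z, (A.sec i).pull (T.above (B.U i)) (B.U i) le_rfl (A.sec_mapsTo i)
      (T.TP.res le_top z) = A.secPull i z := fun z =>
    ((A.sec i).pull_res le_top le_rfl le_rfl (fun _ _ => trivial) (A.sec_mapsTo i) z).trans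
      (N.res_self _)
  -- Pull the formula for the horizontal part back along `s_i`. The projection disappears, the
  -- trivialization form vanishes along `s_i`, and its contraction is `-α (e b)`, so the sum becomes
  -- `+ s_i^* θ`.
  rw [TangentPrincipalBundle.projOn, A.sec_pull_projT i (A.sec_mapsTo i) (fun _ h => h) le_rfl,
    N.res_self, map_sub, A.sec_triv, map_sum] at h1
  simp only [map_mul, A.sec_contr, h2, map_neg, neg_mul, Finset.sum_neg_distrib, zero_sub,
    neg_neg, ← Algebra.smul_def] at h1
  rw [h1, IsShiftedLieAlgebra.linear_eq e θ α, map_sum]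
  simp only [map_smul]

/-- `s_i` and `τ_i` are Q-morphisms, so `F ξ = s_i^* dθ - φ^* (Q ξ)`. The Chevalley–Eilenberg
differential carries `-½`, which turns into the `+½ [θ, θ]` of the curvature. -/
theorem IsHorizontalLift.fieldOn_linear (h : A.IsHorizontalLift φ θ) (i : B.Index)
    (α : Module.Dual ℝ (GroupLieAlgebra (𝓡 r) K)) :
    φ.fieldOn (B.U i) (B.trivPull i (A.ξ α)) = A.secPull i (T.curvature e θ α) := by
  have h1 : M.Q _ (B.trivPull i (A.ξ α)) = B.trivPull i (F.Q ⊤ (A.ξ α)) :=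
    (B.isTrivialization i).isQMorphism _ _ _ _ _
  have h2 : N.Q _ (A.secPull i (θ α)) = A.secPull i (T.TP.Q ⊤ (θ α)) := A.sec_Q i _ _ _ _ _
  rw [QBundle.GaugeField.fieldOn_apply, h1, A.fiber.Q_apply, h.pullOn_linear, h2,
    TangentPrincipalBundle.curvature]
  simp only [map_neg, map_smul, map_sum, map_mul, map_add, h.pullOn_linear, neg_smul,
    sub_neg_eq_add]

/-- Extension, `f^*` and `s_i^*` are homomorphisms of algebras, so only the values on the `dξ^a`
matter, and these are the local curvature. -/
theorem IsHorizontalLift.localChar_evalPolynomial (h : A.IsHorizontalLift φ θ) (i : B.Index)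
    {q : ℕ} (w : MultilinearMap ℝ (fun _ : Fin q => GroupLieAlgebra (𝓡 r) K) ℝ) :
    φ.localChar i (evalPolynomial e w fun a => Form.dfn (A.ξ (e.coord a))) =
      A.secPull i (evalPolynomial e w fun a => T.curvature e θ (e.coord a)) := by
  rw [QBundle.GaugeField.localChar, evalPolynomial_map, evalPolynomial_map, evalPolynomial_map]
  congr 1
  funext a
  rw [← h.fieldOn_linear]
  exact (congrArg (QManifold.fieldStrength φ.toGHom _ _ le_top (φ.mapsTo (B.U i)))
    ((B.τ i).pullForm_dfn (V := ⊤) le_rfl (fun _ _ => trivial) (A.ξ (e.coord a)))).trans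
      (Form.lift_dfn _ _)

/-- The characteristic class of an invariant polynomial is represented by its Chern–Weil form. -/
theorem IsHorizontalLift.exists_chernWeil (h : A.IsHorizontalLift φ θ) {q : ℕ}
    (w : MultilinearMap ℝ (fun _ : Fin q => GroupLieAlgebra (𝓡 r) K) ℝ)
    (hw : evalPolynomial e w (fun a => Form.dfn (A.ξ (e.coord a))) ∈
      GradedComplex.cocycles G.basicDeg (F.totalQ ⊤) (2 * q)) :
    ∃ c : GradedComplex.cocycles (N.deg ⊤) (N.Q ⊤) (2 * q),
      (∀ i, N.res le_top c.1 =
        A.secPull i (evalPolynomial e w fun a => T.curvature e θ (e.coord a))) ∧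
      (∀ c' : N.Fn ⊤, T.projT.pull ⊤ ⊤ le_top (fun _ _ => trivial) c' =
        evalPolynomial e w (fun a => T.curvature e θ (e.coord a)) → c' = c.1) ∧
      ∀ χ : QBundle.FiberCohomology G (2 * q) →ₗ[ℝ] QBundle.BaseCohomology N (2 * q),
        φ.IsCharacteristicMap (2 * q) χ →
        χ (GradedComplex.toCohomology _ _ _ ⟨_, hw⟩) = GradedComplex.toCohomology _ _ _ c := by
  obtain ⟨χ₀, hχ₀, huniq⟩ := φ.existsUnique_characteristicMap (G := G) (2 * q)
  obtain ⟨c, hc, hcχ⟩ := hχ₀ ⟨_, hw⟩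
  have hloc : ∀ i, N.res le_top c.1 =
      A.secPull i (evalPolynomial e w fun a => T.curvature e θ (e.coord a)) := fun i =>
    (hc i).trans (h.localChar_evalPolynomial i w)
  refine ⟨c, hloc, fun c' hc' => A.eq_of_projT_eq hloc hc', fun χ hχ => ?_⟩
  rw [huniq χ hχ, hcχ]

end AtiyahData

/-- Supplies the degree of smoothness that the Lie algebra structure on `GroupLieAlgebra` asks for.
-/
theorem LieGroup.minSmoothness_three {r : ℕ} (K : Type*) [TopologicalSpace K]
    [ChartedSpace (EuclideanSpace ℝ (Fin r)) K] [Group K] [LieGroup (𝓡 r) ∞ K] :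
    LieGroup (𝓡 r) (minSmoothness ℝ 3) K :=
  LieGroup.of_le (n := ∞) (by
    rw [minSmoothness_of_isRCLikeNormedField]
    exact WithTop.coe_le_coe.2 (le_top : (3 : ℕ∞) ≤ ⊤))

/-! ### The main theorem -/

theorem mainTheorem1 {M N F : QManifold.{u}} {G : HolonomyAlgebra F} (B : QBundle M N F G) :
    (∀ (φ : B.GaugeField) (p : ℕ),
      (∀ w ∈ G.basicDeg p, ∃! c : N.Fn ⊤, c ∈ N.deg ⊤ p ∧ φ.IsCharacteristicForm w c) ∧
      ∃! χ : QBundle.FiberCohomology G p →ₗ[ℝ] QBundle.BaseCohomology N p,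
        φ.IsCharacteristicMap p χ) ∧
    (∀ φ₀ φ₁ : B.GaugeField, φ₀.Homotopic φ₁ →
      ∀ (p : ℕ) (χ₀ χ₁ : QBundle.FiberCohomology G p →ₗ[ℝ] QBundle.BaseCohomology N p),
        φ₀.IsCharacteristicMap p χ₀ → φ₁.IsCharacteristicMap p χ₁ → χ₀ = χ₁) ∧
    (∀ (r : ℕ) (K : Type u) [TopologicalSpace K] [ChartedSpace (EuclideanSpace ℝ (Fin r)) K]
      [Group K] [LieGroup (𝓡 r) ∞ K] [T2Space K] [SecondCountableTopology K]
      (e : Module.Basis (Fin r) ℝ (GroupLieAlgebra (𝓡 r) K))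
      (T : TangentPrincipalBundle r K N) (A : AtiyahData B T e) (q : ℕ),
      G.basicDeg (2 * q + 1) = ⊥ ∧
      (∀ x ∈ G.basicDeg (2 * q), ∃! w : MultilinearMap ℝ (fun _ : Fin q =>
          GroupLieAlgebra (𝓡 r) K) ℝ, IsInvariantPolynomial w ∧
        x = evalPolynomial e w fun a => GradedManifold.Form.dfn (A.ξ (e.coord a))) ∧
      ∀ w : MultilinearMap ℝ (fun _ : Fin q => GroupLieAlgebra (𝓡 r) K) ℝ,
        IsInvariantPolynomial w →
        ∃ hw : evalPolynomial e w (fun a => GradedManifold.Form.dfn (A.ξ (e.coord a))) ∈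
            GradedComplex.cocycles G.basicDeg (F.totalQ ⊤) (2 * q),
        ∀ (φ : B.GaugeField)
          (θ : Module.Dual ℝ (GroupLieAlgebra (𝓡 r) K) →ₗ[ℝ] T.TP.Fn ⊤),
          T.IsConnection θ → A.IsHorizontalLift φ θ →
          ∃ c : GradedComplex.cocycles (N.deg ⊤) (N.Q ⊤) (2 * q),
            (∀ i, N.res le_top c.1 =
              A.secPull i (evalPolynomial e w fun a => T.curvature e θ (e.coord a))) ∧
            (∀ c' : N.Fn ⊤, T.projT.pull ⊤ ⊤ le_top (fun _ _ => trivial) c' =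
              evalPolynomial e w (fun a => T.curvature e θ (e.coord a)) → c' = c.1) ∧
            ∀ χ : QBundle.FiberCohomology G (2 * q) →ₗ[ℝ] QBundle.BaseCohomology N (2 * q),
              φ.IsCharacteristicMap (2 * q) χ →
              χ (GradedComplex.toCohomology _ _ _ ⟨_, hw⟩) =
                GradedComplex.toCohomology _ _ _ c) := by
  refine ⟨fun φ p => ⟨fun w hw => ?_, φ.existsUnique_characteristicMap p⟩,
    fun φ₀ φ₁ h p χ₀ χ₁ h₀ h₁ => h.characteristicMap_eq h₀ h₁, ?_⟩
  · obtain ⟨c, hc, hcw⟩ := φ.exists_characteristicForm hw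
    exact ⟨c, ⟨hc, hcw⟩, fun c' hc' => hc'.2.unique hcw⟩
  · intro r K _ _ _ _ _ _ e T A q
    have := LieGroup.minSmoothness_three (r := r) K
    -- The lemmas on `𝔨[1]` assume only a bracket; its bilinearity, packaged in `ad`, and its
    -- skewness are what they need.
    let ad : GroupLieAlgebra (𝓡 r) K →ₗ[ℝ] GroupLieAlgebra (𝓡 r) K →ₗ[ℝ] GroupLieAlgebra (𝓡 r) K :=
      LinearMap.mk₂ ℝ (fun x y => ⁅x, y⁆) (fun x y z => add_lie x y z) (fun t x y => smul_lie t x y)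
        (fun x y z => lie_add x y z) fun t x y => lie_smul t x y
    have had : ∀ x y, ad x y = ⁅x, y⁆ := fun _ _ => rfl
    have hskew : ∀ x y : GroupLieAlgebra (𝓡 r) K, ⁅x, y⁆ = -⁅y, x⁆ := fun x y =>
      (lie_skew x y).symm
    exact ⟨A.fiber.basicDeg_odd A.holonomy q,
      fun x hx => A.fiber.existsUnique_invariantPolynomial had hskew A.holonomy hx,
      fun w hw => ⟨A.fiber.evalPolynomial_mem_cocycles had hskew A.holonomy hw,
        fun φ θ _ hφ => hφ.exists_chernWeil w _⟩⟩
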